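/- Let $K\subset\mathbb R^3$ be a nondegenerate closed tetrahedron, and let $k\ge 3$, $\ell\ge\max\{k-1,3\}$ be integers. Let $\mathbb T$ be the space of trace-free real $3\times3$ matrices, let $\mathbb P_m(K;\mathbb X)$ be the $\mathbb X$-valued polynomials of total degree at most $m$, and $\mathbb P_m=\mathbb P_m(K;\mathbb R)$ (similarly on faces and edges). Differential operators act row-wise on matrices: $\operatorname{grad}u=(\partial_ju_i)$, $\operatorname{dev}A=A-\frac13\operatorname{tr}(A)I$, $\operatorname{sym}A=\frac12(A+A^{\intercal})$, $\operatorname{sym}\operatorname{curl}A=\operatorname{sym}(\operatorname{curl}A)$ and $\operatorname{div}\operatorname{div}A=\sum_{i,j}\partial_i\partial_jA_{ij}$. For a vector $n$, $\tau\times n$ is the row-wise cross product and $n\times\tau$ the column-wise one. On each face $F$ of $K$ let $n$ be the outward unit normal and $\operatorname{div}_F$ the surface divergence; for each edge $e$ let $n_1,n_2$ be two linearly independent vectors normal to $e$. Put $$B_{\ell+2}(K;\mathbb R^3)=\{v\in\mathbb P_{\ell+2}(K;\mathbb R^3): v|_{\partial K}=0\},$$ $$B_{\ell+1}(\operatorname{sym}\operatorname{curl},K;\mathbb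 T)=\{\tau\in\mathbb P_{\ell+1}(K;\mathbb T): (n\cdot\tau\times n)|_F=0,\ (n\times\operatorname{sym}(\tau\times n)\times n)|_F=0\ \text{ for every face }F\},$$ $$\Sigma_{\ell,k}(K)=\operatorname{sym}\operatorname{curl}\mathbb P_{\ell+1}(K;\mathbb T)+x x^{\intercal}\,\mathbb P_{k-2}(K),$$ and let $\mathring\Sigma_{\ell,k}(K)$ be the set of all $\tau\in\Sigma_{\ell,k}(K)$ such that - $\tau(\delta)=0$ at every vertex $\delta$ of $K$; - $\int_e (n_i^{\intercal}\tau n_j)\,q\,ds=0$ for every edge $e$, all $q\in\mathbb P_{\ell-2}(e)$ and $i,j\in\{1,2\}$; - $\int_F (n^{\intercal}\tau n)\,q\,dS=0$ for every face $F$ and all $q\in\mathbb P_{\ell-3}(F)$; - $\int_F \bigl(2\operatorname{div}_F(\tau n)+\partial_n(n^{\intercal}\tau n)\bigr)q\,dS=0$ for every face $F$ and all $q\in\mathbb P_{\ell-1}(F)$. Let $\mathbb P_1^{\perp}(K)$ be the $L^2(K)$-orthogonal complement of $\mathbb P_1(K)$, and let $b_K=\lambda_1\lambda_2\lambda_3\lambda_4$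 be the product of the barycentric coordinates of $K$. **Theorem.** One has $B_{\ell+2}(K;\mathbb R^3)=b_K\,\mathbb P_{\ell-2}(K;\mathbb R^3)$, and the sequence $$0\to B_{\ell+2}(K;\mathbb R^3)\xrightarrow{\operatorname{dev}\operatorname{grad}}B_{\ell+1}(\operatorname{sym}\operatorname{curl},K;\mathbb T)\xrightarrow{\operatorname{sym}\operatorname{curl}}\mathring\Sigma_{\ell,k}(K)\xrightarrow{\operatorname{div}\operatorname{div}}\mathbb P_{k-2}(K)\cap\mathbb P_1^{\perp}(K)\to0$$ is a well-defined exact Hilbert complex: the four spaces are Hilbert spaces under the $L^2(K)$ inner product, the operators are linear maps between the indicated spaces, the first is injective, the last is surjective, and the range of each map is the kernel of the next. In particular, $$\operatorname{sym}\operatorname{curl}B_{\ell+1}(\operatorname{sym}\operatorname{curl},K;\mathbb T)=\mathring\Sigma_{\ell,k}(K)\cap\ker(\operatorname{div}\operatorname{div}).$$ -/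

import Mathlib

namespace DivDiv

open MeasureTheory MvPolynomial
open scoped Matrix

noncomputable section

/-! ### Polynomial scalar, vector and tensor fields on three-space

Since a tetrahedron has nonempty interior, a polynomial function on it is the same thing as a
polynomial in the three coordinates. -/

/-- Points and constant vectors of three-space. -/
abbrev Vec : Type := Fin 3 → ℝ

/-- Scalar polynomial fields. -/
abbrev Poly : Type := MvPolynomial (Fin 3) ℝ

/-- Vector-valued polynomial fields. -/
abbrev PVec : Type := Fin 3 → Poly

/-- Matrix-valued polynomial fields. -/
abbrev PMat : Type := Matrix (Fin 3) (Fin 3) Poly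

/-- A constant vector, seen as a polynomial vector field. -/
def constVec (n : Vec) : PVec := fun i => C (n i)

/-- The value of a vector field at a point. -/
def evalVec (x : Vec) (v : PVec) : Vec := fun i => eval x (v i)

/-- The value of a matrix field at a point. -/
def evalMat (x : Vec) (τ : PMat) : Matrix (Fin 3) (Fin 3) ℝ := fun i j => eval x (τ i j)

/-! ### Polynomial spaces -/

/-- Scalar polynomials of total degree at most `m`. -/
def P (m : ℕ) : Submodule ℝ Poly := restrictTotalDegree (Fin 3) ℝ m

/-- Vector polynomials of total degree at most `m`. -/
def PV (m : ℕ) : Submodule ℝ PVec where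
  carrier := {v | ∀ i, v i ∈ P m}
  add_mem' ha hb i := (P m).add_mem (ha i) (hb i)
  zero_mem' _ := (P m).zero_mem
  smul_mem' c _ hv i := (P m).smul_mem c (hv i)

/-- Trace-free matrix polynomials of total degree at most `m`. -/
def PT (m : ℕ) : Submodule ℝ PMat where
  carrier := {τ | (∀ i j, τ i j ∈ P m) ∧ τ.trace = 0}
  add_mem' ha hb := ⟨fun i j => (P m).add_mem (ha.1 i j) (hb.1 i j), by
    rw [Matrix.trace_add, ha.2, hb.2, add_zero]⟩
  zero_mem' := ⟨fun _ _ => (P m).zero_mem, Matrix.trace_zero _ _⟩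
  smul_mem' c _ hv := ⟨fun i j => (P m).smul_mem c (hv.1 i j), by
    rw [Matrix.trace_smul, hv.2, smul_zero]⟩

/-! ### Matrix operations -/

/-- Symmetric part. -/
def symPart {R : Type*} [AddCommGroup R] [Module ℝ R] (A : Matrix (Fin 3) (Fin 3) R) :
    Matrix (Fin 3) (Fin 3) R := (1 / 2 : ℝ) • (A + Aᵀ)

/-- Deviatoric (trace-free) part. -/
def dev (A : PMat) : PMat := A - ((1 / 3 : ℝ) • A.trace) • (1 : PMat)

/-- `A × b`: the cross product from the right acts on the rows. -/
def crossRight (A : Matrix (Fin 3) (Fin 3) ℝ) (b : Vec) : Matrix (Fin 3) (Fin 3) ℝ :=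
  Matrix.of fun i => crossProduct (A i) b

/-- `b × A`: the cross product from the left acts on the columns. -/
def crossLeft (b : Vec) (A : Matrix (Fin 3) (Fin 3) ℝ) : Matrix (Fin 3) (Fin 3) ℝ :=
  (Matrix.of fun j => crossProduct b (Aᵀ j))ᵀ

/-! ### Differential operators (acting row-wise on matrices) -/

/-- Gradient of a scalar. -/
def gradS (p : Poly) : PVec := fun i => pderiv i p

/-- Gradient of a vector field: the matrix `(∂ⱼ uᵢ)`. -/
def gradV (u : PVec) : PMat := Matrix.of fun i => gradS (u i)

/-- Divergence of a vector field. -/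
def divV (u : PVec) : Poly := ∑ i, pderiv i (u i)

/-- Curl of a vector field. -/
def curlV (u : PVec) : PVec :=
  ![pderiv 1 (u 2) - pderiv 2 (u 1), pderiv 2 (u 0) - pderiv 0 (u 2),
    pderiv 0 (u 1) - pderiv 1 (u 0)]

/-- Row-wise curl of a matrix field. -/
def curlM (A : PMat) : PMat := Matrix.of fun i => curlV (A i)

/-- Row-wise divergence of a matrix field. -/
def divM (A : PMat) : PVec := fun i => divV (A i)

/-- The operator `dev grad`. -/
def devGrad : PVec →ₗ[ℝ] PMat where
  toFun u := dev (gradV u)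
  map_add' u v := by
    ext1 i j
    simp only [dev, gradV, gradS, Matrix.trace, Matrix.diag, Matrix.sub_apply, Matrix.add_apply,
      Matrix.of_apply, Matrix.smul_apply, Pi.add_apply, map_add, Finset.sum_add_distrib,
      smul_add, add_smul]
    ring
  map_smul' c u := by
    ext1 i j
    simp only [dev, gradV, gradS, Matrix.trace, Matrix.diag, Matrix.sub_apply,
      Matrix.of_apply, Matrix.smul_apply, Pi.smul_apply, Derivation.map_smul, ← Finset.smul_sum,
      RingHom.id_apply, smul_sub]
    rw [smul_comm (1 / 3 : ℝ) c, smul_assoc c]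

/-- The operator `sym curl`. -/
def symCurl : PMat →ₗ[ℝ] PMat where
  toFun A := symPart (curlM A)
  map_add' A B := by
    ext1 i j
    simp only [symPart, curlM, curlV, Matrix.add_apply, Matrix.of_apply, Matrix.smul_apply,
      Matrix.transpose_apply, map_add]
    fin_cases i <;> fin_cases j <;> simp [smul_add, smul_sub] <;> ring
  map_smul' c A := by
    ext1 i j
    simp only [symPart, curlM, curlV, Matrix.add_apply, Matrix.of_apply, Matrix.smul_apply,
      Matrix.transpose_apply, RingHom.id_apply]
    rw [smul_comm c]
    congr 1
    fin_cases i <;> fin_cases j <;> simp [smul_add, smul_sub]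

/-- The operator `div div`. -/
def divDiv : PMat →ₗ[ℝ] Poly where
  toFun A := divV (divM A)
  map_add' A B := by simp [divV, divM, Finset.sum_add_distrib]
  map_smul' c A := by simp [divV, divM, Finset.smul_sum]

/-- `n · τ · m` for constant vectors `n`, `m`. -/
def bilin (n m : Vec) (τ : PMat) : Poly := constVec n ⬝ᵥ (τ *ᵥ constVec m)

/-- The derivative `∂ₙ p = n · ∇ p`. -/
def normalDeriv (n : Vec) (p : Poly) : Poly := constVec n ⬝ᵥ gradS p

/-- The surface gradient `∇_F p = (n × ∇ p) × n` on a plane with unit normal `n`. -/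
def surfGrad (n : Vec) (p : Poly) : PVec :=
  crossProduct (crossProduct (constVec n) (gradS p)) (constVec n)

/-- The surface divergence `div_F v = ∇_F · v`. -/
def surfDiv (n : Vec) (v : PVec) : Poly := ∑ i, surfGrad n (v i) i

/-- The second trace `2 div_F (τ n) + ∂ₙ (n · τ · n)`. -/
def trace2 (n : Vec) (τ : PMat) : Poly :=
  2 * surfDiv n (τ *ᵥ constVec n) + normalDeriv n (bilin n n τ)

/-! ### Tetrahedra -/

/-- A nondegenerate tetrahedron. -/
abbrev Tetra : Type := Affine.Simplex ℝ Vec 3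

/-- The closed tetrahedron as a set. -/
def Tetra.body (K : Tetra) : Set Vec := convexHull ℝ (Set.range K.points)

/-- The vertices of the face opposite to vertex `i`. -/
def Tetra.fv (K : Tetra) (i : Fin 4) (j : Fin 3) : Vec := K.points (i.succAbove j)

/-- The closed face opposite to vertex `i`; the boundary of the tetrahedron is the union of the
four faces. -/
def Tetra.face (K : Tetra) (i : Fin 4) : Set Vec := convexHull ℝ (Set.range (K.fv i))

/-- A normal vector of face `i`, with length twice the area of the face. -/
def Tetra.areaVec (K : Tetra) (i : Fin 4) : Vec :=
  crossProduct (K.fv i 1 - K.fv i 0) (K.fv i 2 - K.fv i 0)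

/-- The outward unit normal of face `i`. -/
def Tetra.normal (K : Tetra) (i : Fin 4) : Vec :=
  (-((SignType.sign (K.areaVec i ⬝ᵥ (K.points i - K.fv i 0)) : SignType) : ℝ) /
    Real.sqrt (K.areaVec i ⬝ᵥ K.areaVec i)) • K.areaVec i

/-- The barycentric coordinate that is `1` at vertex `i` and `0` on face `i`. -/
def Tetra.bary (K : Tetra) (i : Fin 4) : Poly :=
  C (K.areaVec i ⬝ᵥ (K.points i - K.fv i 0))⁻¹ *
    ∑ j, C (K.areaVec i j) * (X j - C (K.fv i 0 j))

/-- The quartic bubble function. -/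
def Tetra.bubble (K : Tetra) : Poly := ∏ i, K.bary i

/-- A choice, for each edge of `K` (joining vertices `i < j`), of two linearly independent
vectors normal to the edge. -/
structure EdgeNormals (K : Tetra) where
  nrm : Fin 4 → Fin 4 → Fin 2 → Vec
  orthogonal : ∀ i j, i < j → ∀ a, nrm i j a ⬝ᵥ (K.points j - K.points i) = 0
  independent : ∀ i j, i < j → LinearIndependent ℝ (nrm i j)

/-! ### Integrals of polynomials over tetrahedra, faces and edges -/

theorem continuous_eval (p : Poly) : Continuous fun x : Vec => eval x p :=
  MvPolynomial.continuous_eval p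

theorem integrableOn_body (K : Tetra) (p : Poly) :
    IntegrableOn (fun x : Vec => eval x p) K.body :=
  (continuous_eval p).continuousOn.integrableOn_compact
    ((Set.finite_range K.points).isCompact_convexHull ℝ)

/-- The volume integral `∫_K p dx`. -/
def Tetra.volInt (K : Tetra) : Poly →ₗ[ℝ] ℝ where
  toFun p := ∫ x in K.body, eval x p
  map_add' p q := by
    simp only [map_add]
    exact integral_add (integrableOn_body K p) (integrableOn_body K q)
  map_smul' c p := by
    simp only [smul_eval, RingHom.id_apply, smul_eq_mul]
    rw [integral_const_mul]

/-- The reference triangle. -/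
def refTriangle : Set (ℝ × ℝ) := {s | 0 ≤ s.1 ∧ 0 ≤ s.2 ∧ s.1 + s.2 ≤ 1}

theorem isCompact_refTriangle : IsCompact refTriangle := by
  refine IsCompact.of_isClosed_subset (isCompact_Icc (a := ((0 : ℝ), (0 : ℝ))) (b := (1, 1)))
    ?_ ?_
  · exact (isClosed_le continuous_const continuous_fst).inter
      ((isClosed_le continuous_const continuous_snd).inter
        (isClosed_le (continuous_fst.add continuous_snd) continuous_const))
  · rintro ⟨s, t⟩ ⟨hs, ht, hst⟩
    simp only at hs ht hst
    exact ⟨⟨hs, ht⟩, ⟨by simp only; linarith, by simp only; linarith⟩⟩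

/-- The affine parametrization of face `i` over the reference triangle. -/
def Tetra.facePoint (K : Tetra) (i : Fin 4) (s : ℝ × ℝ) : Vec :=
  K.fv i 0 + s.1 • (K.fv i 1 - K.fv i 0) + s.2 • (K.fv i 2 - K.fv i 0)

theorem integrableOn_face (K : Tetra) (i : Fin 4) (p : Poly) :
    IntegrableOn (fun s => eval (K.facePoint i s) p) refTriangle := by
  refine ContinuousOn.integrableOn_compact isCompact_refTriangle (Continuous.continuousOn ?_)
  refine (continuous_eval p).comp ?_
  unfold Tetra.facePoint
  fun_prop

/-- The surface integral `∫_F p dS` over face `i`. -/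
def Tetra.faceInt (K : Tetra) (i : Fin 4) : Poly →ₗ[ℝ] ℝ where
  toFun p := Real.sqrt (K.areaVec i ⬝ᵥ K.areaVec i) *
    ∫ s in refTriangle, eval (K.facePoint i s) p
  map_add' p q := by
    simp only [map_add]
    rw [integral_add (integrableOn_face K i p) (integrableOn_face K i q), mul_add]
  map_smul' c p := by
    simp only [smul_eval, RingHom.id_apply, smul_eq_mul]
    rw [integral_const_mul]
    ring

/-- The affine parametrization of the edge from vertex `i` to vertex `j`. -/
def Tetra.edgePoint (K : Tetra) (i j : Fin 4) (t : ℝ) : Vec :=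
  K.points i + t • (K.points j - K.points i)

theorem intervalIntegrable_edge (K : Tetra) (i j : Fin 4) (p : Poly) :
    IntervalIntegrable (fun t => eval (K.edgePoint i j t) p) volume 0 1 := by
  refine Continuous.intervalIntegrable ((continuous_eval p).comp ?_) 0 1
  unfold Tetra.edgePoint
  fun_prop

/-- The line integral `∫_e p ds` over the edge joining vertices `i` and `j`. -/
def Tetra.edgeInt (K : Tetra) (i j : Fin 4) : Poly →ₗ[ℝ] ℝ where
  toFun p := Real.sqrt ((K.points j - K.points i) ⬝ᵥ (K.points j - K.points i)) *
    ∫ t in (0 : ℝ)..1, eval (K.edgePoint i j t) p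
  map_add' p q := by
    simp only [map_add]
    rw [intervalIntegral.integral_add (intervalIntegrable_edge K i j p)
      (intervalIntegrable_edge K i j q), mul_add]
  map_smul' c p := by
    simp only [smul_eval, RingHom.id_apply, smul_eq_mul]
    rw [intervalIntegral.integral_const_mul]
    ring

/-! ### Linearity of the traces -/

theorem bilin_add (n m : Vec) (σ τ : PMat) : bilin n m (σ + τ) = bilin n m σ + bilin n m τ := by
  simp [bilin, Matrix.add_mulVec]

theorem bilin_smul (n m : Vec) (c : ℝ) (τ : PMat) : bilin n m (c • τ) = c • bilin n m τ := by
  simp [bilin, Matrix.smul_mulVec]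

theorem gradS_add (p q : Poly) : gradS (p + q) = gradS p + gradS q := by
  ext1 i; simp [gradS]

theorem gradS_smul (c : ℝ) (p : Poly) : gradS (c • p) = c • gradS p := by
  ext1 i; simp [gradS]

theorem trace2_add (n : Vec) (σ τ : PMat) : trace2 n (σ + τ) = trace2 n σ + trace2 n τ := by
  simp only [trace2, surfDiv, surfGrad, normalDeriv, bilin_add, Matrix.add_mulVec, Pi.add_apply,
    gradS_add, map_add, LinearMap.add_apply, dotProduct_add, Finset.sum_add_distrib]
  ring

theorem crossProduct_smul_smul (c : ℝ) (u v w : PVec) :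
    crossProduct (crossProduct u (c • v)) w = c • crossProduct (crossProduct u v) w := by
  ext1 i
  fin_cases i <;> simp [cross_apply, smul_sub, sub_mul]

theorem trace2_smul (n : Vec) (c : ℝ) (τ : PMat) : trace2 n (c • τ) = c • trace2 n τ := by
  simp only [trace2, surfDiv, surfGrad, normalDeriv, bilin_smul, Matrix.smul_mulVec,
    Pi.smul_apply, gradS_smul, crossProduct_smul_smul, dotProduct_smul, ← Finset.smul_sum,
    smul_add, mul_smul_comm]

/-! ### The spaces of the bubble complex -/

/-- Vector polynomials of degree at most `m` that vanish on the boundary of `K`. -/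
def vecBubble (K : Tetra) (m : ℕ) : Submodule ℝ PVec where
  carrier := {v | v ∈ PV m ∧ ∀ i, ∀ x ∈ K.face i, evalVec x v = 0}
  add_mem' {a b} ha hb := ⟨(PV m).add_mem ha.1 hb.1, fun i x hx => by
    have h1 := ha.2 i x hx
    have h2 := hb.2 i x hx
    ext j
    have h3 := congrFun h1 j
    have h4 := congrFun h2 j
    simp only [evalVec, Pi.zero_apply] at h3 h4
    simp [evalVec, h3, h4]⟩
  zero_mem' := ⟨(PV m).zero_mem, fun i x hx => by ext j; simp [evalVec]⟩
  smul_mem' c v hv := ⟨(PV m).smul_mem c hv.1, fun i x hx => by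
    ext j
    have h3 := congrFun (hv.2 i x hx) j
    simp only [evalVec, Pi.zero_apply] at h3
    simp [evalVec, h3]⟩

/-- The space `b_K P_m(K; ℝ³)`. -/
def bubbleTimes (K : Tetra) (m : ℕ) : Submodule ℝ PVec :=
  (PV m).map (LinearMap.lsmul Poly PVec K.bubble |>.restrictScalars ℝ)

/-- The trace `n · A × n` at a point where the field has the value `A`. -/
def trN (n : Vec) (A : Matrix (Fin 3) (Fin 3) ℝ) : Vec := n ᵥ* crossRight A n

/-- The trace `n × sym (A × n) × n` at a point where the field has the value `A`. -/
def trT (n : Vec) (A : Matrix (Fin 3) (Fin 3) ℝ) : Matrix (Fin 3) (Fin 3) ℝ :=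
  crossRight (crossLeft n (symPart (crossRight A n))) n

theorem evalMat_add (x : Vec) (σ τ : PMat) :
    evalMat x (σ + τ) = evalMat x σ + evalMat x τ := by
  ext i j; simp [evalMat]

theorem evalMat_smul (x : Vec) (c : ℝ) (τ : PMat) : evalMat x (c • τ) = c • evalMat x τ := by
  ext i j; simp [evalMat]

theorem evalMat_zero (x : Vec) : evalMat x 0 = 0 := by
  ext i j; simp [evalMat]

theorem crossRight_add (A B : Matrix (Fin 3) (Fin 3) ℝ) (n : Vec) :
    crossRight (A + B) n = crossRight A n + crossRight B n := by
  ext i j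
  change crossProduct (A i + B i) n j = crossProduct (A i) n j + crossProduct (B i) n j
  simp

theorem crossRight_smul (c : ℝ) (A : Matrix (Fin 3) (Fin 3) ℝ) (n : Vec) :
    crossRight (c • A) n = c • crossRight A n := by
  ext i j
  change crossProduct (c • A i) n j = c • crossProduct (A i) n j
  simp

theorem crossLeft_add (A B : Matrix (Fin 3) (Fin 3) ℝ) (n : Vec) :
    crossLeft n (A + B) = crossLeft n A + crossLeft n B := by
  ext i j
  change crossProduct n (Aᵀ j + Bᵀ j) i = crossProduct n (Aᵀ j) i + crossProduct n (Bᵀ j) i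
  simp

theorem crossLeft_smul (c : ℝ) (A : Matrix (Fin 3) (Fin 3) ℝ) (n : Vec) :
    crossLeft n (c • A) = c • crossLeft n A := by
  ext i j
  change crossProduct n (c • Aᵀ j) i = c • crossProduct n (Aᵀ j) i
  simp

theorem trN_add (n : Vec) (A B : Matrix (Fin 3) (Fin 3) ℝ) :
    trN n (A + B) = trN n A + trN n B := by
  simp [trN, crossRight_add, Matrix.vecMul_add]

theorem trN_smul (n : Vec) (c : ℝ) (A : Matrix (Fin 3) (Fin 3) ℝ) :
    trN n (c • A) = c • trN n A := by
  simp [trN, crossRight_smul, Matrix.vecMul_smul]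

theorem symPart_add (A B : Matrix (Fin 3) (Fin 3) ℝ) :
    symPart (A + B) = symPart A + symPart B := by
  simp only [symPart, Matrix.transpose_add, ← smul_add]
  congr 1
  abel

theorem symPart_smul (c : ℝ) (A : Matrix (Fin 3) (Fin 3) ℝ) :
    symPart (c • A) = c • symPart A := by
  simp only [symPart, Matrix.transpose_smul, ← smul_add]
  rw [smul_comm]

theorem trT_add (n : Vec) (A B : Matrix (Fin 3) (Fin 3) ℝ) :
    trT n (A + B) = trT n A + trT n B := by
  simp only [trT, crossRight_add, symPart_add, crossLeft_add]

theorem trT_smul (n : Vec) (c : ℝ) (A : Matrix (Fin 3) (Fin 3) ℝ) :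
    trT n (c • A) = c • trT n A := by
  simp only [trT, crossRight_smul, symPart_smul, crossLeft_smul]

/-- `B_m(sym curl, K; T)`: trace-free polynomial tensors of degree at most `m` whose two
`sym curl` traces vanish on every face. -/
def symCurlBubble (K : Tetra) (m : ℕ) : Submodule ℝ PMat where
  carrier := {τ | τ ∈ PT m ∧ ∀ i, ∀ x ∈ K.face i,
    trN (K.normal i) (evalMat x τ) = 0 ∧ trT (K.normal i) (evalMat x τ) = 0}
  add_mem' ha hb := ⟨(PT m).add_mem ha.1 hb.1, fun i x hx => by
    rw [evalMat_add, trN_add, trT_add, (ha.2 i x hx).1, (ha.2 i x hx).2, (hb.2 i x hx).1,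
      (hb.2 i x hx).2]
    simp⟩
  zero_mem' := ⟨(PT m).zero_mem, fun i x hx => by
    have h1 := trN_smul (K.normal i) 0 (evalMat x 0)
    have h2 := trT_smul (K.normal i) 0 (evalMat x 0)
    rw [evalMat_zero, zero_smul, zero_smul] at h1 h2
    rw [evalMat_zero]
    exact ⟨h1, h2⟩⟩
  smul_mem' c _ hv := ⟨(PT m).smul_mem c hv.1, fun i x hx => by
    rw [evalMat_smul, trN_smul, trT_smul, (hv.2 i x hx).1, (hv.2 i x hx).2]
    simp⟩

/-- The map `q ↦ x xᵀ q`. -/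
def xxT : Poly →ₗ[ℝ] PMat where
  toFun q := Matrix.of fun i j => X i * X j * q
  map_add' p q := by ext1 i j; simp [mul_add]
  map_smul' c p := by ext1 i j; simp

/-- The shape functions `sym curl P_{ℓ+1}(K; T) + x xᵀ P_{k-2}(K)`. -/
def shape (l k : ℕ) : Submodule ℝ PMat :=
  (PT (l + 1)).map symCurl ⊔ (P (k - 2)).map xxT

/-- The `div div` bubbles: shape functions whose degrees of freedom at vertices, on edges and on
faces all vanish. A polynomial on an edge or on a face is the restriction of a polynomial in the
three coordinates of the same degree. -/
def sigmaBubble (K : Tetra) (N : EdgeNormals K) (l k : ℕ) : Submodule ℝ PMat where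
  carrier := {τ | τ ∈ shape l k ∧
    (∀ i, evalMat (K.points i) τ = 0) ∧
    (∀ i j, i < j → ∀ a b, ∀ q ∈ P (l - 2),
      K.edgeInt i j (bilin (N.nrm i j a) (N.nrm i j b) τ * q) = 0) ∧
    (∀ i, ∀ q ∈ P (l - 3), K.faceInt i (bilin (K.normal i) (K.normal i) τ * q) = 0) ∧
    (∀ i, ∀ q ∈ P (l - 1), K.faceInt i (trace2 (K.normal i) τ * q) = 0)}
  add_mem' ha hb := by
    refine ⟨Submodule.add_mem _ ha.1 hb.1, fun i => ?_, fun i j hij a b q hq => ?_,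
      fun i q hq => ?_, fun i q hq => ?_⟩
    · rw [evalMat_add, ha.2.1 i, hb.2.1 i, add_zero]
    · rw [bilin_add, add_mul, map_add, ha.2.2.1 i j hij a b q hq, hb.2.2.1 i j hij a b q hq,
        add_zero]
    · rw [bilin_add, add_mul, map_add, ha.2.2.2.1 i q hq, hb.2.2.2.1 i q hq, add_zero]
    · rw [trace2_add, add_mul, map_add, ha.2.2.2.2 i q hq, hb.2.2.2.2 i q hq, add_zero]
  zero_mem' := by
    have h1 : ∀ n m, bilin n m (0 : PMat) = 0 := fun n m => by simp [bilin]
    have h2 : ∀ n, trace2 n (0 : PMat) = 0 := fun n => by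
      simpa using trace2_smul n 0 (0 : PMat)
    refine ⟨Submodule.zero_mem _, fun i => evalMat_zero _, fun i j hij a b q hq => ?_,
      fun i q hq => ?_, fun i q hq => ?_⟩
    · rw [h1, zero_mul, map_zero]
    · rw [h1, zero_mul, map_zero]
    · rw [h2, zero_mul, map_zero]
  smul_mem' c _ hv := by
    refine ⟨Submodule.smul_mem _ c hv.1, fun i => ?_, fun i j hij a b q hq => ?_,
      fun i q hq => ?_, fun i q hq => ?_⟩
    · rw [evalMat_smul, hv.2.1 i, smul_zero]
    · rw [bilin_smul, smul_mul_assoc, map_smul, hv.2.2.1 i j hij a b q hq, smul_zero]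
    · rw [bilin_smul, smul_mul_assoc, map_smul, hv.2.2.2.1 i q hq, smul_zero]
    · rw [trace2_smul, smul_mul_assoc, map_smul, hv.2.2.2.2 i q hq, smul_zero]

/-- Polynomials of degree at most `m` that are `L²(K)`-orthogonal to all affine functions. -/
def orthP1 (K : Tetra) (m : ℕ) : Submodule ℝ Poly where
  carrier := {q | q ∈ P m ∧ ∀ p ∈ P 1, K.volInt (q * p) = 0}
  add_mem' ha hb := ⟨(P m).add_mem ha.1 hb.1, fun p hp => by
    rw [add_mul, map_add, ha.2 p hp, hb.2 p hp, add_zero]⟩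
  zero_mem' := ⟨(P m).zero_mem, fun p _ => by rw [zero_mul, map_zero]⟩
  smul_mem' c _ hv := ⟨(P m).smul_mem c hv.1, fun p hp => by
    rw [smul_mul_assoc, map_smul, hv.2 p hp, smul_zero]⟩

/-! ### `L²(K)` inner products and Hilbert spaces -/

/-- The `L²(K)` inner product of scalar fields. -/
def innerS (K : Tetra) (p q : Poly) : ℝ := K.volInt (p * q)

/-- The `L²(K)` inner product of vector fields. -/
def innerV (K : Tetra) (u v : PVec) : ℝ := K.volInt (∑ i, u i * v i)

/-- The `L²(K)` inner product of matrix fields. -/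
def innerM (K : Tetra) (σ τ : PMat) : ℝ := K.volInt (∑ i, ∑ j, σ i j * τ i j)

/-- The subspace `V` is a Hilbert space under the form `ip`: the restriction of `ip` to `V` is an
inner product, for whose norm `V` is complete. -/
def IsHilbert {M : Type*} [AddCommGroup M] [Module ℝ M] (ip : M → M → ℝ) (V : Submodule ℝ M) :
    Prop :=
  ∃ c : InnerProductSpace.Core ℝ V, (∀ x y : V, c.inner x y = ip x y) ∧
    @CompleteSpace V (@InnerProductSpace.Core.toNormedAddCommGroup ℝ V _ _ _
      c).toMetricSpace.toUniformSpace

end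

end DivDiv

/-! ### Polynomial degrees, inverses of Euler operators, and the Poincaré lemma for gradients. -/

namespace DivDiv

open MeasureTheory MvPolynomial
open scoped Matrix

noncomputable section

/-! ### Degrees of polynomials -/

/-! The whole argument is carried out in the polynomial ring. Vanishing on face `d` means
divisibility by the barycentric coordinate `K.bary d`, and vanishing on an edge means membership in
the ideal generated by the two barycentric coordinates that are zero there. In these terms a vector
bubble has components divisible by all four coordinates. A tensor is a `sym curl` bubble when on
each face it maps every tangent vector to a multiple of itself (`mem_symCurlBubble`). A shape
function is a `div div` bubble when its normal-normal component and second trace vanish on the faces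
and its mixed normal components vanish on the edges (`mem_sigmaBubble`). The last equivalence is a
unisolvence argument: the shape space may have degree `l + 1`, but its traces only have degree `l`,
or `l - 1` for the second trace.

Exactness at the tensors: the polynomial complex gives `τ = dev grad v`, and the trace conditions
force `v` to be of the form `a + b x` on each face. Two faces share two vertices, so it is the same
field on all faces and can be subtracted (`exists_vecBubble_devGrad_eq`).

Exactness at the `div div` bubbles: `div div` is injective on the summand `x xᵀ q`, so a bubble in
the kernel is `sym curl τ` for some `τ`, in general without vanishing traces. On each face the trace
conditions are exactly the compatibility conditions for a potential, unique up to fields `a + b x`.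
The edge conditions make potentials on adjacent faces differ on the common edge only by such a
field. These discrepancies can be normalised away, a cycle around each vertex showing consistency,
and the face data extend to the tetrahedron (`Tetra.exists_potential`). Correcting `τ` by the
resulting deviatoric gradient puts it into the bubble space.

Surjectivity: Green's formula puts the range inside the orthogonal complement of the affine
functions. For `k ≤ l`, a function orthogonal to the range is tested against `div div` of `λ_a² λ_b²
v t tᵀ`, where `t` is an edge and `v` its second derivative along `t`. So all second derivatives
along edges vanish, the function is affine, and being orthogonal to affine functions it is zero. For
`k = l + 1` such test tensors may leave the shape space. An explicit bubble with leading part a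
multiple of `x xᵀ q₀` matches the top-degree part of the target, and the remainder falls under the
case `k = l` (`map_divDiv_eq`). -/

theorem mem_P {m : ℕ} {p : Poly} : p ∈ P m ↔ p.totalDegree ≤ m := mem_restrictTotalDegree ..

theorem P_mono {a b : ℕ} (h : a ≤ b) : P a ≤ P b := fun _ hp => mem_P.2 ((mem_P.1 hp).trans h)

theorem PV_mono {a b : ℕ} (h : a ≤ b) : PV a ≤ PV b := fun _ hp i => P_mono h (hp i)

theorem C_mem_P (c : ℝ) (m : ℕ) : (C c : Poly) ∈ P m := mem_P.2 (by simp)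

theorem X_mem_P (i : Fin 3) : (X i : Poly) ∈ P 1 := mem_P.2 (by simp)

theorem mul_mem_P {a b : ℕ} {p q : Poly} (hp : p ∈ P a) (hq : q ∈ P b) : p * q ∈ P (a + b) :=
  mem_P.2 ((totalDegree_mul _ _).trans (add_le_add (mem_P.1 hp) (mem_P.1 hq)))

theorem C_mul_mem_P {m : ℕ} {p : Poly} (c : ℝ) (hp : p ∈ P m) : C c * p ∈ P m := by
  simpa using mul_mem_P (C_mem_P c 0) hp

theorem pderiv_mem_P {m : ℕ} {p : Poly} (i : Fin 3) (hp : p ∈ P m) : pderiv i p ∈ P (m - 1) := by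
  classical
  rw [mem_P] at hp ⊢
  rw [totalDegree, Finset.sup_le_iff] at hp ⊢
  intro s hs
  have h1 : s + Finsupp.single i 1 ∈ p.support := by
    rw [mem_support_iff] at hs ⊢
    rw [coeff_pderiv] at hs
    exact left_ne_zero_of_mul hs
  have h2 := hp _ h1
  rw [Finsupp.sum_add_index' (by simp) (by simp), Finsupp.sum_single_index rfl] at h2
  omega

theorem totalDegree_aeval_le {σ τ : Type*} {f : σ → MvPolynomial τ ℝ}
    (hf : ∀ i, (f i).totalDegree ≤ 1) (p : MvPolynomial σ ℝ) :
    (aeval f p).totalDegree ≤ p.totalDegree := by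
  classical
  conv_lhs => rw [p.as_sum]
  rw [map_sum]
  refine (totalDegree_finsetSum _ _).trans (Finset.sup_le fun s hs => ?_)
  rw [aeval_monomial]
  refine (totalDegree_mul _ _).trans ?_
  have h1 : (algebraMap ℝ (MvPolynomial τ ℝ) (coeff s p)).totalDegree = 0 := totalDegree_C _
  rw [h1, zero_add]
  refine le_trans ?_ (le_totalDegree hs)
  refine (totalDegree_finsetProd _ _).trans (Finset.sum_le_sum fun i _ => ?_)
  refine (totalDegree_pow _ _).trans ?_
  simpa using Nat.mul_le_mul_left (s i) (hf i)

theorem mem_P_of_mul_mem {m : ℕ} {p q : Poly} (hp : p.totalDegree = 1) (h : p * q ∈ P (m + 1)) :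
    q ∈ P m := by
  by_cases hq : q = 0
  · rw [hq]; exact Submodule.zero_mem _
  · have hp0 : p ≠ 0 := by rintro rfl; simp at hp
    rw [mem_P, totalDegree_mul_of_isDomain hp0 hq, hp] at h
    rw [mem_P]; omega

/-- A slack exponent turns monomials of degree at most `m` in `n` variables into monomials of degree
exactly `m` in `n + 1` variables. Its use here is to make `P m` finite-dimensional. -/
theorem finrank_restrictTotalDegree (n m : ℕ) :
    Module.finrank ℝ (restrictTotalDegree (Fin n) ℝ m) = (m + n).choose n := by
  classical
  let e : {s : Fin n →₀ ℕ | (s.sum fun _ e => e) ≤ m} ≃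
      (Finset.univ : Finset (Fin (n + 1))).finsuppAntidiag m :=
    { toFun := fun s => ⟨Finsupp.cons (m - s.1.sum fun _ e => e) s.1, by
        have h := s.2
        simp only [Set.mem_ofPred_eq] at h
        rw [Finsupp.sum_fintype _ _ (by simp)] at h ⊢
        simp only [Finset.mem_finsuppAntidiag, Fin.sum_univ_succ, Finsupp.cons_zero,
          Finsupp.cons_succ, Finset.subset_univ, and_true]
        omega⟩
      invFun := fun s => ⟨s.1.tail, by
        have h := s.2
        simp only [Finset.mem_finsuppAntidiag, Fin.sum_univ_succ, Finset.subset_univ,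
          and_true] at h
        simp only [Set.mem_ofPred_eq]
        rw [Finsupp.sum_fintype _ _ (by simp)]
        simp only [Finsupp.tail_apply]
        omega⟩
      left_inv := fun s => by simp
      right_inv := fun s => by
        have h := s.2
        simp only [Finset.mem_finsuppAntidiag, Fin.sum_univ_succ, Finset.subset_univ,
          and_true] at h
        apply Subtype.ext
        ext j
        refine Fin.cases ?_ (fun j => ?_) j
        · simp only [Finsupp.cons_zero]
          rw [Finsupp.sum_fintype _ _ (by simp)]
          simp only [Finsupp.tail_apply]
          omega
        · simp [Finsupp.tail_apply] }
  have h1 := Module.finrank_eq_nat_card_basis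
    (basisRestrictSupport ℝ {s : Fin n →₀ ℕ | (s.sum fun _ e => e) ≤ m})
  rw [Nat.card_congr e, Nat.card_eq_fintype_card, Fintype.card_coe,
    Finset.card_finsuppAntidiag_nat_eq_choose, Finset.card_univ, Fintype.card_fin] at h1
  have h2 : n + 1 + m - 1 = m + n := by omega
  rw [h2, ← Nat.choose_symm (Nat.le_add_right m n), Nat.add_sub_cancel_left] at h1
  exact h1

/-! ### The Euler operator and the Poincaré lemma -/

/-- The inverse of the operator `x · ∇ + c`. -/
def invEuler (c : ℝ) : Poly →ₗ[ℝ] Poly :=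
  (basisMonomials (Fin 3) ℝ).constr ℝ fun s => monomial s (1 / (s.degree + c))

theorem invEuler_monomial (c : ℝ) (s : Fin 3 →₀ ℕ) (r : ℝ) :
    invEuler c (monomial s r) = monomial s (r / (s.degree + c)) := by
  have h : monomial s r = r • (basisMonomials (Fin 3) ℝ s) := by simp [smul_monomial]
  rw [h, map_smul, invEuler, Module.Basis.constr_basis, smul_monomial]
  congr 1
  simp [div_eq_mul_inv]

/-- A derivative lowers the degree by one, so the constant rises by one to keep the same
denominator. -/
theorem pderiv_invEuler (c : ℝ) (i : Fin 3) (p : Poly) :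
    pderiv i (invEuler c p) = invEuler (c + 1) (pderiv i p) := by
  induction p using MvPolynomial.induction_on' with
  | monomial s r =>
    rw [invEuler_monomial, pderiv_monomial, pderiv_monomial, invEuler_monomial]
    by_cases h : s i = 0
    · simp [h]
    · have h1 : (s - Finsupp.single i 1).degree + 1 = s.degree := by
        have : s - Finsupp.single i 1 + Finsupp.single i 1 = s :=
          tsub_add_cancel_of_le (by simpa using Nat.one_le_iff_ne_zero.2 h)
        conv_rhs => rw [← this]
        simp
      rw [← h1]
      congr 1
      push_cast
      ring
  | add p q hp hq => simp only [map_add, hp, hq]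

theorem invEuler_mem_P {m : ℕ} (c : ℝ) {p : Poly} (hp : p ∈ P m) : invEuler c p ∈ P m := by
  rw [p.as_sum, map_sum]
  refine Submodule.sum_mem _ fun s hs => ?_
  rw [invEuler_monomial, mem_P]
  exact (totalDegree_monomial_le _ _).trans ((le_totalDegree hs).trans (mem_P.1 hp))

theorem sum_X_mul_pderiv_monomial (s : Fin 3 →₀ ℕ) (r : ℝ) :
    ∑ j, X j * pderiv j (monomial s r) = C (s.degree : ℝ) * monomial s r := by
  simp_rw [X_mul_pderiv_monomial]
  rw [← Finset.sum_smul, nsmul_eq_mul, ← Finsupp.degree_eq_sum]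
  simp

theorem euler_invEuler {c : ℝ} (hc : 0 < c) (p : Poly) :
    ∑ j, X j * pderiv j (invEuler c p) + C c * invEuler c p = p := by
  induction p using MvPolynomial.induction_on' with
  | monomial s r =>
    rw [invEuler_monomial, sum_X_mul_pderiv_monomial, ← add_mul, ← C_add, C_mul_monomial]
    congr 1
    have : (s.degree : ℝ) + c ≠ 0 := by positivity
    field_simp
  | add p q hp hq =>
    conv_rhs => rw [← hp, ← hq]
    simp only [map_add, mul_add, Finset.sum_add_distrib]
    ring

theorem invEuler_euler {c : ℝ} (hc : 0 < c) (p : Poly) :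
    invEuler c (∑ j, X j * pderiv j p + C c * p) = p := by
  induction p using MvPolynomial.induction_on' with
  | monomial s r =>
    rw [sum_X_mul_pderiv_monomial, ← add_mul, ← C_add, C_mul_monomial, invEuler_monomial]
    congr 1
    have : (s.degree : ℝ) + c ≠ 0 := by positivity
    field_simp
  | add p q hp hq =>
    conv_rhs => rw [← hp, ← hq]
    rw [← map_add]
    congr 1
    simp only [map_add, mul_add, Finset.sum_add_distrib]
    ring

/-- The potential is the line integral of `x · w(tx)` over `t` in `[0, 1]`; on a monomial of degree
`n` the integral of `tⁿ` is `1 / (n + 1)`, which is `invEuler 1`. -/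
theorem exists_gradS_eq {m : ℕ} {w : PVec} (hw : w ∈ PV m) (hc : curlV w = 0) :
    ∃ s ∈ P (m + 1), gradS s = w := by
  have h0 := congrFun hc 0
  have h1 := congrFun hc 1
  have h2 := congrFun hc 2
  simp only [curlV, Matrix.cons_val, Pi.zero_apply, sub_eq_zero] at h0 h1 h2
  refine ⟨∑ j, X j * invEuler 1 (w j), Submodule.sum_mem _ fun j _ => ?_, ?_⟩
  · rw [add_comm]
    exact mul_mem_P (X_mem_P j) (invEuler_mem_P 1 (hw j))
  · have key : ∀ i j, pderiv i (w j) = pderiv j (w i) := by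
      intro i j
      fin_cases i <;> fin_cases j <;> simp [h0, h1, h2]
    funext i
    have e := euler_invEuler one_pos (w i)
    have h3 : ∀ j, pderiv i (invEuler 1 (w j)) = pderiv j (invEuler 1 (w i)) := fun j => by
      rw [pderiv_invEuler, pderiv_invEuler, key]
    have h4 : ∑ j, pderiv i (X j) * invEuler 1 (w j) = invEuler 1 (w i) := by
      simp_rw [pderiv_X, Pi.single_apply]
      simp
    simp only [gradS, map_sum, pderiv_mul, Finset.sum_add_distrib, h3, h4]
    simp only [C_1, one_mul] at e
    rw [add_comm, e]

theorem eq_C_of_pderiv_eq_zero {p : Poly} (h : ∀ i, pderiv i p = 0) : p = C (coeff 0 p) := by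
  ext s
  rw [coeff_C]
  split_ifs with hs
  · rw [hs]
  · obtain ⟨i, hi⟩ : ∃ i, s i ≠ 0 := by
      by_contra! hcon
      exact hs (Finsupp.ext fun i => by simp [hcon i])
    have h1 : s - Finsupp.single i 1 + Finsupp.single i 1 = s :=
      tsub_add_cancel_of_le (by simpa using Nat.one_le_iff_ne_zero.2 hi)
    have h2 := coeff_pderiv (i := i) p (s - Finsupp.single i 1)
    rw [h i, h1] at h2
    simp only [coeff_zero] at h2
    rcases mul_eq_zero.1 h2.symm with h3 | h3
    · exact h3
    · exfalso
      have : ((s - Finsupp.single i 1 : Fin 3 →₀ ℕ) i : ℝ) + 1 ≠ 0 := by positivity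
      exact this h3

end

end DivDiv

/-! ### Directional derivatives, barycentric coordinates and affine charts. -/

namespace DivDiv

open MeasureTheory MvPolynomial
open scoped Matrix

noncomputable section

/-! ### Directional derivatives -/

/-- The derivative in the direction of a constant vector, as a derivation. -/
def dirD (w : Vec) : Derivation ℝ Poly Poly := ∑ i, w i • pderiv i

theorem dirD_apply (w : Vec) (p : Poly) : dirD w p = ∑ i, C (w i) * pderiv i p := by
  have h : ∀ s : Finset (Fin 3), (∑ i ∈ s, w i • pderiv (R := ℝ) i) p =
      ∑ i ∈ s, w i • pderiv i p := by
    intro s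
    induction s using Finset.induction_on with
    | empty => simp
    | insert a s ha ih => rw [Finset.sum_insert ha, Finset.sum_insert ha, Derivation.add_apply, ih,
        Derivation.smul_apply]
  rw [dirD, h]
  simp_rw [smul_eq_C_mul]

theorem normalDeriv_eq_dirD (w : Vec) (p : Poly) : normalDeriv w p = dirD w p := by
  rw [dirD_apply, normalDeriv]
  rfl

theorem dirD_add_left (v w : Vec) (p : Poly) : dirD (v + w) p = dirD v p + dirD w p := by
  simp [dirD_apply, add_mul, Finset.sum_add_distrib]

theorem dirD_smul_left (c : ℝ) (w : Vec) (p : Poly) : dirD (c • w) p = C c * dirD w p := by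
  simp [dirD_apply, Finset.mul_sum, mul_assoc]

theorem dirD_sub_left (v w : Vec) (p : Poly) : dirD (v - w) p = dirD v p - dirD w p := by
  simp [dirD_apply, sub_mul, Finset.sum_sub_distrib]

theorem dirD_mul (w : Vec) (p q : Poly) : dirD w (p * q) = dirD w p * q + p * dirD w q := by
  rw [Derivation.leibniz, smul_eq_mul, smul_eq_mul]; ring

theorem dirD_C (w : Vec) (c : ℝ) : dirD w (C c) = 0 := derivation_C _ _

theorem dirD_C_mul (w : Vec) (c : ℝ) (p : Poly) : dirD w (C c * p) = C c * dirD w p := by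
  rw [dirD_mul, dirD_C, zero_mul, zero_add]

theorem dirD_X (w : Vec) (i : Fin 3) : dirD w (X i) = C (w i) := by
  simp [dirD_apply, pderiv_X, Pi.single_apply]

theorem dirD_mem_P {m : ℕ} (w : Vec) {p : Poly} (hp : p ∈ P m) : dirD w p ∈ P (m - 1) := by
  rw [dirD_apply]
  exact Submodule.sum_mem _ fun i _ => C_mul_mem_P _ (pderiv_mem_P i hp)

theorem pderiv_comm (i j : Fin 3) (p : Poly) :
    pderiv i (pderiv j p) = pderiv j (pderiv i p) := by
  induction p using MvPolynomial.induction_on with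
  | C a => simp
  | add p q hp hq => simp [hp, hq]
  | mul_X p k hp =>
    simp only [pderiv_mul, map_add, hp, pderiv_X, Pi.single_apply]
    split_ifs <;> simp [add_right_comm]

theorem dirD_comm (v w : Vec) (p : Poly) : dirD v (dirD w p) = dirD w (dirD v p) := by
  simp only [dirD_apply, map_sum, pderiv_C_mul]
  rw [Finset.sum_comm]
  refine Finset.sum_congr rfl fun i _ => Finset.sum_congr rfl fun j _ => ?_
  rw [pderiv_comm]
  ring

/-! ### Barycentric coordinates -/

/-- The gradient of a barycentric coordinate. -/
def Tetra.baryGrad (K : Tetra) (i : Fin 4) : Vec :=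
  (K.areaVec i ⬝ᵥ (K.points i - K.fv i 0))⁻¹ • K.areaVec i

/-- The height is the determinant of three edge vectors issuing from one vertex of the face, which
are independent because the tetrahedron is nondegenerate. -/
theorem Tetra.height_ne_zero (K : Tetra) (i : Fin 4) :
    K.areaVec i ⬝ᵥ (K.points i - K.fv i 0) ≠ 0 := by
  have h := (affineIndependent_iff_linearIndependent_vsub ℝ K.points (i.succAbove 0)).1
    K.independent
  let f : Fin 3 → {x // x ≠ i.succAbove 0} :=
    ![⟨i, (Fin.succAbove_ne i 0).symm⟩, ⟨i.succAbove 1, by simp⟩, ⟨i.succAbove 2, by simp⟩]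
  have hf : Function.Injective f := by
    intro a b hab
    have h1 := congrArg Subtype.val hab
    fin_cases a <;> fin_cases b <;> simp [f, Fin.succAbove_ne, Fin.ne_succAbove] at h1 ⊢
  have h2 := h.comp f hf
  have h3 : ((fun x : {x // x ≠ i.succAbove 0} => K.points x -ᵥ K.points (i.succAbove 0)) ∘ f) =
      ![K.points i - K.fv i 0, K.fv i 1 - K.fv i 0, K.fv i 2 - K.fv i 0] := by
    funext a
    fin_cases a <;> rfl
  rw [h3] at h2
  have h4 : LinearIndependent ℝ (Matrix.of
      ![K.points i - K.fv i 0, K.fv i 1 - K.fv i 0, K.fv i 2 - K.fv i 0]).row := h2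
  rw [Matrix.linearIndependent_rows_iff_isUnit, Matrix.isUnit_iff_isUnit_det,
    isUnit_iff_ne_zero] at h4
  rw [dotProduct_comm, Tetra.areaVec, triple_product_eq_det]
  exact h4

theorem Tetra.areaVec_ne_zero (K : Tetra) (i : Fin 4) : K.areaVec i ≠ 0 := by
  intro h
  apply K.height_ne_zero i
  rw [h, zero_dotProduct]

theorem Tetra.areaVec_dot_fv (K : Tetra) (i : Fin 4) (j : Fin 3) :
    K.areaVec i ⬝ᵥ (K.fv i j - K.fv i 0) = 0 := by
  fin_cases j
  · simp
  · rw [dotProduct_comm]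
    exact dot_self_cross _ _
  · rw [dotProduct_comm]
    exact dot_cross_self _ _

theorem Tetra.eval_bary (K : Tetra) (i : Fin 4) (x : Vec) :
    eval x (K.bary i) = K.baryGrad i ⬝ᵥ (x - K.fv i 0) := by
  simp [bary, baryGrad, dotProduct, Finset.mul_sum, mul_assoc]

theorem Tetra.eval_bary_points (K : Tetra) (i j : Fin 4) :
    eval (K.points j) (K.bary i) = if i = j then 1 else 0 := by
  rw [eval_bary, baryGrad, smul_dotProduct, smul_eq_mul]
  split_ifs with h
  · subst h
    exact inv_mul_cancel₀ (K.height_ne_zero i)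
  · obtain ⟨a, rfl⟩ := Fin.exists_succAbove_eq (Ne.symm h)
    have := K.areaVec_dot_fv i a
    rw [fv] at this
    rw [this, mul_zero]

theorem Tetra.eval_bary_sub (K : Tetra) (i : Fin 4) (x y : Vec) :
    eval x (K.bary i) = eval y (K.bary i) + K.baryGrad i ⬝ᵥ (x - y) := by
  rw [eval_bary, eval_bary, ← dotProduct_add]
  congr 1
  abel

theorem Tetra.baryGrad_dot_sub (K : Tetra) (i j k : Fin 4) :
    K.baryGrad i ⬝ᵥ (K.points j - K.points k) =
      (if i = j then 1 else 0) - (if i = k then 1 else 0) := by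
  rw [← eval_bary_points, ← eval_bary_points, K.eval_bary_sub i _ (K.points k)]
  ring

theorem Tetra.dirD_bary (K : Tetra) (w : Vec) (i : Fin 4) :
    dirD w (K.bary i) = C (K.baryGrad i ⬝ᵥ w) := by
  rw [bary, dirD_C_mul, map_sum]
  simp only [dirD_C_mul, map_sub, dirD_X, dirD_C, sub_zero]
  simp only [← C_mul, ← map_sum]
  congr 1
  simp [baryGrad, dotProduct, Finset.mul_sum, mul_assoc]

/-! ### Affine charts -/

theorem eval_aeval {σ τ : Type*} (f : σ → MvPolynomial τ ℝ) (y : τ → ℝ) (p : MvPolynomial σ ℝ) :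
    eval y (aeval f p) = eval (fun i => eval y (f i)) p := by
  induction p using MvPolynomial.induction_on with
  | C a => simp
  | add p q hp hq => simp only [map_add, hp, hq]
  | mul_X p j hp => simp only [map_mul, hp, aeval_X, eval_X]

/-- The edge vectors emanating from vertex `π 0`. -/
def Tetra.tan (K : Tetra) (π : Equiv.Perm (Fin 4)) (a : Fin 3) : Vec :=
  K.points (π a.succ) - K.points (π 0)

theorem Tetra.baryGrad_dot_tan (K : Tetra) (π : Equiv.Perm (Fin 4)) (a b : Fin 3) :
    K.baryGrad (π a.succ) ⬝ᵥ K.tan π b = if a = b then 1 else 0 := by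
  rw [tan, baryGrad_dot_sub]
  simp

/-- Edge vectors at `π 0` and gradients of the other three barycentric coordinates are dual bases;
this gives both expansions of a vector below. -/
theorem Tetra.dual_mul (K : Tetra) (π : Equiv.Perm (Fin 4)) :
    (Matrix.of fun a => K.tan π a)ᵀ * (Matrix.of fun a : Fin 3 => K.baryGrad (π a.succ)) = 1 := by
  rw [mul_eq_one_comm]
  ext a b
  have := K.baryGrad_dot_tan π a b
  rw [Matrix.one_apply, ← this]
  rfl

theorem Tetra.eq_sum_tan (K : Tetra) (π : Equiv.Perm (Fin 4)) (w : Vec) :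
    w = ∑ a : Fin 3, (K.baryGrad (π a.succ) ⬝ᵥ w) • K.tan π a := by
  have h := congrArg (fun M => M *ᵥ w) (K.dual_mul π)
  simp only [Matrix.one_mulVec, ← Matrix.mulVec_mulVec] at h
  conv_lhs => rw [← h]
  ext j
  simp [Matrix.mulVec, dotProduct, Matrix.transpose_apply, mul_comm]

theorem Tetra.eq_sum_baryGrad (K : Tetra) (π : Equiv.Perm (Fin 4)) (w : Vec) :
    w = ∑ a : Fin 3, (K.tan π a ⬝ᵥ w) • K.baryGrad (π a.succ) := by
  have h := congrArg (fun M => Mᵀ *ᵥ w) (K.dual_mul π)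
  simp only [Matrix.transpose_one, Matrix.one_mulVec, Matrix.transpose_mul,
    Matrix.transpose_transpose, ← Matrix.mulVec_mulVec] at h
  conv_lhs => rw [← h]
  ext j
  simp [Matrix.mulVec, dotProduct, Matrix.transpose_apply, mul_comm]

theorem Tetra.sum_baryGrad_dot (K : Tetra) (w : Vec) : ∑ i, K.baryGrad i ⬝ᵥ w = 0 := by
  rw [K.eq_sum_tan 1 w]
  simp only [dotProduct_sum, dotProduct_smul]
  rw [Finset.sum_comm]
  refine Finset.sum_eq_zero fun a _ => ?_
  have h : ∑ i, K.baryGrad i ⬝ᵥ K.tan 1 a = 0 := by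
    simp_rw [tan, baryGrad_dot_sub]
    rw [Finset.sum_sub_distrib, Finset.sum_ite_eq', Finset.sum_ite_eq']
    simp
  rw [← Finset.smul_sum, h, smul_zero]

theorem Tetra.sum_eval_bary (K : Tetra) (x : Vec) : ∑ i, eval x (K.bary i) = 1 := by
  simp_rw [K.eval_bary_sub _ x (K.points 0)]
  rw [Finset.sum_add_distrib, K.sum_baryGrad_dot]
  simp [eval_bary_points]

theorem Tetra.sum_bary (K : Tetra) : ∑ i, K.bary i = 1 :=
  MvPolynomial.funext fun x => by rw [map_sum, K.sum_eval_bary, map_one]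

theorem Tetra.point_eq (K : Tetra) (x : Vec) : x = ∑ i, eval x (K.bary i) • K.points i := by
  have h := K.eq_sum_tan 1 (x - K.points 0)
  have h0 := K.sum_baryGrad_dot (x - K.points 0)
  simp_rw [K.eval_bary_sub _ x (K.points 0), add_smul, Finset.sum_add_distrib, eval_bary_points]
  rw [Fin.sum_univ_succ] at h0
  rw [sub_eq_iff_eq_add] at h
  conv_lhs => rw [h]
  simp only [ite_smul, one_smul, zero_smul, Finset.sum_ite_eq', Finset.mem_univ, if_true]
  rw [add_comm]
  congr 1
  conv_rhs => rw [Fin.sum_univ_succ, eq_neg_of_add_eq_zero_left h0, neg_smul, Finset.sum_smul]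
  simp [tan, smul_sub, Finset.sum_sub_distrib]
  abel

/-- The point with affine coordinates `y` in the chart with origin `π 0`. -/
def Tetra.chartPoint (K : Tetra) (π : Equiv.Perm (Fin 4)) (y : Vec) : Vec :=
  K.points (π 0) + ∑ a, y a • K.tan π a

theorem Tetra.eval_bary_chartPoint (K : Tetra) (π : Equiv.Perm (Fin 4)) (y : Vec) (a : Fin 3) :
    eval (K.chartPoint π y) (K.bary (π a.succ)) = y a := by
  rw [K.eval_bary_sub _ _ (K.points (π 0)), eval_bary_points, chartPoint, add_sub_cancel_left,
    dotProduct_sum]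
  simp [baryGrad_dot_tan]

theorem Tetra.chartPoint_bary (K : Tetra) (π : Equiv.Perm (Fin 4)) (x : Vec) :
    K.chartPoint π (fun a => eval x (K.bary (π a.succ))) = x := by
  rw [chartPoint]
  simp_rw [K.eval_bary_sub _ x (K.points (π 0)), eval_bary_points]
  have h := K.eq_sum_tan π (x - K.points (π 0))
  have h1 : ∀ a : Fin 3, π a.succ ≠ π 0 := fun a => by simp
  simp only [h1, if_false, zero_add]
  rw [← h]
  abel

/-- Pulling polynomials back along an affine chart. -/
def Tetra.chart (K : Tetra) (π : Equiv.Perm (Fin 4)) : Poly ≃ₐ[ℝ] Poly :=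
  AlgEquiv.ofAlgHom
    (aeval fun j => C (K.points (π 0) j) + ∑ a, C (K.tan π a j) * X a)
    (aeval fun a => K.bary (π a.succ))
    (by
      refine MvPolynomial.algHom_ext fun a => MvPolynomial.funext fun y => ?_
      rw [AlgHom.comp_apply, aeval_X, AlgHom.id_apply, eval_X,
        ← K.eval_bary_chartPoint π y a, eval_aeval]
      congr 1
      congr 1
      funext j
      simp [chartPoint, mul_comm])
    (by
      refine MvPolynomial.algHom_ext fun j => MvPolynomial.funext fun x => ?_
      rw [AlgHom.comp_apply, aeval_X, AlgHom.id_apply, eval_X]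
      conv_rhs => rw [← K.chartPoint_bary π x]
      simp [chartPoint, mul_comm])

theorem Tetra.chart_X (K : Tetra) (π : Equiv.Perm (Fin 4)) (j : Fin 3) :
    K.chart π (X j) = C (K.points (π 0) j) + ∑ a, C (K.tan π a j) * X a := by
  change aeval _ (X j) = _
  rw [aeval_X]

theorem Tetra.chart_C (K : Tetra) (π : Equiv.Perm (Fin 4)) (c : ℝ) : K.chart π (C c) = C c :=
  (K.chart π).commutes c

theorem Tetra.chart_symm_X (K : Tetra) (π : Equiv.Perm (Fin 4)) (a : Fin 3) :
    (K.chart π).symm (X a) = K.bary (π a.succ) := by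
  change aeval _ (X a) = _
  rw [aeval_X]

/-- The point of the charts: face `π 3` becomes the plane `X 2 = 0`, and the edge joining `π 0` to
`π 1` becomes the first coordinate axis. A suitable permutation brings any face or edge into this
position. -/
theorem Tetra.chart_bary (K : Tetra) (π : Equiv.Perm (Fin 4)) (a : Fin 3) :
    K.chart π (K.bary (π a.succ)) = X a := by
  rw [← chart_symm_X, AlgEquiv.apply_symm_apply]

theorem Tetra.eval_chart (K : Tetra) (π : Equiv.Perm (Fin 4)) (y : Vec) (p : Poly) :
    eval y (K.chart π p) = eval (K.chartPoint π y) p := by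
  induction p using MvPolynomial.induction_on with
  | C a => rw [chart_C, eval_C, eval_C]
  | add p q hp hq => rw [map_add, map_add, map_add, hp, hq]
  | mul_X p j hp =>
    rw [map_mul, map_mul, map_mul, hp, chart_X]
    simp [chartPoint, mul_comm]

theorem Tetra.pderiv_chart (K : Tetra) (π : Equiv.Perm (Fin 4)) (a : Fin 3) (p : Poly) :
    pderiv a (K.chart π p) = K.chart π (dirD (K.tan π a) p) := by
  induction p using MvPolynomial.induction_on with
  | C c => rw [chart_C, pderiv_C, dirD_C, map_zero]
  | add p q hp hq => simp only [map_add, hp, hq]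
  | mul_X p j hp =>
    rw [map_mul, pderiv_mul, hp, dirD_mul, map_add, map_mul, map_mul, dirD_X, chart_C, chart_X]
    congr 2
    simp [pderiv_X, Pi.single_apply]

theorem Tetra.totalDegree_bary_le (K : Tetra) (i : Fin 4) : (K.bary i).totalDegree ≤ 1 := by
  rw [← mem_P, bary]
  refine C_mul_mem_P _ (Submodule.sum_mem _ fun j _ => C_mul_mem_P _ ?_)
  exact Submodule.sub_mem _ (X_mem_P j) (C_mem_P _ _)

theorem Tetra.bary_mem_P (K : Tetra) (i : Fin 4) : K.bary i ∈ P 1 :=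
  mem_P.2 (K.totalDegree_bary_le i)

theorem Tetra.chart_mem_P (K : Tetra) (π : Equiv.Perm (Fin 4)) {m : ℕ} {p : Poly} :
    K.chart π p ∈ P m ↔ p ∈ P m := by
  have h1 : ∀ q : Poly, (K.chart π q).totalDegree ≤ q.totalDegree := fun q => by
    refine totalDegree_aeval_le (fun j => ?_) q
    rw [← mem_P]
    refine Submodule.add_mem _ (C_mem_P _ _) (Submodule.sum_mem _ fun a _ => ?_)
    exact C_mul_mem_P _ (X_mem_P a)
  have h2 : ∀ q : Poly, ((K.chart π).symm q).totalDegree ≤ q.totalDegree := fun q =>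
    totalDegree_aeval_le (fun a => K.totalDegree_bary_le _) q
  rw [mem_P, mem_P]
  refine ⟨fun h => ?_, fun h => (h1 p).trans h⟩
  have := h2 (K.chart π p)
  rw [AlgEquiv.symm_apply_apply] at this
  exact this.trans h

theorem Tetra.chart_dvd (K : Tetra) (π : Equiv.Perm (Fin 4)) (a : Fin 3) (p : Poly) :
    X a ∣ K.chart π p ↔ K.bary (π a.succ) ∣ p := by
  rw [← chart_bary, map_dvd_iff]

theorem Tetra.totalDegree_bary (K : Tetra) (i : Fin 4) : (K.bary i).totalDegree = 1 := by
  refine le_antisymm (K.totalDegree_bary_le i) (Nat.one_le_iff_ne_zero.2 fun h => ?_)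
  rw [totalDegree_eq_zero_iff_eq_C] at h
  obtain ⟨j, hj⟩ := exists_ne i
  have h1 := K.eval_bary_points i i
  have h2 := K.eval_bary_points i j
  rw [h, eval_C] at h1 h2
  rw [h1] at h2
  simp [hj.symm] at h2

theorem Tetra.bary_ne_zero (K : Tetra) (i : Fin 4) : K.bary i ≠ 0 := by
  intro h
  have := K.totalDegree_bary i
  rw [h] at this
  simp at this

end

end DivDiv

/-! ### Ideals of faces and edges, bubble factorisations and extension from the boundary. -/

namespace DivDiv

open MeasureTheory MvPolynomial
open scoped Matrix

noncomputable section

/-! ### Restriction to a coordinate plane and to a coordinate axis -/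

/-- Setting the last coordinate to zero. -/
def planeRes : Poly →ₐ[ℝ] Poly := aeval ![X 0, X 1, 0]

/-- Setting the last two coordinates to zero. -/
def axisRes : Poly →ₐ[ℝ] Poly := aeval ![X 0, 0, 0]

theorem X_dvd_sub_planeRes (p : Poly) : X 2 ∣ p - planeRes p := by
  induction p using MvPolynomial.induction_on with
  | C a => simp [planeRes]
  | add p q hp hq => simpa [add_sub_add_comm] using dvd_add hp hq
  | mul_X p j hp =>
    have h : p * X j - planeRes (p * X j) =
        (p - planeRes p) * X j + planeRes p * (X j - planeRes (X j)) := by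
      rw [map_mul]; ring
    rw [h]
    refine dvd_add (Dvd.dvd.mul_right hp _) (Dvd.dvd.mul_left ?_ _)
    fin_cases j <;> simp [planeRes]

theorem sub_axisRes_mem (p : Poly) : p - axisRes p ∈ Ideal.span {(X 1 : Poly), X 2} := by
  induction p using MvPolynomial.induction_on with
  | C a => simp [axisRes]
  | add p q hp hq => simpa [add_sub_add_comm] using Ideal.add_mem _ hp hq
  | mul_X p j hp =>
    have h : p * X j - axisRes (p * X j) =
        X j * (p - axisRes p) + axisRes p * (X j - axisRes (X j)) := by
      rw [map_mul]; ring
    rw [h]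
    refine Ideal.add_mem _ (Ideal.mul_mem_left _ _ hp) (Ideal.mul_mem_left _ _ ?_)
    fin_cases j
    · simp [axisRes]
    · simpa [axisRes] using Ideal.subset_span (by simp)
    · simpa [axisRes] using Ideal.subset_span (by simp)

theorem X_dvd_iff_planeRes {p : Poly} : X 2 ∣ p ↔ planeRes p = 0 := by
  constructor
  · rintro ⟨q, rfl⟩
    simp [planeRes]
  · intro h
    simpa [h] using X_dvd_sub_planeRes p

theorem mem_span_iff_axisRes {p : Poly} :
    p ∈ Ideal.span {(X 1 : Poly), X 2} ↔ axisRes p = 0 := by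
  constructor
  · intro h
    obtain ⟨a, b, rfl⟩ := Ideal.mem_span_pair.1 h
    simp [axisRes]
  · intro h
    simpa [h] using sub_axisRes_mem p

/-- Restriction commutes with tangential derivatives, while the restricted polynomial no longer
depends on the transversal variable. -/
theorem pderiv_planeRes (i : Fin 3) (p : Poly) :
    pderiv i (planeRes p) = if i = 2 then 0 else planeRes (pderiv i p) := by
  induction p using MvPolynomial.induction_on with
  | C a => simp [planeRes]
  | add p q hp hq => simp only [map_add, hp, hq]; split_ifs <;> simp
  | mul_X p j hp =>
    rw [map_mul, pderiv_mul, hp, pderiv_mul, map_add, map_mul, map_mul]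
    have h : pderiv i (planeRes (X j)) = if i = 2 then 0 else planeRes (pderiv i (X j)) := by
      fin_cases i <;> fin_cases j <;> simp [planeRes, pderiv_X]
    rw [h]
    split_ifs <;> simp

theorem pderiv_axisRes (i : Fin 3) (p : Poly) :
    pderiv i (axisRes p) = if i = 0 then axisRes (pderiv i p) else 0 := by
  induction p using MvPolynomial.induction_on with
  | C a => simp [axisRes]
  | add p q hp hq => simp only [map_add, hp, hq]; split_ifs <;> simp
  | mul_X p j hp =>
    rw [map_mul, pderiv_mul, hp, pderiv_mul, map_add, map_mul, map_mul]
    have h : pderiv i (axisRes (X j)) = if i = 0 then axisRes (pderiv i (X j)) else 0 := by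
      fin_cases i <;> fin_cases j <;> simp [axisRes, pderiv_X]
    rw [h]
    split_ifs <;> simp

theorem planeRes_mem_P {m : ℕ} {p : Poly} (hp : p ∈ P m) : planeRes p ∈ P m := by
  rw [mem_P] at hp ⊢
  refine (totalDegree_aeval_le (fun i => ?_) p).trans hp
  fin_cases i <;> simp

/-! ### Polynomials vanishing on faces and edges -/

/-- The ideal of the edge on which two given barycentric coordinates vanish. -/
def Tetra.edgeIdeal (K : Tetra) (c d : Fin 4) : Ideal Poly := Ideal.span {K.bary c, K.bary d}

theorem Tetra.edgeIdeal_comm (K : Tetra) (c d : Fin 4) : K.edgeIdeal c d = K.edgeIdeal d c := by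
  rw [edgeIdeal, edgeIdeal, Set.pair_comm]

theorem Tetra.mem_edgeIdeal_of_dvd_right (K : Tetra) {c d : Fin 4} {p : Poly}
    (h : K.bary d ∣ p) : p ∈ K.edgeIdeal c d :=
  Ideal.mem_span_pair.2 (by obtain ⟨q, rfl⟩ := h; exact ⟨0, q, by ring⟩)

theorem Tetra.mem_edgeIdeal_of_dvd_left (K : Tetra) {c d : Fin 4} {p : Poly}
    (h : K.bary c ∣ p) : p ∈ K.edgeIdeal c d := by
  rw [edgeIdeal_comm]
  exact K.mem_edgeIdeal_of_dvd_right h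

theorem Tetra.bary_dvd_dirD (K : Tetra) {d : Fin 4} {w : Vec} (hw : K.baryGrad d ⬝ᵥ w = 0)
    {p : Poly} (h : K.bary d ∣ p) : K.bary d ∣ dirD w p := by
  obtain ⟨q, rfl⟩ := h
  rw [dirD_mul, dirD_bary, hw]
  simp

theorem Tetra.dirD_mem_edgeIdeal (K : Tetra) {c d : Fin 4} {w : Vec}
    (hc : K.baryGrad c ⬝ᵥ w = 0) (hd : K.baryGrad d ⬝ᵥ w = 0) {p : Poly}
    (h : p ∈ K.edgeIdeal c d) : dirD w p ∈ K.edgeIdeal c d := by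
  obtain ⟨a, b, rfl⟩ := Ideal.mem_span_pair.1 h
  refine Ideal.mem_span_pair.2 ⟨dirD w a, dirD w b, ?_⟩
  rw [map_add, dirD_mul, dirD_mul, dirD_bary, dirD_bary, hc, hd]
  simp

section Chart

variable (K : Tetra) (π : Equiv.Perm (Fin 4))

theorem Tetra.chart_mem_span {p : Poly} :
    K.chart π p ∈ Ideal.span {(X 1 : Poly), X 2} ↔ p ∈ K.edgeIdeal (π 2) (π 3) := by
  have h1 : K.chart π (K.bary (π 2)) = X 1 := K.chart_bary π 1
  have h2 : K.chart π (K.bary (π 3)) = X 2 := K.chart_bary π 2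
  rw [edgeIdeal, Ideal.mem_span_pair, Ideal.mem_span_pair]
  constructor
  · rintro ⟨a, b, h⟩
    refine ⟨(K.chart π).symm a, (K.chart π).symm b, (K.chart π).injective ?_⟩
    simp [h1, h2, h]
  · rintro ⟨a, b, rfl⟩
    exact ⟨K.chart π a, K.chart π b, by simp [h1, h2]⟩

theorem Tetra.chart_dvd_two {p : Poly} : X 2 ∣ K.chart π p ↔ K.bary (π 3) ∣ p :=
  K.chart_dvd π 2 p

/-- A polynomial in two variables that vanishes on a product of infinite sets is zero; a small
square inside the face suffices. -/
theorem Tetra.bary_dvd_of_forall {p : Poly}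
    (h : ∀ a ∈ Set.Ioo (0 : ℝ) (1 / 2), ∀ b ∈ Set.Ioo (0 : ℝ) (1 / 2),
      eval (K.chartPoint π ![a, b, 0]) p = 0) : K.bary (π 3) ∣ p := by
  rw [← chart_dvd_two, X_dvd_iff_planeRes]
  refine funext_set (fun _ => Set.Ioo (0 : ℝ) (1 / 2))
    (fun _ => Set.Ioo_infinite (by norm_num)) fun x hx => ?_
  rw [map_zero, planeRes, eval_aeval, eval_chart, ← h (x 0) (hx 0 trivial) (x 1) (hx 1 trivial)]
  congr 2
  congr 1
  funext i
  fin_cases i <;> simp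

theorem Tetra.mem_edgeIdeal_of_forall {p : Poly}
    (h : ∀ a ∈ Set.Ioo (0 : ℝ) 1, eval (K.chartPoint π ![a, 0, 0]) p = 0) :
    p ∈ K.edgeIdeal (π 2) (π 3) := by
  rw [← chart_mem_span, mem_span_iff_axisRes]
  refine funext_set (fun _ => Set.Ioo (0 : ℝ) 1)
    (fun _ => Set.Ioo_infinite (by norm_num)) fun x hx => ?_
  rw [map_zero, axisRes, eval_aeval, eval_chart, ← h (x 0) (hx 0 trivial)]
  congr 2
  congr 1
  funext i
  fin_cases i <;> simp

/-- The planar Poincaré lemma, obtained from the spatial one applied to a field with zero third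
component and no dependence on the third variable. -/
theorem Tetra.exists_potential_on_face {m : ℕ} {A B : Poly} (hA : A ∈ P m) (hB : B ∈ P m)
    (h : K.bary (π 3) ∣ dirD (K.tan π 0) B - dirD (K.tan π 1) A) :
    ∃ f ∈ P (m + 1), K.bary (π 3) ∣ dirD (K.tan π 0) f - A ∧
      K.bary (π 3) ∣ dirD (K.tan π 1) f - B := by
  rw [← chart_dvd_two, X_dvd_iff_planeRes, map_sub, map_sub, ← pderiv_chart, ← pderiv_chart,
    sub_eq_zero] at h
  obtain ⟨f, hf, hfw⟩ := exists_gradS_eq (m := m)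
    (w := ![planeRes (K.chart π A), planeRes (K.chart π B), 0]) (by
      intro i
      fin_cases i
      · exact planeRes_mem_P ((K.chart_mem_P π).2 hA)
      · exact planeRes_mem_P ((K.chart_mem_P π).2 hB)
      · exact Submodule.zero_mem _) (by
      funext i
      fin_cases i <;> simp [curlV, pderiv_planeRes, h])
  refine ⟨(K.chart π).symm f, ?_, ?_, ?_⟩
  · rw [← K.chart_mem_P π, AlgEquiv.apply_symm_apply]
    exact hf
  · rw [← chart_dvd_two, map_sub, ← pderiv_chart, AlgEquiv.apply_symm_apply, ← dvd_neg, neg_sub]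
    have : pderiv 0 f = planeRes (K.chart π A) := congrFun hfw 0
    rw [this]
    exact X_dvd_sub_planeRes _
  · rw [← chart_dvd_two, map_sub, ← pderiv_chart, AlgEquiv.apply_symm_apply, ← dvd_neg, neg_sub]
    have : pderiv 1 f = planeRes (K.chart π B) := congrFun hfw 1
    rw [this]
    exact X_dvd_sub_planeRes _

theorem Tetra.exists_const_on_face {f : Poly} (h0 : K.bary (π 3) ∣ dirD (K.tan π 0) f)
    (h1 : K.bary (π 3) ∣ dirD (K.tan π 1) f) : ∃ c : ℝ, K.bary (π 3) ∣ f - C c := by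
  rw [← chart_dvd_two, X_dvd_iff_planeRes, ← pderiv_chart] at h0 h1
  have h := eq_C_of_pderiv_eq_zero (p := planeRes (K.chart π f)) (by
    intro i
    fin_cases i <;> simp [pderiv_planeRes, h0, h1])
  refine ⟨coeff 0 (planeRes (K.chart π f)), ?_⟩
  rw [← chart_dvd_two, map_sub, chart_C, ← h]
  exact X_dvd_sub_planeRes _

theorem Tetra.exists_const_on_edge {f : Poly}
    (h : dirD (K.tan π 0) f ∈ K.edgeIdeal (π 2) (π 3)) :
    ∃ c : ℝ, f - C c ∈ K.edgeIdeal (π 2) (π 3) := by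
  rw [← chart_mem_span, mem_span_iff_axisRes, ← pderiv_chart] at h
  have h := eq_C_of_pderiv_eq_zero (p := axisRes (K.chart π f)) (by
    intro i
    fin_cases i <;> simp [pderiv_axisRes, h])
  refine ⟨coeff 0 (axisRes (K.chart π f)), ?_⟩
  rw [← chart_mem_span, map_sub, chart_C, ← h]
  exact sub_axisRes_mem _

/-- On the face, the edge is the zero set of one linear function, which can be divided out with a
drop of one in degree. -/
theorem Tetra.exists_sub_mul_dvd {m : ℕ} {p : Poly} (hp : p ∈ P (m + 1))
    (h : p ∈ K.edgeIdeal (π 2) (π 3)) : ∃ q ∈ P m, K.bary (π 3) ∣ p - K.bary (π 2) * q := by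
  have hp' := (K.chart_mem_P π).2 hp
  rw [← chart_mem_span, Ideal.mem_span_pair] at h
  obtain ⟨a, b, hab⟩ := h
  have h1 : planeRes (K.chart π p) = X 1 * planeRes a := by
    rw [← hab]
    simp [planeRes, mul_comm]
  refine ⟨(K.chart π).symm (planeRes a), ?_, ?_⟩
  · rw [← K.chart_mem_P π, AlgEquiv.apply_symm_apply]
    refine mem_P_of_mul_mem (p := X 1) (by simp) ?_
    rw [← h1]
    exact planeRes_mem_P hp'
  · have h2 : K.chart π (K.bary (π 2)) = X 1 := K.chart_bary π 1
    rw [← chart_dvd_two, map_sub, map_mul, h2, AlgEquiv.apply_symm_apply, ← h1]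
    exact X_dvd_sub_planeRes _

/-- Restriction to the edge lands in a domain, and `K.bary (π 1)` restricts there to a nonzero
function. -/
theorem Tetra.mem_edgeIdeal_of_mul {p : Poly}
    (h : K.bary (π 1) * p ∈ K.edgeIdeal (π 2) (π 3)) : p ∈ K.edgeIdeal (π 2) (π 3) := by
  rw [← chart_mem_span, mem_span_iff_axisRes] at h ⊢
  have h2 : K.chart π (K.bary (π 1)) = X 0 := K.chart_bary π 0
  rw [map_mul, h2, map_mul] at h
  have h3 : axisRes (X 0) = X 0 := by simp [axisRes]
  rw [h3] at h
  exact (mul_eq_zero.1 h).resolve_left (X_ne_zero _)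

theorem Tetra.bary_dvd_of_mul {p : Poly}
    (h : K.bary (π 3) ∣ K.bary (π 1) * p) : K.bary (π 3) ∣ p := by
  rw [← chart_dvd_two, X_dvd_iff_planeRes] at h ⊢
  have h2 : K.chart π (K.bary (π 1)) = X 0 := K.chart_bary π 0
  rw [map_mul, h2, map_mul] at h
  have h3 : planeRes (X 0) = X 0 := by simp [planeRes]
  rw [h3] at h
  exact (mul_eq_zero.1 h).resolve_left (X_ne_zero _)

end Chart

theorem exists_perm_last {d : Fin 4} : ∃ π : Equiv.Perm (Fin 4), π 3 = d := by
  revert d; decide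

theorem exists_perm_last_two {c d : Fin 4} (h : c ≠ d) :
    ∃ π : Equiv.Perm (Fin 4), π 2 = c ∧ π 3 = d := by
  revert c d; decide

theorem exists_perm_last_three {b c d : Fin 4} (h1 : b ≠ c) (h2 : b ≠ d) (h3 : c ≠ d) :
    ∃ π : Equiv.Perm (Fin 4), π 1 = b ∧ π 2 = c ∧ π 3 = d := by
  revert b c d; decide

theorem Tetra.bary_dvd_of_dvd_mul (K : Tetra) {i j : Fin 4} (hij : i ≠ j) {p : Poly}
    (h : K.bary j ∣ K.bary i * p) : K.bary j ∣ p := by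
  have hex : ∀ i j : Fin 4, ∃ b, b ≠ i ∧ b ≠ j := by decide
  obtain ⟨b, hbi, hbj⟩ := hex i j
  obtain ⟨π, h1, -, h3⟩ := exists_perm_last_three hbi.symm hij hbj
  rw [← h1, ← h3] at h
  rw [← h3]
  exact K.bary_dvd_of_mul π h

theorem Tetra.mem_edgeIdeal_of_mul_mem (K : Tetra) {b c d : Fin 4} (h1 : b ≠ c) (h2 : b ≠ d)
    (h3 : c ≠ d) {p : Poly} (h : K.bary b * p ∈ K.edgeIdeal c d) : p ∈ K.edgeIdeal c d := by
  obtain ⟨π, rfl, rfl, rfl⟩ := exists_perm_last_three h1 h2 h3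
  exact K.mem_edgeIdeal_of_mul π h

theorem Tetra.exists_mul_of_mem_edgeIdeal (K : Tetra) {c d : Fin 4} (hcd : c ≠ d) {m : ℕ}
    {p : Poly} (hp : p ∈ P (m + 1)) (h : p ∈ K.edgeIdeal c d) :
    ∃ q ∈ P m, K.bary d ∣ p - K.bary c * q := by
  obtain ⟨π, rfl, rfl⟩ := exists_perm_last_two hcd
  exact K.exists_sub_mul_dvd π hp h

/-- A polynomial that vanishes on three edges of a face is, on that face, a multiple of the cubic
face bubble. -/
theorem Tetra.exists_faceBubble_mul (K : Tetra) (π : Equiv.Perm (Fin 4)) {m : ℕ} {p : Poly}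
    (hp : p ∈ P (m + 3)) (h0 : p ∈ K.edgeIdeal (π 0) (π 3)) (h1 : p ∈ K.edgeIdeal (π 1) (π 3))
    (h2 : p ∈ K.edgeIdeal (π 2) (π 3)) :
    ∃ q ∈ P m, K.bary (π 3) ∣ p - K.bary (π 0) * K.bary (π 1) * K.bary (π 2) * q := by
  have hπ : ∀ {a b : Fin 4}, a ≠ b → π a ≠ π b := fun h => π.injective.ne h
  obtain ⟨q0, hq0, k0⟩ := K.exists_mul_of_mem_edgeIdeal (hπ (by decide)) hp h0
  have key : ∀ {c : Fin 4} {x y z : Poly}, K.bary (π 3) ∣ x - y * z → x ∈ K.edgeIdeal c (π 3) →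
      y * z ∈ K.edgeIdeal c (π 3) := fun {c x y z} h hx => by
    have := Ideal.sub_mem _ hx (K.mem_edgeIdeal_of_dvd_right (c := c) h)
    rwa [sub_sub_cancel] at this
  have e1 := K.mem_edgeIdeal_of_mul_mem (hπ (by decide)) (hπ (by decide)) (hπ (by decide))
    (key k0 h1)
  have e2 := K.mem_edgeIdeal_of_mul_mem (hπ (by decide)) (hπ (by decide)) (hπ (by decide))
    (key k0 h2)
  obtain ⟨q1, hq1, k1⟩ := K.exists_mul_of_mem_edgeIdeal (hπ (by decide)) hq0 e1
  have e3 := K.mem_edgeIdeal_of_mul_mem (hπ (by decide)) (hπ (by decide)) (hπ (by decide))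
    (key k1 e2)
  obtain ⟨q2, hq2, k2⟩ := K.exists_mul_of_mem_edgeIdeal (hπ (by decide)) hq1 e3
  refine ⟨q2, hq2, ?_⟩
  have : p - K.bary (π 0) * K.bary (π 1) * K.bary (π 2) * q2 =
      (p - K.bary (π 0) * q0) + K.bary (π 0) * (q0 - K.bary (π 1) * q1) +
        K.bary (π 0) * K.bary (π 1) * (q1 - K.bary (π 2) * q2) := by ring
  rw [this]
  exact dvd_add (dvd_add k0 (k1.mul_left _)) (k2.mul_left _)

theorem Tetra.bubble_dvd (K : Tetra) {p : Poly} (h : ∀ i, K.bary i ∣ p) : K.bubble ∣ p := by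
  obtain ⟨q0, rfl⟩ := h 0
  obtain ⟨q1, rfl⟩ := K.bary_dvd_of_dvd_mul (by decide) (h 1)
  obtain ⟨q2, rfl⟩ := K.bary_dvd_of_dvd_mul (by decide)
    (K.bary_dvd_of_dvd_mul (by decide) (h 2))
  obtain ⟨q3, rfl⟩ := K.bary_dvd_of_dvd_mul (by decide)
    (K.bary_dvd_of_dvd_mul (by decide) (K.bary_dvd_of_dvd_mul (by decide) (h 3)))
  exact ⟨q3, by rw [bubble, Fin.prod_univ_four]; ring⟩

theorem Tetra.exists_bubble_mul (K : Tetra) {m : ℕ} {p : Poly} (hp : p ∈ P (m + 4))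
    (h : ∀ i, K.bary i ∣ p) : ∃ q ∈ P m, p = K.bubble * q := by
  obtain ⟨q, rfl⟩ := K.bubble_dvd h
  refine ⟨q, ?_, rfl⟩
  rw [bubble, Fin.prod_univ_four, mul_assoc, mul_assoc, mul_assoc] at hp
  have := fun i => K.totalDegree_bary i
  exact mem_P_of_mul_mem (this 3) (mem_P_of_mul_mem (this 2) (mem_P_of_mul_mem (this 1)
    (mem_P_of_mul_mem (this 0) hp)))

/-- Face polynomials that agree on the edges extend to the tetrahedron. -/
theorem Tetra.exists_extension (K : Tetra) {m : ℕ} (v : Fin 4 → Poly) (hv : ∀ d, v d ∈ P (m + 3))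
    (h : ∀ c d, c ≠ d → v c - v d ∈ K.edgeIdeal c d) :
    ∃ u ∈ P (m + 3), ∀ d, K.bary d ∣ u - v d := by
  have trans' : ∀ {c d : Fin 4} {u : Poly}, c ≠ d → K.bary c ∣ u - v c →
      u - v d ∈ K.edgeIdeal c d := fun {c d u} hcd hu => by
    have := Ideal.add_mem _ (K.mem_edgeIdeal_of_dvd_left (d := d) hu) (h c d hcd)
    rwa [sub_add_sub_cancel] at this
  have mulmem : ∀ {c d : Fin 4} {x y q : Poly}, K.bary d ∣ x - y * q →
      x ∈ K.edgeIdeal c d → y * q ∈ K.edgeIdeal c d := fun {c d x y q} h hx => by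
    have := Ideal.sub_mem _ hx (K.mem_edgeIdeal_of_dvd_right (c := c) h)
    rwa [sub_sub_cancel] at this
  obtain ⟨q1, hq1, k1⟩ := K.exists_mul_of_mem_edgeIdeal (c := 0) (d := 1) (by decide)
    (Submodule.sub_mem _ (hv 0) (hv 1)) (h 0 1 (by decide))
  -- The data are interpolated one face at a time: each correction is a multiple of the coordinates
  -- of the faces already treated, so it does not disturb them. Agreement on edges makes the
  -- required quotient exist at each stage.
  set u1 := v 0 - K.bary 0 * q1 with hu1
  have hu1P : u1 ∈ P (m + 3) := Submodule.sub_mem _ (hv 0)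
    (by rw [show m + 3 = 1 + (m + 2) by ring]; exact mul_mem_P (K.bary_mem_P 0) hq1)
  have u1a : K.bary 0 ∣ u1 - v 0 := ⟨-q1, by rw [hu1]; ring⟩
  have u1b : K.bary 1 ∣ u1 - v 1 := by
    have : u1 - v 1 = v 0 - v 1 - K.bary 0 * q1 := by rw [hu1]; ring
    rwa [this]
  obtain ⟨q2, hq2, k2⟩ := K.exists_mul_of_mem_edgeIdeal (c := 0) (d := 2) (by decide)
    (Submodule.sub_mem _ hu1P (hv 2)) (trans' (by decide) u1a)
  have e2 := K.mem_edgeIdeal_of_mul_mem (b := 0) (c := 1) (d := 2) (by decide) (by decide)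
    (by decide) (mulmem k2 (trans' (by decide) u1b))
  obtain ⟨r2, hr2, l2⟩ := K.exists_mul_of_mem_edgeIdeal (c := 1) (d := 2) (by decide) hq2 e2
  set u2 := u1 - K.bary 0 * (K.bary 1 * r2) with hu2
  have hu2P : u2 ∈ P (m + 3) := Submodule.sub_mem _ hu1P
    (by
      rw [show m + 3 = 1 + (1 + (m + 1)) by ring]
      exact mul_mem_P (K.bary_mem_P 0) (mul_mem_P (K.bary_mem_P 1) hr2))
  have u2a : K.bary 0 ∣ u2 - v 0 := by
    have : u2 - v 0 = (u1 - v 0) + K.bary 0 * (-(K.bary 1 * r2)) := by rw [hu2]; ring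
    rw [this]
    exact dvd_add u1a (Dvd.intro _ rfl)
  have u2b : K.bary 1 ∣ u2 - v 1 := by
    have : u2 - v 1 = (u1 - v 1) + K.bary 1 * (-(K.bary 0 * r2)) := by rw [hu2]; ring
    rw [this]
    exact dvd_add u1b (Dvd.intro _ rfl)
  have u2c : K.bary 2 ∣ u2 - v 2 := by
    have : u2 - v 2 = (u1 - v 2 - K.bary 0 * q2) + K.bary 0 * (q2 - K.bary 1 * r2) := by
      rw [hu2]; ring
    rw [this]
    exact dvd_add k2 (l2.mul_left _)
  -- The remaining error on the last face vanishes on its three edges, so there it is a multiple of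
  -- the cubic bubble, which is zero on the other three faces.
  obtain ⟨q, hq, k⟩ := K.exists_faceBubble_mul 1 (m := m) (p := u2 - v 3)
    (Submodule.sub_mem _ hu2P (hv 3)) (trans' (by decide) u2a) (trans' (by decide) u2b)
    (trans' (by decide) u2c)
  simp only [Equiv.Perm.coe_one, id_eq] at k
  refine ⟨u2 - K.bary 0 * K.bary 1 * K.bary 2 * q, Submodule.sub_mem _ hu2P ?_, fun d => ?_⟩
  · rw [show m + 3 = 1 + 1 + 1 + m by ring]
    exact mul_mem_P (mul_mem_P (mul_mem_P (K.bary_mem_P 0) (K.bary_mem_P 1)) (K.bary_mem_P 2)) hq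
  · fin_cases d
    · have : u2 - K.bary 0 * K.bary 1 * K.bary 2 * q - v 0 =
        (u2 - v 0) + K.bary 0 * (-(K.bary 1 * K.bary 2 * q)) := by ring
      simp only [Fin.zero_eta]
      rw [this]
      exact dvd_add u2a (Dvd.intro _ rfl)
    · have : u2 - K.bary 0 * K.bary 1 * K.bary 2 * q - v 1 =
        (u2 - v 1) + K.bary 1 * (-(K.bary 0 * K.bary 2 * q)) := by ring
      simp only [Fin.mk_one]
      rw [this]
      exact dvd_add u2b (Dvd.intro _ rfl)
    · have : u2 - K.bary 0 * K.bary 1 * K.bary 2 * q - v 2 =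
        (u2 - v 2) + K.bary 2 * (-(K.bary 0 * K.bary 1 * q)) := by ring
      simp only [Fin.reduceFinMk]
      rw [this]
      exact dvd_add u2c (Dvd.intro _ rfl)
    · simp only [Fin.reduceFinMk]
      rw [sub_right_comm]
      exact k

end

end DivDiv

/-! ### Tensor components in a chart and formulas for the traces of `sym curl`. -/

namespace DivDiv

open MeasureTheory MvPolynomial
open scoped Matrix

noncomputable section

/-! ### Components of tensor fields -/

theorem bilin_eq_sum (n m : Vec) (τ : PMat) :
    bilin n m τ = ∑ i, ∑ j, C (n i) * C (m j) * τ i j := by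
  simp only [bilin, constVec, dotProduct, Matrix.mulVec, Finset.mul_sum]
  refine Finset.sum_congr rfl fun i _ => Finset.sum_congr rfl fun j _ => ?_
  ring

theorem bilin_add_left (n n' m : Vec) (τ : PMat) :
    bilin (n + n') m τ = bilin n m τ + bilin n' m τ := by
  simp [bilin_eq_sum, add_mul, Finset.sum_add_distrib]

theorem bilin_add_right (n m m' : Vec) (τ : PMat) :
    bilin n (m + m') τ = bilin n m τ + bilin n m' τ := by
  simp [bilin_eq_sum, add_mul, mul_add, Finset.sum_add_distrib]

theorem bilin_smul_left (c : ℝ) (n m : Vec) (τ : PMat) :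
    bilin (c • n) m τ = C c * bilin n m τ := by
  simp [bilin_eq_sum, Finset.mul_sum, mul_assoc]

theorem bilin_smul_right (c : ℝ) (n m : Vec) (τ : PMat) :
    bilin n (c • m) τ = C c * bilin n m τ := by
  simp only [bilin_eq_sum, Finset.mul_sum, Pi.smul_apply, smul_eq_mul, C_mul]
  refine Finset.sum_congr rfl fun i _ => Finset.sum_congr rfl fun j _ => ?_
  ring

theorem bilin_sub_right (n m m' : Vec) (τ : PMat) :
    bilin n (m - m') τ = bilin n m τ - bilin n m' τ := by
  simp [bilin_eq_sum, sub_mul, mul_sub, Finset.sum_sub_distrib]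

theorem bilin_sum_right {ι : Type*} (s : Finset ι) (n : Vec) (f : ι → Vec) (τ : PMat) :
    bilin n (∑ i ∈ s, f i) τ = ∑ i ∈ s, bilin n (f i) τ := by
  classical
  induction s using Finset.induction_on with
  | empty => simp [bilin_eq_sum]
  | insert a s ha ih => rw [Finset.sum_insert ha, Finset.sum_insert ha, bilin_add_right, ih]

theorem bilin_sub (n m : Vec) (σ τ : PMat) : bilin n m (σ - τ) = bilin n m σ - bilin n m τ := by
  simp [bilin, Matrix.sub_mulVec]

theorem bilin_transpose (n m : Vec) (τ : PMat) : bilin n m τᵀ = bilin m n τ := by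
  rw [bilin_eq_sum, bilin_eq_sum, Finset.sum_comm]
  refine Finset.sum_congr rfl fun i _ => Finset.sum_congr rfl fun j _ => ?_
  rw [Matrix.transpose_apply]
  ring

theorem bilin_symPart (n m : Vec) (A : PMat) :
    2 * bilin n m (symPart A) = bilin n m A + bilin m n A := by
  rw [symPart, bilin_smul, bilin_add, bilin_transpose, smul_eq_C_mul, ← mul_assoc]
  have : (2 : Poly) * C (1 / 2) = 1 := by
    rw [show (2 : Poly) = C 2 from rfl, ← C_mul]
    norm_num
  rw [this, one_mul]

theorem bilin_mem_P {m : ℕ} {τ : PMat} (h : ∀ i j, τ i j ∈ P m) (n n' : Vec) :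
    bilin n n' τ ∈ P m := by
  rw [bilin_eq_sum]
  refine Submodule.sum_mem _ fun i _ => Submodule.sum_mem _ fun j _ => ?_
  rw [← C_mul]
  exact C_mul_mem_P _ (h i j)

theorem eval_bilin (x n m : Vec) (τ : PMat) :
    eval x (bilin n m τ) = n ⬝ᵥ (evalMat x τ *ᵥ m) := by
  simp only [bilin_eq_sum, map_sum, map_mul, eval_C, evalMat, dotProduct, Matrix.mulVec,
    Finset.mul_sum]
  refine Finset.sum_congr rfl fun i _ => Finset.sum_congr rfl fun j _ => ?_
  ring

/-- The component of a vector field along a constant covector. -/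
def dotC (n : Vec) (v : PVec) : Poly := ∑ i, C (n i) * v i

theorem bilin_gradV (n u : Vec) (v : PVec) : bilin n u (gradV v) = dirD u (dotC n v) := by
  simp only [bilin_eq_sum, gradV, gradS, Matrix.of_apply, dotC, map_sum, dirD_C_mul]
  simp only [dirD_apply, Finset.mul_sum, mul_assoc]

theorem dotC_sub (n : Vec) (v w : PVec) : dotC n (v - w) = dotC n v - dotC n w := by
  simp [dotC, mul_sub, Finset.sum_sub_distrib]

theorem dotC_mem (I : Ideal Poly) {v : PVec} (h : ∀ i, v i ∈ I) (n : Vec) : dotC n v ∈ I :=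
  Submodule.sum_mem _ fun i _ => Ideal.mul_mem_left _ _ (h i)

/-- Pairing the curl of a row field with `u × w` evaluates the exterior derivative of that row on
`(u, w)`. This makes the curl computable in any oblique frame. -/
theorem bilin_cross_curlM (n u w : Vec) (τ : PMat) :
    bilin n (crossProduct u w) (curlM τ) = dirD u (bilin n w τ) - dirD w (bilin n u τ) := by
  simp only [bilin_eq_sum, Fin.sum_univ_three, curlM, curlV, Matrix.of_apply, cross_apply,
    Matrix.cons_val, map_add, mul_assoc, dirD_C_mul]
  simp only [dirD_apply, Fin.sum_univ_three, C_sub, C_mul]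
  ring

theorem gradV_sub (v w : PVec) : gradV (v - w) = gradV v - gradV w := by
  ext1 i j
  simp [gradV, gradS]

theorem gradV_add (v w : PVec) : gradV (v + w) = gradV v + gradV w := by
  ext1 i j
  simp [gradV, gradS]

/-- The fields `a + b x`. -/
def rtField (a : Vec) (b : ℝ) : PVec := fun i => C (a i) + C b * X i

/-- The gradient of `a + b x` is `b` times the identity, so these fields lie in the kernel of `dev
grad` and do not affect the relations with `n ⬝ᵥ u = 0`. -/
theorem dirD_dotC_rtField (n u a : Vec) (b : ℝ) :
    dirD u (dotC n (rtField a b)) = C (b * (n ⬝ᵥ u)) := by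
  simp only [dotC, rtField, map_sum, dirD_C_mul, map_add, dirD_C, zero_add, dirD_X, dotProduct,
    Finset.mul_sum, C_mul]
  refine Finset.sum_congr rfl fun i _ => ?_
  ring

theorem rtField_mem_PV (a : Vec) (b : ℝ) : rtField a b ∈ PV 1 := fun i =>
  Submodule.add_mem _ (C_mem_P _ _) (C_mul_mem_P _ (X_mem_P i))

/-! ### Tensors that act as a scalar on the tangent space of a face -/

/-- On face `d`, the field `ω` maps each tangent vector to a multiple of itself. -/
def Tetra.IsScalarOn (K : Tetra) (d : Fin 4) (ω : PMat) : Prop :=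
  ∀ u α : Vec, K.baryGrad d ⬝ᵥ u = 0 → α ⬝ᵥ u = 0 → K.bary d ∣ bilin α u ω

/-- Equality of the two diagonal entries follows by applying the condition to `u - w` and `α + β`,
which annihilate each other, and removing the off-diagonal entries. -/
theorem Tetra.IsScalarOn.sub_dvd {K : Tetra} {d : Fin 4} {ω : PMat} (h : K.IsScalarOn d ω)
    {u w α β : Vec} (hu : K.baryGrad d ⬝ᵥ u = 0) (hw : K.baryGrad d ⬝ᵥ w = 0)
    (h1 : α ⬝ᵥ u = 1) (h2 : α ⬝ᵥ w = 0) (h3 : β ⬝ᵥ u = 0) (h4 : β ⬝ᵥ w = 1) :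
    K.bary d ∣ bilin α u ω - bilin β w ω := by
  have k1 := h (u - w) (α + β) (by rw [dotProduct_sub, hu, hw, sub_zero])
    (by rw [dotProduct_sub, add_dotProduct, add_dotProduct, h1, h2, h3, h4]; norm_num)
  have k2 := h w α hw h2
  have k3 := h u β hu h3
  rw [bilin_sub_right, bilin_add_left, bilin_add_left] at k1
  have := dvd_sub (dvd_add k1 k2) k3
  convert this using 1
  ring

section Chart

variable (K : Tetra) (π : Equiv.Perm (Fin 4))

/-- The gradients dual to the edge vectors of a chart. -/
def Tetra.cotan (a : Fin 3) : Vec := K.baryGrad (π a.succ)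

theorem Tetra.cotan_dot_tan (a b : Fin 3) : K.cotan π a ⬝ᵥ K.tan π b = if a = b then 1 else 0 :=
  K.baryGrad_dot_tan π a b

/-- In a basis adapted to the face, five scalar relations are left: images of tangents have no
normal part (two), the tangential block has no off-diagonal entries (two), and its diagonal entries
coincide (one). -/
theorem Tetra.isScalarOn_iff (ω : PMat) :
    K.IsScalarOn (π 3) ω ↔
      K.bary (π 3) ∣ bilin (K.cotan π 2) (K.tan π 0) ω ∧
      K.bary (π 3) ∣ bilin (K.cotan π 2) (K.tan π 1) ω ∧
      K.bary (π 3) ∣ bilin (K.cotan π 0) (K.tan π 1) ω ∧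
      K.bary (π 3) ∣ bilin (K.cotan π 1) (K.tan π 0) ω ∧
      K.bary (π 3) ∣ bilin (K.cotan π 0) (K.tan π 0) ω - bilin (K.cotan π 1) (K.tan π 1) ω := by
  have hd : ∀ b, K.baryGrad (π 3) ⬝ᵥ K.tan π b = if 2 = b then 1 else 0 :=
    fun b => K.cotan_dot_tan π 2 b
  constructor
  · intro h
    refine ⟨h _ _ ?_ ?_, h _ _ ?_ ?_, h _ _ ?_ ?_, h _ _ ?_ ?_,
      h.sub_dvd ?_ ?_ ?_ ?_ ?_ ?_⟩ <;> simp [hd, cotan_dot_tan]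
  · rintro ⟨h1, h2, h3, h4, h5⟩ u α hu hα
    have eu := K.eq_sum_tan π u
    have eα := K.eq_sum_baryGrad π α
    rw [Fin.sum_univ_three] at eu eα
    have h0 : K.baryGrad (π (Fin.succ 2)) ⬝ᵥ u = 0 := hu
    rw [h0, zero_smul, add_zero] at eu
    change α = _ • K.cotan π 0 + _ • K.cotan π 1 + _ • K.cotan π 2 at eα
    set u0 := K.baryGrad (π (Fin.succ 0)) ⬝ᵥ u
    set u1 := K.baryGrad (π (Fin.succ 1)) ⬝ᵥ u
    set α0 := K.tan π 0 ⬝ᵥ α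
    set α1 := K.tan π 1 ⬝ᵥ α
    set α2 := K.tan π 2 ⬝ᵥ α
    have h6 : α0 * u0 + α1 * u1 = 0 := by
      rw [eu, eα] at hα
      simp only [add_dotProduct, dotProduct_add, smul_dotProduct, dotProduct_smul, cotan_dot_tan,
        smul_eq_mul] at hα
      simp at hα
      linarith
    rw [eu, eα]
    simp only [bilin_add_left, bilin_add_right, bilin_smul_left, bilin_smul_right]
    have h7 : (C α1 : Poly) * C u1 = - (C α0 * C u0) := by
      rw [← C_mul, ← C_mul, ← C_neg]
      congr 1
      linarith
    have key := dvd_add (dvd_add (dvd_add (dvd_add (h1.mul_left (C α2 * C u0))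
      (h2.mul_left (C α2 * C u1))) (h3.mul_left (C α0 * C u1))) (h4.mul_left (C α1 * C u0)))
      (h5.mul_left (C α0 * C u0))
    convert key using 1
    linear_combination (bilin (K.cotan π 1) (K.tan π 1) ω) * h7

/-- The determinant of a chart. -/
def Tetra.chartDet : ℝ := K.tan π 0 ⬝ᵥ crossProduct (K.tan π 1) (K.tan π 2)

theorem Tetra.cross_tan_one_two :
    crossProduct (K.tan π 1) (K.tan π 2) = K.chartDet π • K.cotan π 0 := by
  rw [K.eq_sum_baryGrad π (crossProduct (K.tan π 1) (K.tan π 2)), Fin.sum_univ_three,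
    dot_self_cross, dot_cross_self, zero_smul, zero_smul, add_zero, add_zero]
  rfl

theorem Tetra.cross_tan_two_zero :
    crossProduct (K.tan π 2) (K.tan π 0) = K.chartDet π • K.cotan π 1 := by
  rw [K.eq_sum_baryGrad π (crossProduct (K.tan π 2) (K.tan π 0)), Fin.sum_univ_three,
    dot_self_cross, dot_cross_self, zero_smul, zero_smul, zero_add, add_zero,
    ← triple_product_permutation]
  rfl

theorem Tetra.cross_tan_zero_one :
    crossProduct (K.tan π 0) (K.tan π 1) = K.chartDet π • K.cotan π 2 := by
  rw [K.eq_sum_baryGrad π (crossProduct (K.tan π 0) (K.tan π 1)), Fin.sum_univ_three,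
    dot_self_cross, dot_cross_self, zero_smul, zero_smul, zero_add, zero_add,
    triple_product_permutation]
  rfl

/-- If it were zero, the cross products of the edge vectors would vanish, while the Lagrange
identity with the dual basis gives the value `1`. -/
theorem Tetra.chartDet_ne_zero : K.chartDet π ≠ 0 := by
  intro h
  have h1 := K.cross_tan_one_two π
  rw [h, zero_smul] at h1
  have h2 : (K.tan π 1) ⬝ᵥ (K.cotan π 1) = 1 := by
    rw [dotProduct_comm, cotan_dot_tan, if_pos rfl]
  have h3 := K.cross_tan_two_zero π
  rw [h, zero_smul] at h3
  have h4 := K.cross_tan_zero_one π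
  rw [h, zero_smul] at h4
  have e0 := cross_dot_cross (K.tan π 0) (K.tan π 1) (K.cotan π 0) (K.cotan π 1)
  rw [h4, zero_dotProduct, dotProduct_comm _ (K.cotan π 0), dotProduct_comm _ (K.cotan π 1),
    dotProduct_comm _ (K.cotan π 1), dotProduct_comm _ (K.cotan π 0)] at e0
  simp [cotan_dot_tan] at e0

/-- The normal of face `π 3` is, up to `chartDet`, the cross product of the two tangents. Hence only
tangential derivatives occur, and they act on entries that occur in `isScalarOn_iff`. -/
theorem Tetra.bilin_symCurl_two_two (τ : PMat) :
    C (K.chartDet π) * bilin (K.cotan π 2) (K.cotan π 2) (symCurl τ) =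
      dirD (K.tan π 0) (bilin (K.cotan π 2) (K.tan π 1) τ) -
      dirD (K.tan π 1) (bilin (K.cotan π 2) (K.tan π 0) τ) := by
  rw [← bilin_cross_curlM, cross_tan_zero_one, bilin_smul_right]
  have h := bilin_symPart (K.cotan π 2) (K.cotan π 2) (curlM τ)
  rw [← two_mul] at h
  have h1 : bilin (K.cotan π 2) (K.cotan π 2) (symCurl τ) =
      bilin (K.cotan π 2) (K.cotan π 2) (curlM τ) := mul_left_cancel₀ two_ne_zero h
  rw [h1]

theorem Tetra.bilin_symCurl_zero_two (τ : PMat) :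
    2 * C (K.chartDet π) * bilin (K.cotan π 0) (K.cotan π 2) (symCurl τ) =
      dirD (K.tan π 0) (bilin (K.cotan π 0) (K.tan π 1) τ) -
      dirD (K.tan π 1) (bilin (K.cotan π 0) (K.tan π 0) τ) +
      (dirD (K.tan π 1) (bilin (K.cotan π 2) (K.tan π 2) τ) -
      dirD (K.tan π 2) (bilin (K.cotan π 2) (K.tan π 1) τ)) := by
  rw [← bilin_cross_curlM, ← bilin_cross_curlM, cross_tan_zero_one, cross_tan_one_two,
    bilin_smul_right, bilin_smul_right]
  have h := bilin_symPart (K.cotan π 0) (K.cotan π 2) (curlM τ)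
  rw [← mul_add, ← h]
  change _ * bilin _ _ (symPart (curlM τ)) = _
  ring

/-- This serves the edge shared by faces `π 2` and `π 3`, whose direction is `K.tan π 0`. The first
off-diagonal entry belongs to face `π 3` and the other to face `π 2`, each differentiated along its
own face. The diagonal entries combine into the difference of the two faces' diagonal relations,
differentiated along the edge. -/
theorem Tetra.bilin_symCurl_one_two (τ : PMat) :
    2 * C (K.chartDet π) * bilin (K.cotan π 1) (K.cotan π 2) (symCurl τ) =
      dirD (K.tan π 0) (bilin (K.cotan π 1) (K.tan π 1) τ) -
      dirD (K.tan π 1) (bilin (K.cotan π 1) (K.tan π 0) τ) +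
      (dirD (K.tan π 2) (bilin (K.cotan π 2) (K.tan π 0) τ) -
      dirD (K.tan π 0) (bilin (K.cotan π 2) (K.tan π 2) τ)) := by
  rw [← bilin_cross_curlM, ← bilin_cross_curlM, cross_tan_zero_one, cross_tan_two_zero,
    bilin_smul_right, bilin_smul_right]
  have h := bilin_symPart (K.cotan π 1) (K.cotan π 2) (curlM τ)
  rw [← mul_add, ← h]
  change _ * bilin _ _ (symPart (curlM τ)) = _
  ring

/-- The second trace, up to a multiple of the face's own barycentric coordinate, in a chart. -/
def Tetra.chartTrace (σ : PMat) : Poly :=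
  2 * (dirD (K.tan π 0) (bilin (K.cotan π 0) (K.cotan π 2) σ) +
    dirD (K.tan π 1) (bilin (K.cotan π 1) (K.cotan π 2) σ)) +
  dirD (K.tan π 2) (bilin (K.cotan π 2) (K.cotan π 2) σ)

/-- All terms with a transversal derivative cancel because derivatives commute. What remains is a
second-order tangential operator on the tangential block, the compatibility operator of the planar
problem in `exists_face_potential_comps`. -/
theorem Tetra.chartTrace_symCurl (τ : PMat) :
    C (K.chartDet π) * K.chartTrace π (symCurl τ) =
      dirD (K.tan π 0) (dirD (K.tan π 0) (bilin (K.cotan π 0) (K.tan π 1) τ)) -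
      dirD (K.tan π 0) (dirD (K.tan π 1) (bilin (K.cotan π 0) (K.tan π 0) τ)) +
      dirD (K.tan π 0) (dirD (K.tan π 1) (bilin (K.cotan π 1) (K.tan π 1) τ)) -
      dirD (K.tan π 1) (dirD (K.tan π 1) (bilin (K.cotan π 1) (K.tan π 0) τ)) := by
  have two : (2 : Poly) = C 2 := rfl
  have h0 := congrArg (dirD (K.tan π 0)) (K.bilin_symCurl_zero_two π τ)
  have h1 := congrArg (dirD (K.tan π 1)) (K.bilin_symCurl_one_two π τ)
  have h2 := congrArg (dirD (K.tan π 2)) (K.bilin_symCurl_two_two π τ)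
  rw [two, ← C_mul] at h0 h1
  simp only [dirD_C_mul, map_add, map_sub] at h0 h1 h2
  rw [chartTrace, two]
  simp only [C_mul] at h0 h1
  have c1 := dirD_comm (K.tan π 0) (K.tan π 1)
  have c2 := dirD_comm (K.tan π 0) (K.tan π 2)
  have c3 := dirD_comm (K.tan π 1) (K.tan π 2)
  rw [c2, c1 (bilin (K.cotan π 2) (K.tan π 2) τ)] at h0
  rw [c3, ← c1] at h1
  linear_combination h0 + h1 + h2

end Chart

/-- The surface divergence of `v` is `|n|² div v - ∂ₙ(n · v)`, by the double cross product formula.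
No unit length is needed, so the unit normal may be replaced by a barycentric gradient. -/
theorem trace2_eq (n : Vec) (τ : PMat) :
    trace2 n τ = 2 * (C (n ⬝ᵥ n) * divV (τ *ᵥ constVec n)) - dirD n (bilin n n τ) := by
  have hb : bilin n n τ = ∑ i, C (n i) * (τ *ᵥ constVec n) i := rfl
  rw [trace2, normalDeriv_eq_dirD, hb]
  generalize τ *ᵥ constVec n = v
  simp only [surfDiv, surfGrad, cross_apply, gradS, constVec, Fin.sum_univ_three, Matrix.cons_val,
    map_add, dirD_C_mul, divV, dotProduct, C_mul]
  simp only [dirD_apply, Fin.sum_univ_three]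
  ring

theorem trace2_smul_left (c : ℝ) (n : Vec) (τ : PMat) :
    trace2 (c • n) τ = C (c ^ 3) * trace2 n τ := by
  have h : τ *ᵥ constVec (c • n) = c • (τ *ᵥ constVec n) := by
    rw [← Matrix.mulVec_smul]
    congr 1
    funext i
    simp [constVec, smul_eq_C_mul]
  have h1 : ∀ v : PVec, divV (c • v) = C c * divV v := fun v => by
    simp [divV, smul_eq_C_mul, Finset.mul_sum]
  rw [trace2_eq, trace2_eq, h, h1, bilin_smul_left, bilin_smul_right, dirD_smul_left, dirD_C_mul,
    dirD_C_mul, smul_dotProduct, dotProduct_smul]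
  simp only [smul_eq_mul, C_mul, C_pow]
  ring

theorem Tetra.divV_eq_chart (K : Tetra) (π : Equiv.Perm (Fin 4)) (v : PVec) :
    divV v = ∑ a, dirD (K.tan π a) (dotC (K.cotan π a) v) := by
  have h : ∀ i j, ∑ a, K.tan π a i * K.cotan π a j = if i = j then 1 else 0 := fun i j => by
    have := congrFun (congrFun (K.dual_mul π) i) j
    rw [Matrix.one_apply] at this
    rw [← this]
    rfl
  simp only [dotC, map_sum, dirD_C_mul]
  rw [Finset.sum_comm]
  simp only [dirD_apply, Finset.mul_sum, ← mul_assoc, ← C_mul]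
  have h2 : ∀ j, ∑ a, ∑ i, C (K.cotan π a j * K.tan π a i) * pderiv i (v j) =
      pderiv j (v j) := fun j => by
    rw [Finset.sum_comm]
    simp_rw [← Finset.sum_mul, ← map_sum, mul_comm (K.cotan π _ _), h]
    simp
  rw [divV, ← Finset.sum_congr rfl fun j _ => (h2 j).symm]

/-- The direction in the last term is tangent to the face, since `K.cotan π 2` pairs to `1` with
`K.tan π 2`. Thus the last term vanishes on the face once the normal-normal component does. -/
theorem Tetra.trace2_cotan (K : Tetra) (π : Equiv.Perm (Fin 4)) (σ : PMat) :
    trace2 (K.cotan π 2) σ =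
      C (K.cotan π 2 ⬝ᵥ K.cotan π 2) * K.chartTrace π σ +
      dirD ((K.cotan π 2 ⬝ᵥ K.cotan π 2) • K.tan π 2 - K.cotan π 2)
        (bilin (K.cotan π 2) (K.cotan π 2) σ) := by
  have h : ∀ a, dotC (K.cotan π a) (σ *ᵥ constVec (K.cotan π 2)) =
    bilin (K.cotan π a) (K.cotan π 2) σ := fun a => rfl
  rw [trace2_eq, K.divV_eq_chart π, Fin.sum_univ_three, h, h, h, dirD_sub_left, dirD_smul_left,
    chartTrace]
  ring

theorem dotProduct_self_ne_zero {v : Vec} (h : v ≠ 0) : v ⬝ᵥ v ≠ 0 := by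
  rwa [Ne, dotProduct_self_eq_zero]

theorem Tetra.baryGrad_ne_zero (K : Tetra) (i : Fin 4) : K.baryGrad i ≠ 0 :=
  smul_ne_zero (inv_ne_zero (K.height_ne_zero i)) (K.areaVec_ne_zero i)

theorem Tetra.exists_normal_eq (K : Tetra) (i : Fin 4) :
    ∃ c : ℝ, c ≠ 0 ∧ K.normal i = c • K.baryGrad i := by
  have h := K.height_ne_zero i
  have hs : Real.sqrt (K.areaVec i ⬝ᵥ K.areaVec i) ≠ 0 := by
    rw [Real.sqrt_ne_zero']
    exact lt_of_le_of_ne (Finset.sum_nonneg fun _ _ => mul_self_nonneg _)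
      (dotProduct_self_ne_zero (K.areaVec_ne_zero i)).symm
  have hsgn : ((SignType.sign (K.areaVec i ⬝ᵥ (K.points i - K.fv i 0)) : SignType) : ℝ) ≠ 0 := by
    rcases lt_or_gt_of_ne h with h1 | h1
    · rw [sign_neg h1]; norm_num
    · rw [sign_pos h1]; norm_num
  refine ⟨(-((SignType.sign (K.areaVec i ⬝ᵥ (K.points i - K.fv i 0)) : SignType) : ℝ) /
    Real.sqrt (K.areaVec i ⬝ᵥ K.areaVec i)) * (K.areaVec i ⬝ᵥ (K.points i - K.fv i 0)),
    mul_ne_zero (div_ne_zero (neg_ne_zero.2 hsgn) hs) h, ?_⟩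
  rw [baryGrad, smul_smul, mul_assoc, mul_inv_cancel₀ h, mul_one]
  rfl

theorem dvd_C_mul_iff {p q : Poly} {c : ℝ} (hc : c ≠ 0) : p ∣ C c * q ↔ p ∣ q :=
  IsUnit.dvd_mul_left ((isUnit_iff_ne_zero.2 hc).map C)

theorem Tetra.dvd_bilin_normal_iff (K : Tetra) (i : Fin 4) (σ : PMat) :
    K.bary i ∣ bilin (K.normal i) (K.normal i) σ ↔
      K.bary i ∣ bilin (K.baryGrad i) (K.baryGrad i) σ := by
  obtain ⟨c, hc, h⟩ := K.exists_normal_eq i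
  rw [h, bilin_smul_left, bilin_smul_right, dvd_C_mul_iff hc, dvd_C_mul_iff hc]

theorem Tetra.dvd_trace2_normal_iff (K : Tetra) (i : Fin 4) (σ : PMat) :
    K.bary i ∣ trace2 (K.normal i) σ ↔ K.bary i ∣ trace2 (K.baryGrad i) σ := by
  obtain ⟨c, hc, h⟩ := K.exists_normal_eq i
  rw [h, trace2_smul_left, dvd_C_mul_iff (pow_ne_zero 3 hc)]

theorem Tetra.dvd_trace2_iff (K : Tetra) (π : Equiv.Perm (Fin 4)) {σ : PMat}
    (h : K.bary (π 3) ∣ bilin (K.baryGrad (π 3)) (K.baryGrad (π 3)) σ) :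
    K.bary (π 3) ∣ trace2 (K.baryGrad (π 3)) σ ↔ K.bary (π 3) ∣ K.chartTrace π σ := by
  have hne := dotProduct_self_ne_zero (K.baryGrad_ne_zero (π 3))
  have e := K.trace2_cotan π σ
  change trace2 (K.baryGrad (π 3)) σ = C (K.baryGrad (π 3) ⬝ᵥ K.baryGrad (π 3)) * _ +
    dirD ((K.baryGrad (π 3) ⬝ᵥ K.baryGrad (π 3)) • _ - K.baryGrad (π 3))
      (bilin (K.baryGrad (π 3)) (K.baryGrad (π 3)) σ) at e
  have h1 := K.bary_dvd_dirD (d := π 3) (w := (K.baryGrad (π 3) ⬝ᵥ K.baryGrad (π 3)) • K.tan π 2 -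
    K.baryGrad (π 3)) (by
      rw [dotProduct_sub, dotProduct_smul]
      have : K.baryGrad (π 3) ⬝ᵥ K.tan π 2 = 1 := K.cotan_dot_tan π 2 2
      rw [this]
      simp) h
  rw [e, ← dvd_C_mul_iff hne (q := K.chartTrace π σ)]
  exact dvd_add_left h1

end

end DivDiv

/-! ### Potentials on faces, their matching across edges and around vertices, and the global
potential. -/

namespace DivDiv

open MeasureTheory MvPolynomial
open scoped Matrix

noncomputable section

/-! ### Local potentials of tensors whose `sym curl` has vanishing traces -/

section Chart

variable (K : Tetra) (π : Equiv.Perm (Fin 4))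

theorem Tetra.dirD_tan_bary (a b : Fin 3) :
    dirD (K.tan π a) (K.bary (π b.succ)) = C (if b = a then 1 else 0) := by
  rw [dirD_bary]
  congr 1
  exact K.cotan_dot_tan π b a

theorem Tetra.X_eq_chart (j : Fin 3) :
    (X j : Poly) = C (K.points (π 0) j) + ∑ a, C (K.tan π a j) * K.bary (π a.succ) := by
  apply (K.chart π).injective
  rw [chart_X, map_add, chart_C, map_sum]
  simp_rw [map_mul, chart_C, chart_bary]

/-- The vector field with given components in a chart. -/
def Tetra.ofComps (V : Fin 3 → Poly) : PVec := fun j => ∑ a, C (K.tan π a j) * V a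

theorem Tetra.dotC_ofComps (V : Fin 3 → Poly) (b : Fin 3) :
    dotC (K.cotan π b) (K.ofComps π V) = V b := by
  simp only [dotC, ofComps, Finset.mul_sum]
  rw [Finset.sum_comm]
  simp_rw [← mul_assoc, ← C_mul, ← Finset.sum_mul, ← map_sum]
  have h : ∀ a, ∑ i, K.cotan π b i * K.tan π a i = if b = a then 1 else 0 :=
    fun a => K.cotan_dot_tan π b a
  simp_rw [h]
  simp

theorem Tetra.ofComps_dotC (v : PVec) : K.ofComps π (fun a => dotC (K.cotan π a) v) = v := by
  have h : ∀ i j, ∑ a, K.tan π a i * K.cotan π a j = if i = j then 1 else 0 := fun i j => by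
    have := congrFun (congrFun (K.dual_mul π) i) j
    rw [Matrix.one_apply] at this
    rw [← this]
    rfl
  funext j
  simp only [dotC, ofComps, Finset.mul_sum]
  rw [Finset.sum_comm]
  simp_rw [← mul_assoc, ← C_mul, ← Finset.sum_mul, ← map_sum, h]
  simp

theorem Tetra.ofComps_mem_PV {m : ℕ} {V : Fin 3 → Poly} (hV : ∀ a, V a ∈ P m) :
    K.ofComps π V ∈ PV m := fun _ =>
  Submodule.sum_mem _ fun a _ => C_mul_mem_P _ (hV a)

/-- Since `x` is the chart origin plus the barycentric combination of edge vectors, passing to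
Cartesian coordinates only shifts the constant part by `-b` times the origin. -/
theorem Tetra.exists_rtField_of_comps (I : Ideal Poly) (v : PVec) (a : Vec) (b : ℝ)
    (h : ∀ c, dotC (K.cotan π c) v - (C (a c) + C b * K.bary (π c.succ)) ∈ I) :
    ∃ a' : Vec, ∀ j, v j - rtField a' b j ∈ I := by
  refine ⟨fun j => ∑ c, K.tan π c j * a c - b * K.points (π 0) j, fun j => ?_⟩
  have h1 : v j - rtField (fun j => ∑ c, K.tan π c j * a c - b * K.points (π 0) j) b j =
      ∑ c, C (K.tan π c j) * (dotC (K.cotan π c) v - (C (a c) + C b * K.bary (π c.succ))) := by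
    conv_lhs => rw [← K.ofComps_dotC π v]
    rw [ofComps, rtField, K.X_eq_chart π j]
    simp only [map_sub, map_sum, C_mul, mul_sub, mul_add, Finset.sum_sub_distrib,
      Finset.sum_add_distrib, Finset.mul_sum]
    have : ∑ c, (C (K.tan π c j) : Poly) * (C b * K.bary (π c.succ)) =
        ∑ c, C b * (C (K.tan π c j) * K.bary (π c.succ)) :=
      Finset.sum_congr rfl fun c _ => by ring
    rw [this]
    ring
  rw [h1]
  exact Submodule.sum_mem _ fun c _ => Ideal.mul_mem_left _ _ (h c)

/-- The normal component `V 2` solves an ordinary planar gradient problem. For the tangential block,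
the auxiliary unknown `s = ∂₀ V₀` must satisfy `∂₀ s = ∂₁ t10 - ∂₀ (t11 - t00)` and `∂₁ s = ∂₀ t01`.
Hypothesis `h2` is the integrability condition of this system. Given `s`, the gradients of `V₀` and
`V₁` on the face are known and closed. -/
theorem Tetra.exists_face_potential_comps {m : ℕ} {t00 t01 t10 t11 t20 t21 : Poly}
    (h00 : t00 ∈ P (m + 1)) (h01 : t01 ∈ P (m + 1)) (h10 : t10 ∈ P (m + 1))
    (h11 : t11 ∈ P (m + 1)) (h20 : t20 ∈ P (m + 1)) (h21 : t21 ∈ P (m + 1))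
    (h1 : K.bary (π 3) ∣ dirD (K.tan π 0) t21 - dirD (K.tan π 1) t20)
    (h2 : K.bary (π 3) ∣ dirD (K.tan π 0) (dirD (K.tan π 0) t01) -
      dirD (K.tan π 0) (dirD (K.tan π 1) t00) + dirD (K.tan π 0) (dirD (K.tan π 1) t11) -
      dirD (K.tan π 1) (dirD (K.tan π 1) t10)) :
    ∃ V : Fin 3 → Poly, (∀ a, V a ∈ P (m + 2)) ∧ K.bary (π 3) ∣ t20 - dirD (K.tan π 0) (V 2) ∧
      K.bary (π 3) ∣ t21 - dirD (K.tan π 1) (V 2) ∧ K.bary (π 3) ∣ t01 - dirD (K.tan π 1) (V 0) ∧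
      K.bary (π 3) ∣ t10 - dirD (K.tan π 0) (V 1) ∧
      K.bary (π 3) ∣ t00 - dirD (K.tan π 0) (V 0) - (t11 - dirD (K.tan π 1) (V 1)) := by
  have hD : ∀ {w : Vec} {p : Poly}, p ∈ P (m + 1) → dirD w p ∈ P m := fun {w p} hp => by
    have := dirD_mem_P w hp
    rwa [Nat.add_sub_cancel] at this
  obtain ⟨V2, hV2, k20, k21⟩ := K.exists_potential_on_face π h20 h21 h1
  have h2' : K.bary (π 3) ∣ dirD (K.tan π 0) (dirD (K.tan π 0) t01) -
      dirD (K.tan π 1) (dirD (K.tan π 1) t10 - dirD (K.tan π 0) (t11 - t00)) := by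
    have e : dirD (K.tan π 0) (dirD (K.tan π 0) t01) -
        dirD (K.tan π 1) (dirD (K.tan π 1) t10 - dirD (K.tan π 0) (t11 - t00)) =
        dirD (K.tan π 0) (dirD (K.tan π 0) t01) -
        dirD (K.tan π 0) (dirD (K.tan π 1) t00) + dirD (K.tan π 0) (dirD (K.tan π 1) t11) -
        dirD (K.tan π 1) (dirD (K.tan π 1) t10) := by
      simp only [map_sub, dirD_comm (K.tan π 1) (K.tan π 0)]
      ring
    rwa [e]
  obtain ⟨s, hsP, ks0, ks1⟩ := K.exists_potential_on_face π
    (Submodule.sub_mem _ (hD h10) (hD (Submodule.sub_mem _ h11 h00))) (hD h01) h2'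
  obtain ⟨V0, hV0, k00, k01⟩ := K.exists_potential_on_face π hsP h01 (by
    rw [← dvd_neg, neg_sub]
    exact ks1)
  have h3 : dirD (K.tan π 0) (t11 - t00 + s) - dirD (K.tan π 1) t10 =
      dirD (K.tan π 0) s - (dirD (K.tan π 1) t10 - dirD (K.tan π 0) (t11 - t00)) := by
    rw [map_add]
    ring
  obtain ⟨V1, hV1, k10, k11⟩ := K.exists_potential_on_face π h10
    (Submodule.add_mem _ (Submodule.sub_mem _ h11 h00) hsP) (by rwa [h3])
  refine ⟨![V0, V1, V2], fun a => ?_, ?_, ?_, ?_, ?_, ?_⟩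
  · fin_cases a
    · exact hV0
    · exact hV1
    · exact hV2
  · rw [← dvd_neg, neg_sub]
    exact k20
  · rw [← dvd_neg, neg_sub]
    exact k21
  · rw [← dvd_neg, neg_sub]
    exact k01
  · rw [← dvd_neg, neg_sub]
    exact k10
  · have e : t00 - dirD (K.tan π 0) V0 - (t11 - dirD (K.tan π 1) V1) =
        dirD (K.tan π 1) V1 - (t11 - t00 + s) - (dirD (K.tan π 0) V0 - s) := by ring
    simp only [Matrix.cons_val_zero, Matrix.cons_val_one]
    rw [e]
    exact dvd_sub k11 k00

/-- On each face, a tensor whose `sym curl` has vanishing traces differs from a gradient by a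
tensor that acts as a scalar on tangent vectors. -/
theorem Tetra.exists_face_potential {m : ℕ} {τ : PMat} (hτ : ∀ i j, τ i j ∈ P (m + 1))
    (h1 : K.bary (π 3) ∣ bilin (K.baryGrad (π 3)) (K.baryGrad (π 3)) (symCurl τ))
    (h2 : K.bary (π 3) ∣ K.chartTrace π (symCurl τ)) :
    ∃ v ∈ PV (m + 2), K.IsScalarOn (π 3) (τ - gradV v) := by
  have hP : ∀ a b, bilin (K.cotan π a) (K.tan π b) τ ∈ P (m + 1) := fun a b => bilin_mem_P hτ _ _
  have h1' := h1.mul_left (C (K.chartDet π))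
  have h2' := h2.mul_left (C (K.chartDet π))
  rw [K.chartTrace_symCurl π τ] at h2'
  have e1 := K.bilin_symCurl_two_two π τ
  change C (K.chartDet π) * bilin (K.baryGrad (π 3)) (K.baryGrad (π 3)) (symCurl τ) = _ at e1
  rw [e1] at h1'
  obtain ⟨V, hV, k⟩ := K.exists_face_potential_comps π (hP 0 0) (hP 0 1) (hP 1 0) (hP 1 1)
    (hP 2 0) (hP 2 1) h1' h2'
  have hc : ∀ a b, bilin (K.cotan π a) (K.tan π b) (τ - gradV (K.ofComps π V)) =
      bilin (K.cotan π a) (K.tan π b) τ - dirD (K.tan π b) (V a) := fun a b => by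
    rw [bilin_sub, bilin_gradV, dotC_ofComps]
  refine ⟨K.ofComps π V, K.ofComps_mem_PV π hV, ?_⟩
  rw [isScalarOn_iff]
  simp only [hc]
  exact k

/-- On the face `∂₁V₀ = ∂₀V₁ = 0` and `∂₀V₀ = ∂₁V₁`, so the common value has zero tangential
derivatives and is a constant `b`. Subtracting `b` times the coordinates leaves constants, and the
normal component is constant as well. -/
theorem Tetra.exists_rtField_on_face {v : PVec} (h : K.IsScalarOn (π 3) (gradV v)) :
    ∃ a b, ∀ j, K.bary (π 3) ∣ v j - rtField a b j := by
  rw [isScalarOn_iff] at h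
  simp only [bilin_gradV] at h
  obtain ⟨h20, h21, h01, h10, h00⟩ := h
  have t0 : K.baryGrad (π 3) ⬝ᵥ K.tan π 0 = 0 := K.cotan_dot_tan π 2 0
  have t1 : K.baryGrad (π 3) ⬝ᵥ K.tan π 1 = 0 := K.cotan_dot_tan π 2 1
  obtain ⟨b, hb⟩ := K.exists_const_on_face π (f := dirD (K.tan π 0) (dotC (K.cotan π 0) v)) (by
      have e1 := K.bary_dvd_dirD t0 h00
      have e2 := K.bary_dvd_dirD t1 h10
      rw [map_sub, dirD_comm (K.tan π 0) (K.tan π 1)] at e1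
      have := dvd_add e1 e2
      rwa [sub_add_cancel] at this) (by
      rw [dirD_comm]
      exact K.bary_dvd_dirD t0 h01)
  have hb' : K.bary (π 3) ∣ dirD (K.tan π 1) (dotC (K.cotan π 1) v) - C b := by
    have := dvd_sub hb h00
    rwa [sub_sub_sub_cancel_left] at this
  have d : ∀ a c : Fin 3, dirD (K.tan π a) (C b * K.bary (π c.succ)) =
      if c = a then C b else 0 := fun a c => by
    rw [dirD_C_mul, dirD_tan_bary]
    split_ifs <;> simp
  obtain ⟨a0, k0⟩ := K.exists_const_on_face π
    (f := dotC (K.cotan π 0) v - C b * K.bary (π (Fin.succ 0)))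
    (by rw [map_sub, d, if_pos rfl]; exact hb)
    (by rw [map_sub, d, if_neg (by decide), sub_zero]; exact h01)
  obtain ⟨a1, k1⟩ := K.exists_const_on_face π
    (f := dotC (K.cotan π 1) v - C b * K.bary (π (Fin.succ 1)))
    (by rw [map_sub, d, if_neg (by decide), sub_zero]; exact h10)
    (by rw [map_sub, d, if_pos rfl]; exact hb')
  obtain ⟨a2, k2⟩ := K.exists_const_on_face π h20 h21
  obtain ⟨a', ha'⟩ := K.exists_rtField_of_comps π (Ideal.span {K.bary (π 3)}) v ![a0, a1, a2] b
    (by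
      intro c
      rw [Ideal.mem_span_singleton]
      fin_cases c
      · convert k0 using 1
        simp only [Fin.zero_eta, Matrix.cons_val_zero]
        ring
      · convert k1 using 1
        simp only [Fin.mk_one, Matrix.cons_val_one, Matrix.cons_val_zero]
        ring
      · have : K.bary (π 3) ∣ C b * K.bary (π 3) := Dvd.intro_left _ rfl
        convert dvd_sub k2 this using 1
        simp only [Fin.reduceFinMk, Matrix.cons_val, Fin.reduceSucc]
        ring)
  exact ⟨a', b, fun j => Ideal.mem_span_singleton.1 (ha' j)⟩

/-- Along the common edge, the two components of `v - w` transversal to it have zero derivative by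
the relations on both faces. The edge component has zero second derivative: differentiating the
diagonal and off-diagonal relations and using `hS` eliminates `τ`. So this component is affine along
the edge, with slope `b`. -/
theorem Tetra.exists_rtField_on_edge {τ : PMat} {v w : PVec}
    (hv : K.IsScalarOn (π 3) (τ - gradV v)) (hw : K.IsScalarOn (π 2) (τ - gradV w))
    (hS : bilin (K.baryGrad (π 2)) (K.baryGrad (π 3)) (symCurl τ) ∈ K.edgeIdeal (π 2) (π 3)) :
    ∃ a b, ∀ j, v j - w j - rtField a b j ∈ K.edgeIdeal (π 2) (π 3) := by
  set I := K.edgeIdeal (π 2) (π 3) with hI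
  have g20 : K.baryGrad (π 2) ⬝ᵥ K.tan π 0 = 0 := K.cotan_dot_tan π 1 0
  have g30 : K.baryGrad (π 3) ⬝ᵥ K.tan π 0 = 0 := K.cotan_dot_tan π 2 0
  have g31 : K.baryGrad (π 3) ⬝ᵥ K.tan π 1 = 0 := K.cotan_dot_tan π 2 1
  have g22 : K.baryGrad (π 2) ⬝ᵥ K.tan π 2 = 0 := K.cotan_dot_tan π 1 2
  have cc : ∀ a b c d, bilin (K.cotan π a) (K.tan π b) (τ - gradV c) = d →
      bilin (K.cotan π a) (K.tan π b) τ = d + dirD (K.tan π b) (dotC (K.cotan π a) c) := by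
    intro a b c d h
    rw [← h, bilin_sub, bilin_gradV]
    ring
  have hd : ∀ {p}, p ∈ I → dirD (K.tan π 0) p ∈ I := fun hp => K.dirD_mem_edgeIdeal g20 g30 hp
  have L : ∀ {p}, K.bary (π 2) ∣ p → p ∈ I := fun h => K.mem_edgeIdeal_of_dvd_left h
  have R : ∀ {p}, K.bary (π 3) ∣ p → p ∈ I := fun h => K.mem_edgeIdeal_of_dvd_right h
  obtain ⟨p20, p21, p01, p10, p00⟩ := (K.isScalarOn_iff π _).1 hv
  have q20 := hw (K.tan π 0) (K.cotan π 2) g20 (K.cotan_dot_tan π 2 0)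
  have q10 := hw (K.tan π 0) (K.cotan π 1) g20 (K.cotan_dot_tan π 1 0)
  have q00 := hw.sub_dvd g20 g22 (α := K.cotan π 0) (β := K.cotan π 2)
    (K.cotan_dot_tan π 0 0) (K.cotan_dot_tan π 0 2) (K.cotan_dot_tan π 2 0)
    (K.cotan_dot_tan π 2 2)
  -- transversal derivatives of the tangential relations
  have p10' := R (K.bary_dvd_dirD g31 p10)
  have q20' := L (K.bary_dvd_dirD g22 q20)
  have p00' := hd (R p00)
  have q00' := hd (L q00)
  have hS' := Ideal.mul_mem_left I (2 * C (K.chartDet π)) hS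
  have e12 := K.bilin_symCurl_one_two π τ
  change 2 * C (K.chartDet π) * bilin (K.baryGrad (π 2)) (K.baryGrad (π 3)) (symCurl τ) = _ at e12
  rw [e12] at hS'
  simp only [bilin_sub, bilin_gradV, map_sub] at p20 q20 p10 q10 p10' q20' p00' q00'
  have u2 : dirD (K.tan π 0) (dotC (K.cotan π 2) (v - w)) ∈ I := by
    rw [dotC_sub, map_sub]
    convert Ideal.sub_mem _ (L q20) (R p20) using 1
    ring
  have u1 : dirD (K.tan π 0) (dotC (K.cotan π 1) (v - w)) ∈ I := by
    rw [dotC_sub, map_sub]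
    convert Ideal.sub_mem _ (L q10) (R p10) using 1
    ring
  have u0 : dirD (K.tan π 0) (dirD (K.tan π 0) (dotC (K.cotan π 0) (v - w))) ∈ I := by
    rw [dotC_sub, map_sub, map_sub]
    rw [dirD_comm (K.tan π 1) (K.tan π 0)] at p10'
    rw [dirD_comm (K.tan π 2) (K.tan π 0)] at q20'
    have := Ideal.add_mem _ (Ideal.sub_mem _ q00' p00')
      (Ideal.add_mem _ (Ideal.sub_mem _ q20' p10') (Ideal.neg_mem_iff _ |>.2 hS'))
    convert this using 1
    ring
  obtain ⟨b, hb⟩ := K.exists_const_on_edge π u0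
  obtain ⟨a0, k0⟩ := K.exists_const_on_edge π
    (f := dotC (K.cotan π 0) (v - w) - C b * K.bary (π (Fin.succ 0))) (by
      rw [map_sub, dirD_C_mul, dirD_tan_bary, if_pos rfl, C_1, mul_one]
      exact hb)
  obtain ⟨a1, k1⟩ := K.exists_const_on_edge π u1
  obtain ⟨a2, k2⟩ := K.exists_const_on_edge π u2
  obtain ⟨a', ha'⟩ := K.exists_rtField_of_comps π I (v - w) ![a0, a1, a2] b (by
      intro c
      fin_cases c
      · convert k0 using 1
        simp only [Fin.zero_eta, Matrix.cons_val_zero]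
        ring
      · have : C b * K.bary (π 2) ∈ I := L (Dvd.intro_left _ rfl)
        convert Ideal.sub_mem _ k1 this using 1
        simp only [Fin.mk_one, Matrix.cons_val, Fin.reduceSucc]
        ring
      · have : C b * K.bary (π 3) ∈ I := R (Dvd.intro_left _ rfl)
        convert Ideal.sub_mem _ k2 this using 1
        simp only [Fin.reduceFinMk, Matrix.cons_val, Fin.reduceSucc]
        ring)
  exact ⟨a', b, ha'⟩

theorem Tetra.eval_eq_zero_of_mem_edgeIdeal {c d : Fin 4} {x : Vec} (hc : eval x (K.bary c) = 0)
    (hd : eval x (K.bary d) = 0) {p : Poly} (h : p ∈ K.edgeIdeal c d) : eval x p = 0 := by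
  obtain ⟨a, b, rfl⟩ := Ideal.mem_span_pair.1 h
  simp [hc, hd]

theorem Tetra.eval_eq_zero_of_dvd {d : Fin 4} {x : Vec}
    (hd : eval x (K.bary d) = 0) {p : Poly} (h : K.bary d ∣ p) : eval x p = 0 := by
  obtain ⟨q, rfl⟩ := h
  simp [hd]

/-- Around a vertex, potentials that agree on two edges agree on the third. -/
theorem Tetra.rtField_eq_zero_of_vertex {τ : PMat} {v1 v2 v3 : PVec}
    (h1 : K.IsScalarOn (π 1) (τ - gradV v1)) (h2 : K.IsScalarOn (π 2) (τ - gradV v2))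
    (h3 : K.IsScalarOn (π 3) (τ - gradV v3))
    (h31 : ∀ j, v3 j - v1 j ∈ K.edgeIdeal (π 3) (π 1))
    (h32 : ∀ j, v3 j - v2 j ∈ K.edgeIdeal (π 3) (π 2)) {a : Vec} {b : ℝ}
    (h12 : ∀ j, v1 j - v2 j - rtField a b j ∈ K.edgeIdeal (π 1) (π 2)) :
    rtField a b = 0 := by
  set o := K.points (π 0) with ho
  have z1 : eval o (K.bary (π 1)) = 0 := by rw [eval_bary_points]; simp
  have z2 : eval o (K.bary (π 2)) = 0 := by rw [eval_bary_points]; simp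
  have z3 : eval o (K.bary (π 3)) = 0 := by rw [eval_bary_points]; simp
  have g : ∀ a b : Fin 3, K.baryGrad (π a.succ) ⬝ᵥ K.tan π b = if a = b then 1 else 0 :=
    K.cotan_dot_tan π
  have c : ∀ a b : Fin 3, K.cotan π a ⬝ᵥ K.tan π b = if a = b then 1 else 0 :=
    K.cotan_dot_tan π
  -- the relations on the three faces
  have f3 := K.eval_eq_zero_of_dvd z3 (h3.sub_dvd (u := K.tan π 0) (w := K.tan π 1)
    (α := K.cotan π 0) (β := K.cotan π 1) (g 2 0) (g 2 1) (c 0 0) (c 0 1) (c 1 0) (c 1 1))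
  have f1 := K.eval_eq_zero_of_dvd z1 (h1.sub_dvd (u := K.tan π 1) (w := K.tan π 2)
    (α := K.cotan π 1) (β := K.cotan π 2) (g 0 1) (g 0 2) (c 1 1) (c 1 2) (c 2 1) (c 2 2))
  have f2 := K.eval_eq_zero_of_dvd z2 (h2.sub_dvd (u := K.tan π 0) (w := K.tan π 2)
    (α := K.cotan π 0) (β := K.cotan π 2) (g 1 0) (g 1 2) (c 0 0) (c 0 2) (c 2 0) (c 2 2))
  -- the relations on the three edges
  have e31 := K.eval_eq_zero_of_mem_edgeIdeal z3 z1 (K.dirD_mem_edgeIdeal (w := K.tan π 1)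
    (g 2 1) (g 0 1) (dotC_mem _ (v := v3 - v1) h31 (K.cotan π 1)))
  have e32 := K.eval_eq_zero_of_mem_edgeIdeal z3 z2 (K.dirD_mem_edgeIdeal (w := K.tan π 0)
    (g 2 0) (g 1 0) (dotC_mem _ (v := v3 - v2) h32 (K.cotan π 0)))
  have e12 := K.eval_eq_zero_of_mem_edgeIdeal z1 z2 (K.dirD_mem_edgeIdeal (w := K.tan π 2)
    (g 0 2) (g 1 2) (dotC_mem _ (v := v1 - v2 - rtField a b) h12 (K.cotan π 2)))
  simp only [bilin_sub, bilin_gradV, dotC_sub, map_sub, dirD_dotC_rtField, c, if_true, mul_one,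
    eval_C] at f1 f2 f3 e31 e32 e12
  -- At the vertex the three face relations compare the diagonal entries of `τ` cyclically, so `τ`
  -- cancels; the edge relations cancel the derivatives of the potentials and only `b` remains.
  have hb : b = 0 := by linarith
  -- All three edges pass through the vertex, so there `v1 = v3 = v2`, while `v1 - v2 = a`.
  have ha : ∀ j, a j = 0 := fun j => by
    have r1 := K.eval_eq_zero_of_mem_edgeIdeal z3 z1 (h31 j)
    have r2 := K.eval_eq_zero_of_mem_edgeIdeal z3 z2 (h32 j)
    have r3 := K.eval_eq_zero_of_mem_edgeIdeal z1 z2 (h12 j)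
    simp only [rtField, hb, map_sub, eval_C, map_zero, zero_mul, add_zero] at r1 r2 r3
    linarith
  funext j
  simp [rtField, ha j, hb]

end Chart

theorem Tetra.isScalarOn_sub_gradV_iff (K : Tetra) {d : Fin 4} {τ : PMat} {v w : PVec}
    (h : ∀ j, K.bary d ∣ v j - w j) (hw : K.IsScalarOn d (τ - gradV w)) :
    K.IsScalarOn d (τ - gradV v) := by
  intro u α hu hα
  have h1 : τ - gradV v = (τ - gradV w) - gradV (v - w) := by
    rw [gradV_sub]
    abel
  rw [h1, bilin_sub, bilin_gradV]
  refine dvd_sub (hw u α hu hα) (K.bary_dvd_dirD hu ?_)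
  exact Ideal.mem_span_singleton.1 (dotC_mem _ (v := v - w)
    (fun j => Ideal.mem_span_singleton.2 (h j)) α)

theorem Tetra.IsScalarOn.sub_gradV_add_rtField {K : Tetra} {d : Fin 4} {τ : PMat} {v : PVec}
    (h : K.IsScalarOn d (τ - gradV v)) (a : Vec) (b : ℝ) :
    K.IsScalarOn d (τ - gradV (v + rtField a b)) := by
  intro u α hu hα
  have h1 : τ - gradV (v + rtField a b) = (τ - gradV v) - gradV (rtField a b) := by
    rw [gradV_add]
    abel
  rw [h1, bilin_sub, bilin_gradV, dirD_dotC_rtField, hα, mul_zero, C_0, sub_zero]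
  exact h u α hu hα

/-- A tensor whose `sym curl` has vanishing traces differs from a gradient by a tensor with
vanishing traces. -/
theorem Tetra.exists_potential (K : Tetra) {m : ℕ} {τ : PMat} (hτ : ∀ i j, τ i j ∈ P (m + 2))
    (h1 : ∀ d, K.bary d ∣ bilin (K.baryGrad d) (K.baryGrad d) (symCurl τ))
    (h2 : ∀ d, K.bary d ∣ trace2 (K.baryGrad d) (symCurl τ))
    (h3 : ∀ c d, c ≠ d → bilin (K.baryGrad c) (K.baryGrad d) (symCurl τ) ∈ K.edgeIdeal c d) :
    ∃ v ∈ PV (m + 3), ∀ d, K.IsScalarOn d (τ - gradV v) := by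
  have hface : ∀ d, ∃ v ∈ PV (m + 3), K.IsScalarOn d (τ - gradV v) := fun d => by
    obtain ⟨π, rfl⟩ := exists_perm_last (d := d)
    exact K.exists_face_potential π hτ (h1 _) ((K.dvd_trace2_iff π (h1 _)).1 (h2 _))
  choose v hvP hv using hface
  have hedge : ∀ (v w : PVec) (c d : Fin 4), c ≠ d → K.IsScalarOn d (τ - gradV v) →
      K.IsScalarOn c (τ - gradV w) →
      ∃ a b, ∀ j, v j - w j - rtField a b j ∈ K.edgeIdeal c d := fun v w c d hcd hv hw => by
    obtain ⟨π, rfl, rfl⟩ := exists_perm_last_two hcd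
    exact K.exists_rtField_on_edge π hv hw (h3 _ _ hcd)
  -- Face `0` serves as reference: the potential on every other face is changed by a field `a + b
  -- x`, which is allowed, so that it agrees with that of face `0` on the common edge.
  have hadj : ∀ d, ∃ w ∈ PV (m + 3), K.IsScalarOn d (τ - gradV w) ∧
      ∀ j, v 0 j - w j ∈ K.edgeIdeal 0 d := fun d => by
    by_cases hd : d = 0
    · subst hd
      exact ⟨v 0, hvP 0, hv 0, fun j => by rw [sub_self]; exact Ideal.zero_mem _⟩
    · obtain ⟨a, b, hab⟩ := hedge (v 0) (v d) d 0 hd (hv 0) (hv d)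
      refine ⟨v d + rtField a b, (PV _).add_mem (hvP d)
        (PV_mono (by omega) (rtField_mem_PV a b)), (hv d).sub_gradV_add_rtField a b, fun j => ?_⟩
      rw [edgeIdeal_comm, Pi.add_apply, ← sub_sub]
      exact hab j
  choose w hwP hw hw0 using hadj
  set u : Fin 4 → PVec := fun d => if d = 0 then v 0 else w d with hu
  have hu0 : u 0 = v 0 := if_pos rfl
  have hud : ∀ d, d ≠ 0 → u d = w d := fun d hd => if_neg hd
  have huP : ∀ d, u d ∈ PV (m + 3) := fun d => by
    by_cases hd : d = 0
    · rw [hd, hu0]; exact hvP 0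
    · rw [hud d hd]; exact hwP d
  have huS : ∀ d, K.IsScalarOn d (τ - gradV (u d)) := fun d => by
    by_cases hd : d = 0
    · rw [hd, hu0]; exact hv 0
    · rw [hud d hd]; exact hw d
  have hu0d : ∀ d, d ≠ 0 → ∀ j, u 0 j - u d j ∈ K.edgeIdeal 0 d := fun d hd j => by
    rw [hu0, hud d hd]
    exact hw0 d j
  have hagree : ∀ c d, c ≠ d → ∀ j, u c j - u d j ∈ K.edgeIdeal c d := fun c d hcd => by
    by_cases hc : c = 0
    · subst hc
      exact hu0d d hcd.symm
    by_cases hd : d = 0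
    · subst hd
      intro j
      rw [edgeIdeal_comm, ← Ideal.neg_mem_iff, neg_sub]
      exact hu0d c hcd j
    obtain ⟨a, b, hab⟩ := hedge (u c) (u d) d c hcd.symm (huS c) (huS d)
    -- The vertex `π 0` lies on the faces `c`, `d` and `0`. Agreement holds already on the two edges
    -- through it that lie in face `0`, hence on the third.
    obtain ⟨π, p1, p2, p3⟩ := exists_perm_last_three hcd hc hd
    have := K.rtField_eq_zero_of_vertex π (τ := τ) (v1 := u (π 1)) (v2 := u (π 2))
      (v3 := u (π 3)) (a := a) (b := b) (huS _) (huS _) (huS _)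
      (by rw [p1, p3]; exact hu0d c hc) (by rw [p2, p3]; exact hu0d d hd)
      (by rw [p1, p2]; intro j; rw [edgeIdeal_comm]; exact hab j)
    intro j
    have h := hab j
    rw [this, Pi.zero_apply, sub_zero] at h
    rw [edgeIdeal_comm]
    exact h
  have hext : ∀ j, ∃ z ∈ P (m + 3), ∀ d, K.bary d ∣ z - u d j := fun j =>
    K.exists_extension (fun d => u d j) (fun d => huP d j) fun c d hcd => hagree c d hcd j
  choose z hzP hz using hext
  exact ⟨z, hzP, fun d => K.isScalarOn_sub_gradV_iff (fun j => hz j d) (huS d)⟩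

end

end DivDiv

/-! ### Pointwise traces as divisibility, the operators of the complex, and exactness at the
trace-free tensors. -/

namespace DivDiv

open MeasureTheory MvPolynomial
open scoped Matrix

noncomputable section

/-! ### The traces of `sym curl` -/

theorem dotProduct_trT_self (n u : Vec) (A : Matrix (Fin 3) (Fin 3) ℝ) :
    u ⬝ᵥ (trT n A *ᵥ u) =
      (n ⬝ᵥ n) * (crossProduct n u ⬝ᵥ (A *ᵥ u)) - (n ⬝ᵥ u) * (crossProduct n u ⬝ᵥ (A *ᵥ n)) := by
  simp only [trT, crossRight, crossLeft, symPart, cross_apply, Matrix.mulVec, dotProduct,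
    Fin.sum_univ_three, Matrix.of_apply, Matrix.transpose_apply, Matrix.smul_apply,
    Matrix.add_apply, Matrix.cons_val, smul_eq_mul]
  ring

/-- Polarisation: the symmetric trace is determined by the quadratic form `a ↦ a · A (n × a)` at
vectors `a = n × x`. -/
theorem trT_apply_eq (n : Vec) (A : Matrix (Fin 3) (Fin 3) ℝ) (x y : Vec) :
    x ⬝ᵥ (trT n A *ᵥ y) =
      -(1 / 2) * ((crossProduct n x + crossProduct n y) ⬝ᵥ
          (A *ᵥ crossProduct n (crossProduct n x + crossProduct n y)) -
        crossProduct n x ⬝ᵥ (A *ᵥ crossProduct n (crossProduct n x)) -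
        crossProduct n y ⬝ᵥ (A *ᵥ crossProduct n (crossProduct n y))) := by
  simp only [trT, crossRight, crossLeft, symPart, cross_apply, Matrix.mulVec, dotProduct,
    Fin.sum_univ_three, Matrix.of_apply, Matrix.transpose_apply, Matrix.smul_apply,
    Matrix.add_apply, Matrix.cons_val, smul_eq_mul, Pi.add_apply]
  ring

theorem dotProduct_trN (n u : Vec) (A : Matrix (Fin 3) (Fin 3) ℝ) :
    trN n A ⬝ᵥ u = n ⬝ᵥ (A *ᵥ crossProduct n u) := by
  simp only [trN, crossRight, cross_apply, Matrix.mulVec, Matrix.vecMul, dotProduct,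
    Fin.sum_univ_three, Matrix.of_apply, Matrix.cons_val]
  ring

/-- Expansion of `α · y` in the basis `n`, `u`, `n × u`, with the Gram determinant of `n` and `u`
cleared from the denominator. -/
theorem dotProduct_gram (n u α y : Vec) :
    ((n ⬝ᵥ n) * (u ⬝ᵥ u) - (n ⬝ᵥ u) ^ 2) * (α ⬝ᵥ y) =
      (α ⬝ᵥ n) * (n ⬝ᵥ y) * (u ⬝ᵥ u) + (α ⬝ᵥ u) * (u ⬝ᵥ y) * (n ⬝ᵥ n) -
      (n ⬝ᵥ u) * ((α ⬝ᵥ n) * (u ⬝ᵥ y) + (α ⬝ᵥ u) * (n ⬝ᵥ y)) +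
      (α ⬝ᵥ crossProduct n u) * (crossProduct n u ⬝ᵥ y) := by
  simp only [cross_apply, dotProduct, Fin.sum_univ_three, Matrix.cons_val]
  ring

/-- The two traces of `sym curl` vanish exactly for the matrices that act as a scalar on the
tangent plane. -/
theorem traces_eq_zero_iff {n : Vec} (hn : n ≠ 0) (A : Matrix (Fin 3) (Fin 3) ℝ) :
    (trN n A = 0 ∧ trT n A = 0) ↔
      ∀ u α : Vec, n ⬝ᵥ u = 0 → α ⬝ᵥ u = 0 → α ⬝ᵥ (A *ᵥ u) = 0 := by
  have hnn := dotProduct_self_ne_zero hn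
  constructor
  · rintro ⟨h1, h2⟩ u α hu hα
    by_cases hu0 : u = 0
    · simp [hu0]
    have huu := dotProduct_self_ne_zero hu0
    have e1 := dotProduct_trT_self n u A
    rw [h2, Matrix.zero_mulVec, dotProduct_zero, hu, zero_mul, sub_zero] at e1
    have e2 : crossProduct n u ⬝ᵥ (A *ᵥ u) = 0 :=
      (mul_eq_zero.1 e1.symm).resolve_left hnn
    have e3 := dotProduct_trN n (crossProduct n u) A
    rw [h1, zero_dotProduct] at e3
    have e4 : crossProduct n (crossProduct n u) = (-(n ⬝ᵥ n)) • u := by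
      have : crossProduct n (crossProduct n u) = (n ⬝ᵥ u) • n - (n ⬝ᵥ n) • u := by
        ext i
        fin_cases i <;>
          simp only [cross_apply, dotProduct, Fin.sum_univ_three, Matrix.cons_val, Pi.sub_apply,
            Pi.smul_apply, smul_eq_mul, Fin.zero_eta, Fin.mk_one, Fin.reduceFinMk] <;> ring
      rw [this, hu]
      simp
    rw [e4, Matrix.mulVec_smul, dotProduct_smul, smul_eq_mul] at e3
    have e5 : n ⬝ᵥ (A *ᵥ u) = 0 := (mul_eq_zero.1 e3.symm).resolve_left (neg_ne_zero.2 hnn)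
    -- The components of `A u` along `n` and `n × u` vanish, so `A u` is a multiple of `u` and is
    -- annihilated by `α`.
    have e6 := dotProduct_gram n u α (A *ᵥ u)
    rw [e2, e5, hu, hα] at e6
    simp only [mul_zero, zero_mul, add_zero, sub_zero, ne_eq, OfNat.ofNat_ne_zero,
      not_false_eq_true, zero_pow] at e6
    exact (mul_eq_zero.1 e6).resolve_left (mul_ne_zero hnn huu)
  · intro h
    have hQ : ∀ u, u ⬝ᵥ (A *ᵥ crossProduct n u) = 0 := fun u =>
      h _ _ (dot_self_cross _ _) (dot_cross_self _ _)
    constructor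
    · refine dotProduct_eq_zero _ fun u => ?_
      rw [dotProduct_trN]
      exact h _ _ (dot_self_cross _ _) (dot_self_cross _ _)
    · have h0 : ∀ x y, x ⬝ᵥ (trT n A *ᵥ y) = 0 := fun x y => by
        rw [trT_apply_eq, hQ, hQ, hQ]
        norm_num
      ext i j
      have := h0 (Pi.single i 1) (Pi.single j 1)
      simpa using this

/-! ### Points of faces -/

theorem exists_facePerm (i : Fin 4) : ∃ π : Equiv.Perm (Fin 4),
    π 0 = i.succAbove 0 ∧ π 1 = i.succAbove 1 ∧ π 2 = i.succAbove 2 ∧ π 3 = i := by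
  revert i; decide

theorem Tetra.facePoint_eq (K : Tetra) {i : Fin 4} {π : Equiv.Perm (Fin 4)}
    (h0 : π 0 = i.succAbove 0) (h1 : π 1 = i.succAbove 1) (h2 : π 2 = i.succAbove 2)
    (s : ℝ × ℝ) : K.facePoint i s = K.chartPoint π ![s.1, s.2, 0] := by
  have t0 : K.tan π 0 = K.fv i 1 - K.fv i 0 := by rw [tan, h0, Fin.succ_zero_eq_one, h1]; rfl
  have t1 : K.tan π 1 = K.fv i 2 - K.fv i 0 := by rw [tan, h0, Fin.succ_one_eq_two, h2]; rfl
  rw [chartPoint, Fin.sum_univ_three, t0, t1, h0]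
  simp [facePoint, fv, add_assoc]

theorem Tetra.facePoint_mem_face (K : Tetra) (i : Fin 4) {s : ℝ × ℝ} (hs : s ∈ refTriangle) :
    K.facePoint i s ∈ K.face i := by
  obtain ⟨h1, h2, h3⟩ := hs
  have h := (convex_convexHull ℝ (Set.range (K.fv i))).sum_mem (t := Finset.univ)
    (w := ![1 - s.1 - s.2, s.1, s.2]) (z := K.fv i) (by
      intro j _
      fin_cases j
      · simp; linarith
      · simpa using h1
      · simpa using h2) (by simp [Fin.sum_univ_three]; ring)
    (fun j _ => subset_convexHull ℝ _ ⟨j, rfl⟩)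
  rw [Fin.sum_univ_three] at h
  simp only [Matrix.cons_val] at h
  have e : K.facePoint i s =
      (1 - s.1 - s.2) • K.fv i 0 + s.1 • K.fv i 1 + s.2 • K.fv i 2 := by
    rw [facePoint]
    module
  rw [e]
  exact h

theorem Tetra.eval_bary_of_mem_face (K : Tetra) {i : Fin 4} {x : Vec} (hx : x ∈ K.face i) :
    eval x (K.bary i) = 0 := by
  have hc : Convex ℝ {x : Vec | eval x (K.bary i) = 0} := by
    intro x hx y hy a b _ _ hab
    simp only [Set.mem_ofPred_eq, eval_bary] at hx hy ⊢
    have : a • x + b • y - K.fv i 0 = a • (x - K.fv i 0) + b • (y - K.fv i 0) := by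
      have : K.fv i 0 = (a + b) • K.fv i 0 := by rw [hab, one_smul]
      conv_lhs => rw [this]
      module
    rw [this, dotProduct_add, dotProduct_smul, dotProduct_smul, hx, hy]
    simp
  refine convexHull_min ?_ hc hx
  rintro _ ⟨j, rfl⟩
  rw [Set.mem_ofPred_eq, fv, eval_bary_points, if_neg (Fin.succAbove_ne i j).symm]

theorem Tetra.bary_dvd_of_facePoint (K : Tetra) (i : Fin 4) {p : Poly}
    (h : ∀ s : ℝ × ℝ, s ∈ Set.Ioo (0 : ℝ) (1 / 2) ×ˢ Set.Ioo (0 : ℝ) (1 / 2) →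
      eval (K.facePoint i s) p = 0) : K.bary i ∣ p := by
  obtain ⟨π, h0, h1, h2, h3⟩ := exists_facePerm i
  rw [← h3]
  refine K.bary_dvd_of_forall π fun a ha b hb => ?_
  have := h (a, b) ⟨ha, hb⟩
  rwa [K.facePoint_eq h0 h1 h2] at this

theorem Tetra.bary_dvd_iff (K : Tetra) (i : Fin 4) (p : Poly) :
    K.bary i ∣ p ↔ ∀ x ∈ K.face i, eval x p = 0 := by
  constructor
  · intro h x hx
    exact K.eval_eq_zero_of_dvd (K.eval_bary_of_mem_face hx) h
  · intro h
    refine K.bary_dvd_of_facePoint i fun s hs => h _ (K.facePoint_mem_face i ?_)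
    obtain ⟨⟨h1, h2⟩, ⟨h3, h4⟩⟩ := hs
    exact ⟨h1.le, h3.le, by linarith⟩

theorem Tetra.normal_ne_zero (K : Tetra) (i : Fin 4) : K.normal i ≠ 0 := by
  obtain ⟨c, hc, h⟩ := K.exists_normal_eq i
  rw [h]
  exact smul_ne_zero hc (K.baryGrad_ne_zero i)

/-- With `mem_vecBubble` and `mem_sigmaBubble`, this replaces conditions at boundary points by
divisibility, the form in which everything else is proved. -/
theorem mem_symCurlBubble {K : Tetra} {m : ℕ} {ω : PMat} :
    ω ∈ symCurlBubble K m ↔ ω ∈ PT m ∧ ∀ d, K.IsScalarOn d ω := by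
  refine and_congr Iff.rfl (forall_congr' fun d => ?_)
  obtain ⟨c, hc, hn⟩ := K.exists_normal_eq d
  have h1 : ∀ u, K.normal d ⬝ᵥ u = 0 ↔ K.baryGrad d ⬝ᵥ u = 0 := fun u => by
    rw [hn, smul_dotProduct, smul_eq_zero, or_iff_right hc]
  simp_rw [traces_eq_zero_iff (K.normal_ne_zero d), h1, Tetra.IsScalarOn, K.bary_dvd_iff,
    eval_bilin]
  exact ⟨fun h u α hu hα x hx => h x hx u α hu hα, fun h x hx u α hu hα => h u α hu hα x hx⟩

theorem mem_vecBubble {K : Tetra} {m : ℕ} {v : PVec} :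
    v ∈ vecBubble K m ↔ v ∈ PV m ∧ ∀ d j, K.bary d ∣ v j := by
  refine and_congr Iff.rfl (forall_congr' fun d => ?_)
  simp_rw [K.bary_dvd_iff]
  exact ⟨fun h j x hx => congrFun (h x hx) j, fun h x hx => funext fun j => h j x hx⟩

theorem Tetra.bary_dvd_bubble (K : Tetra) (i : Fin 4) : K.bary i ∣ K.bubble :=
  Finset.dvd_prod_of_mem _ (Finset.mem_univ i)

theorem Tetra.bubble_mem_P (K : Tetra) : K.bubble ∈ P 4 := by
  rw [bubble, Fin.prod_univ_four]
  exact mul_mem_P (mul_mem_P (mul_mem_P (K.bary_mem_P 0) (K.bary_mem_P 1)) (K.bary_mem_P 2))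
    (K.bary_mem_P 3)

theorem vecBubble_eq (K : Tetra) (m : ℕ) : vecBubble K (m + 4) = bubbleTimes K m := by
  ext v
  rw [mem_vecBubble]
  constructor
  · rintro ⟨h1, h2⟩
    have h3 : ∀ j, ∃ q ∈ P m, v j = K.bubble * q := fun j =>
      K.exists_bubble_mul (h1 j) fun d => h2 d j
    choose q hq hv using h3
    exact ⟨q, hq, funext fun j => (hv j).symm⟩
  · rintro ⟨q, hq, rfl⟩
    refine ⟨fun j => ?_, fun d j => ?_⟩
    · rw [add_comm]
      exact mul_mem_P K.bubble_mem_P (hq j)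
    · exact (K.bary_dvd_bubble d).mul_right _

/-! ### The operators of the complex -/

theorem bilin_one (n u : Vec) : bilin n u (1 : PMat) = C (n ⬝ᵥ u) := by
  rw [bilin, Matrix.one_mulVec]
  simp [constVec, dotProduct]

theorem bilin_smul_poly (n u : Vec) (p : Poly) (τ : PMat) :
    bilin n u (p • τ) = p * bilin n u τ := by
  simp only [bilin, Matrix.smul_mulVec, dotProduct_smul, smul_eq_mul]

theorem bilin_dev (n u : Vec) (A : PMat) (h : n ⬝ᵥ u = 0) : bilin n u (dev A) = bilin n u A := by
  rw [dev, bilin_sub, bilin_smul_poly, bilin_one, h, C_0, mul_zero, sub_zero]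

/-- `dev` only subtracts a multiple of the identity, which acts as a scalar on every vector. A
potential for the full gradient is therefore also one for the deviatoric gradient. -/
theorem Tetra.isScalarOn_sub_dev (K : Tetra) {d : Fin 4} {τ A : PMat} :
    K.IsScalarOn d (τ - dev A) ↔ K.IsScalarOn d (τ - A) := by
  refine forall_congr' fun u => forall_congr' fun α => forall_congr' fun _ =>
    forall_congr' fun h => ?_
  rw [bilin_sub, bilin_sub, bilin_dev _ _ _ h]

theorem trace_dev (A : PMat) : (dev A).trace = 0 := by
  rw [dev, Matrix.trace_sub, Matrix.trace_smul, Matrix.trace_one, Fintype.card_fin,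
    smul_eq_mul, smul_mul_assoc, smul_eq_C_mul, sub_eq_zero, Nat.cast_ofNat, mul_comm A.trace,
    ← mul_assoc, show (3 : Poly) = C 3 from rfl, ← C_mul]
  norm_num

theorem gradV_mem_P {m : ℕ} {v : PVec} (hv : v ∈ PV (m + 1)) (i j : Fin 3) : gradV v i j ∈ P m :=
  pderiv_mem_P j (hv i)

theorem devGrad_mem_PT {m : ℕ} {v : PVec} (hv : v ∈ PV (m + 1)) : devGrad v ∈ PT m := by
  refine ⟨fun i j => ?_, trace_dev _⟩
  change (gradV v - ((1 / 3 : ℝ) • (gradV v).trace) • (1 : PMat)) i j ∈ P m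
  rw [Matrix.sub_apply, Matrix.smul_apply, Matrix.one_apply]
  refine Submodule.sub_mem _ (gradV_mem_P hv i j) ?_
  split_ifs
  · rw [smul_eq_mul, mul_one]
    exact Submodule.smul_mem _ _ (Submodule.sum_mem _ fun i _ => gradV_mem_P hv i i)
  · rw [smul_zero]
    exact Submodule.zero_mem _

theorem devGrad_mem_symCurlBubble {K : Tetra} {m : ℕ} {v : PVec} (hv : v ∈ vecBubble K (m + 1)) :
    devGrad v ∈ symCurlBubble K m := by
  rw [mem_vecBubble] at hv
  refine mem_symCurlBubble.2 ⟨devGrad_mem_PT hv.1, fun d u α hu hα => ?_⟩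
  change _ ∣ bilin α u (dev (gradV v))
  rw [bilin_dev _ _ _ hα, bilin_gradV]
  refine K.bary_dvd_dirD hu (Finset.dvd_sum fun j _ => (hv.2 d j).mul_left _)

theorem symCurl_devGrad (v : PVec) : symCurl (devGrad v) = 0 := by
  have h : ∀ A : PMat, symCurl A = symPart (curlM A) := fun _ => rfl
  ext1 i j
  rw [h]
  change symPart (curlM (gradV v - ((1 / 3 : ℝ) • (gradV v).trace) • (1 : PMat))) i j = 0
  generalize (1 / 3 : ℝ) • (gradV v).trace = p
  fin_cases i <;> fin_cases j <;>
    simp [symPart, curlM, curlV, gradV, gradS, Matrix.sub_apply, Matrix.one_apply,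
      pderiv_comm 1 0, pderiv_comm 2 0, pderiv_comm 2 1]

theorem divDiv_symPart (A : PMat) : divDiv (symPart A) = divDiv A := by
  have h : ∀ B : PMat, divDiv B = ∑ i, ∑ j, pderiv i (pderiv j (B i j)) := fun B => by
    change divV (divM B) = _
    simp [divV, divM]
  have ht : divDiv Aᵀ = divDiv A := by
    rw [h, h, Finset.sum_comm]
    refine Finset.sum_congr rfl fun i _ => Finset.sum_congr rfl fun j _ => ?_
    rw [Matrix.transpose_apply, pderiv_comm]
  rw [symPart, map_smul, map_add, ht, ← two_smul ℝ, smul_smul]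
  norm_num

theorem divV_curlV (v : PVec) : divV (curlV v) = 0 := by
  simp [divV, curlV, Fin.sum_univ_three, pderiv_comm 1 0, pderiv_comm 2 0, pderiv_comm 2 1]

theorem divDiv_symCurl (A : PMat) : divDiv (symCurl A) = 0 := by
  have h1 : divDiv (symCurl A) = divDiv (symPart (curlM A)) := rfl
  rw [h1, divDiv_symPart]
  change ∑ i, pderiv i (divV (curlV (A i))) = 0
  simp [divV_curlV]

/-- Trace-free tensors with vanishing `sym curl` are deviatoric gradients. -/
theorem exists_devGrad_eq {m : ℕ} {τ : PMat} (hτ : τ ∈ PT (m + 1)) (h : symCurl τ = 0) :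
    ∃ v ∈ PV (m + 2), devGrad v = τ := by
  have hM : ∀ i j, curlM τ i j + curlM τ j i = 0 := fun i j => by
    have h1 : (symPart (curlM τ)) i j = 0 := congrFun (congrFun h i) j
    rw [symPart, Matrix.smul_apply, Matrix.add_apply, Matrix.transpose_apply, smul_eq_zero] at h1
    exact h1.resolve_left (by norm_num)
  have hMP : ∀ i j, curlM τ i j ∈ P m := fun i j => by
    have := fun k l => pderiv_mem_P k (hτ.1 i l)
    simp only [Nat.add_sub_cancel] at this
    fin_cases j
    · exact Submodule.sub_mem _ (this 1 2) (this 2 1)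
    · exact Submodule.sub_mem _ (this 2 0) (this 0 2)
    · exact Submodule.sub_mem _ (this 0 1) (this 1 0)
  have hdiv : ∀ i, pderiv 0 (curlM τ i 0) + pderiv 1 (curlM τ i 1) + pderiv 2 (curlM τ i 2) = 0 :=
    fun i => by
      have := divV_curlV (τ i)
      rw [divV, Fin.sum_univ_three] at this
      exact this
  have h00 : ∀ i, curlM τ i i = 0 := fun i => by
    have := hM i i
    rwa [← two_mul, mul_eq_zero, or_iff_right two_ne_zero] at this
  have sk : ∀ i j, curlM τ i j = -curlM τ j i := fun i j => eq_neg_of_add_eq_zero_left (hM i j)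
  -- `curl τ` is skew. Since its rows are divergence-free, its axial vector is curl-free and so is
  -- the gradient of some `s`.
  obtain ⟨s, hs, hsw⟩ := exists_gradS_eq (m := m)
    (w := ![curlM τ 2 1, curlM τ 0 2, curlM τ 1 0]) (by
      intro i
      fin_cases i
      · exact hMP 2 1
      · exact hMP 0 2
      · exact hMP 1 0) (by
      have d0 := hdiv 0
      have d1 := hdiv 1
      have d2 := hdiv 2
      rw [h00, map_zero] at d0 d1 d2
      rw [sk 0 1, map_neg] at d0
      rw [sk 1 2, map_neg] at d1
      rw [sk 2 0, map_neg] at d2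
      funext i
      fin_cases i
      · simp only [curlV, Fin.zero_eta, Matrix.cons_val, Pi.zero_apply]
        linear_combination -d0
      · simp only [curlV, Fin.mk_one, Matrix.cons_val, Pi.zero_apply]
        linear_combination -d1
      · simp only [curlV, Fin.reduceFinMk, Matrix.cons_val, Pi.zero_apply]
        linear_combination -d2)
  have g0 : pderiv 0 s = curlM τ 2 1 := congrFun hsw 0
  have g1 : pderiv 1 s = curlM τ 0 2 := congrFun hsw 1
  have g2 : pderiv 2 s = curlM τ 1 0 := congrFun hsw 2
  -- The row-wise curl of `s` times the identity is skew with the opposite axial vector, so `τ + s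
  -- I` is curl-free and hence a gradient; its deviatoric part is `τ`.
  have hrow : ∀ i, ∃ p ∈ P (m + 2), gradS p = τ i + Pi.single i s := fun i => by
    refine exists_gradS_eq (m := m + 1) (fun j => ?_) ?_
    · refine Submodule.add_mem _ (hτ.1 i j) ?_
      by_cases hij : j = i
      · rw [hij, Pi.single_eq_same]; exact hs
      · rw [Pi.single_eq_of_ne hij]; exact Submodule.zero_mem _
    · have e : curlV (τ i + Pi.single i s) = curlM τ i + curlV (Pi.single i s) := by
        funext j
        fin_cases j <;> simp [curlV, curlM] <;> ring
      rw [e]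
      funext j
      have hs01 := sk 0 1
      have hs12 := sk 1 2
      have hs20 := sk 2 0
      fin_cases i <;> fin_cases j <;>
        simp [curlV, g0, g1, g2, h00, hs01, hs12, hs20]
  choose v hv hgv using hrow
  refine ⟨v, hv, ?_⟩
  have e : gradV v = τ + s • (1 : PMat) := by
    ext1 i j
    change gradS (v i) j = _
    rw [hgv]
    simp [Pi.single_apply, Matrix.one_apply, eq_comm]
  change dev (gradV v) = τ
  have ht := hτ.2
  rw [dev, e, Matrix.trace_add, ht, zero_add, Matrix.trace_smul, Matrix.trace_one,
    Fintype.card_fin]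
  have : (1 / 3 : ℝ) • (s • ((3 : ℕ) : Poly)) = s := by
    rw [smul_eq_mul, smul_eq_C_mul, Nat.cast_ofNat, mul_comm s, ← mul_assoc,
      show (3 : Poly) = C 3 from rfl, ← C_mul]
    norm_num
  rw [this, add_sub_cancel_right]

/-- The three trace conditions satisfied by the `div div` bubbles. -/
structure Tetra.TraceFree (K : Tetra) (σ : PMat) : Prop where
  nn : ∀ d, K.bary d ∣ bilin (K.baryGrad d) (K.baryGrad d) σ
  trace2 : ∀ d, K.bary d ∣ trace2 (K.baryGrad d) σ
  edge : ∀ c d, c ≠ d → bilin (K.baryGrad c) (K.baryGrad d) σ ∈ K.edgeIdeal c d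

theorem C_mul_mem_iff (I : Ideal Poly) {c : ℝ} (hc : c ≠ 0) {p : Poly} :
    C c * p ∈ I ↔ p ∈ I :=
  Ideal.unit_mul_mem_iff_mem I ((isUnit_iff_ne_zero.2 hc).map C)

/-- The chart formulas write each trace through derivatives, tangential to the relevant face, of the
five quantities that vanish there; tangential derivatives preserve the face ideal. -/
theorem Tetra.traceFree_symCurl (K : Tetra) {ω : PMat} (h : ∀ d, K.IsScalarOn d ω) :
    K.TraceFree (symCurl ω) := by
  have t20 : ∀ π, K.baryGrad (π 3) ⬝ᵥ K.tan π 0 = 0 := fun π => K.cotan_dot_tan π 2 0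
  have t21 : ∀ π, K.baryGrad (π 3) ⬝ᵥ K.tan π 1 = 0 := fun π => K.cotan_dot_tan π 2 1
  have hnn : ∀ d, K.bary d ∣ bilin (K.baryGrad d) (K.baryGrad d) (symCurl ω) := fun d => by
    obtain ⟨π, rfl⟩ := exists_perm_last (d := d)
    obtain ⟨p20, p21, p01, p10, p00⟩ := (K.isScalarOn_iff π _).1 (h (π 3))
    have e := K.bilin_symCurl_two_two π ω
    change C (K.chartDet π) * bilin (K.baryGrad (π 3)) (K.baryGrad (π 3)) (symCurl ω) = _ at e
    rw [← dvd_C_mul_iff (K.chartDet_ne_zero π), e]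
    exact dvd_sub (K.bary_dvd_dirD (t20 π) p21) (K.bary_dvd_dirD (t21 π) p20)
  refine ⟨hnn, fun d => ?_, fun c d hcd => ?_⟩
  · have h1 := hnn d
    obtain ⟨π, rfl⟩ := exists_perm_last (d := d)
    obtain ⟨p20, p21, p01, p10, p00⟩ := (K.isScalarOn_iff π _).1 (h (π 3))
    rw [K.dvd_trace2_iff π h1, ← dvd_C_mul_iff (K.chartDet_ne_zero π), K.chartTrace_symCurl]
    have k1 := K.bary_dvd_dirD (t20 π) (K.bary_dvd_dirD (t20 π) p01)
    have k2 := K.bary_dvd_dirD (t20 π) (K.bary_dvd_dirD (t21 π) p00)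
    have k3 := K.bary_dvd_dirD (t21 π) (K.bary_dvd_dirD (t21 π) p10)
    rw [map_sub, map_sub] at k2
    convert dvd_sub (dvd_sub k1 k2) k3 using 1
    ring
  · obtain ⟨π, rfl, rfl⟩ := exists_perm_last_two hcd
    have g20 : K.baryGrad (π 2) ⬝ᵥ K.tan π 0 = 0 := K.cotan_dot_tan π 1 0
    have g22 : K.baryGrad (π 2) ⬝ᵥ K.tan π 2 = 0 := K.cotan_dot_tan π 1 2
    obtain ⟨p20, p21, p01, p10, p00⟩ := (K.isScalarOn_iff π _).1 (h (π 3))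
    have q20 := h (π 2) (K.tan π 0) (K.cotan π 2) g20 (K.cotan_dot_tan π 2 0)
    have q00 := (h (π 2)).sub_dvd g20 g22 (α := K.cotan π 0) (β := K.cotan π 2)
      (K.cotan_dot_tan π 0 0) (K.cotan_dot_tan π 0 2) (K.cotan_dot_tan π 2 0)
      (K.cotan_dot_tan π 2 2)
    have k1 := K.mem_edgeIdeal_of_dvd_right (c := π 2) (K.bary_dvd_dirD (t21 π) p10)
    have k2 := K.mem_edgeIdeal_of_dvd_left (d := π 3) (K.bary_dvd_dirD g22 q20)
    have k3 := K.mem_edgeIdeal_of_dvd_right (c := π 2) (K.bary_dvd_dirD (t20 π) p00)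
    have k4 := K.mem_edgeIdeal_of_dvd_left (d := π 3) (K.bary_dvd_dirD g20 q00)
    have e := K.bilin_symCurl_one_two π ω
    change 2 * C (K.chartDet π) * bilin (K.baryGrad (π 2)) (K.baryGrad (π 3)) (symCurl ω) = _ at e
    rw [show (2 : Poly) = C 2 from rfl, ← C_mul] at e
    rw [← C_mul_mem_iff _ (mul_ne_zero two_ne_zero (K.chartDet_ne_zero π)), e]
    rw [map_sub] at k3 k4
    convert Ideal.add_mem _ (Ideal.sub_mem _ k4 k3) (Ideal.sub_mem _ k2 k1) using 1
    ring

/-- Exactness at the space of trace-free tensors with vanishing traces. -/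
theorem exists_vecBubble_devGrad_eq {K : Tetra} {m : ℕ} {τ : PMat}
    (hτ : τ ∈ symCurlBubble K (m + 1)) (h : symCurl τ = 0) :
    ∃ v ∈ vecBubble K (m + 2), devGrad v = τ := by
  obtain ⟨hT, hS⟩ := mem_symCurlBubble.1 hτ
  obtain ⟨v, hv, rfl⟩ := exists_devGrad_eq hT h
  have hgr : ∀ d, K.IsScalarOn d (gradV v) := fun d u α hu hα => by
    have := hS d u α hu hα
    change _ ∣ bilin α u (dev (gradV v)) at this
    rwa [bilin_dev _ _ _ hα] at this
  have hrt : ∀ d, ∃ a b, ∀ j, K.bary d ∣ v j - rtField a b j := fun d => by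
    obtain ⟨π, rfl⟩ := exists_perm_last (d := d)
    exact K.exists_rtField_on_face π (hgr _)
  choose a b hab using hrt
  -- Faces `c` and `d` share two vertices, and two fields `a + b x` that agree at two distinct
  -- points are equal.
  have heq : ∀ c d, rtField (a c) (b c) = rtField (a d) (b d) := fun c d => by
    have hex : ∀ c d : Fin 4, ∃ p q, p ≠ q ∧ p ≠ c ∧ p ≠ d ∧ q ≠ c ∧ q ≠ d := by decide
    obtain ⟨p, q, hpq, hpc, hpd, hqc, hqd⟩ := hex c d
    have hv : ∀ r, r ≠ c → r ≠ d → ∀ j,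
        a c j + b c * K.points r j = a d j + b d * K.points r j := fun r hrc hrd j => by
      have h1 := K.eval_eq_zero_of_dvd (x := K.points r)
        (by rw [K.eval_bary_points, if_neg hrc.symm]) (hab c j)
      have h2 := K.eval_eq_zero_of_dvd (x := K.points r)
        (by rw [K.eval_bary_points, if_neg hrd.symm]) (hab d j)
      simp only [rtField, map_sub, map_add, map_mul, eval_C, eval_X] at h1 h2
      linarith
    have hb : b c = b d := by
      by_contra hne
      apply hpq
      apply K.independent.injective
      funext j
      have h1 := hv p hpc hpd j
      have h2 := hv q hqc hqd j
      have h3 : (b c - b d) * (K.points p j - K.points q j) = 0 := by linarith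
      have := (mul_eq_zero.1 h3).resolve_left (sub_ne_zero.2 hne)
      linarith
    funext j
    have h1 := hv p hpc hpd j
    rw [hb] at h1
    simp only [rtField, hb]
    rw [add_right_cancel h1]
  refine ⟨v - rtField (a 0) (b 0), mem_vecBubble.2 ⟨Submodule.sub_mem _ hv
    (PV_mono (by omega) (rtField_mem_PV _ _)), fun d j => ?_⟩, ?_⟩
  · rw [heq 0 d]
    exact hab d j
  · rw [map_sub, sub_eq_self]
    change dev (gradV (rtField (a 0) (b 0))) = 0
    have e : gradV (rtField (a 0) (b 0)) = (C (b 0) : Poly) • (1 : PMat) := by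
      ext1 i j
      simp [gradV, gradS, rtField, Matrix.one_apply, pderiv_X, Pi.single_apply]
    rw [dev, e, Matrix.trace_smul, Matrix.trace_one, Fintype.card_fin, smul_eq_mul,
      smul_eq_C_mul, Nat.cast_ofNat, mul_comm (C (b 0)), ← mul_assoc,
      show (3 : Poly) = C 3 from rfl, ← C_mul]
    norm_num

/-- Symmetric tensors in the range of `sym curl` with vanishing traces have a potential with
vanishing traces. -/
theorem exists_symCurlBubble_add {K : Tetra} {m : ℕ} {τ : PMat} (hτ : τ ∈ PT (m + 2))
    (h : K.TraceFree (symCurl τ)) :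
    ∃ v ∈ PV (m + 3), τ - devGrad v ∈ symCurlBubble K (m + 2) := by
  obtain ⟨v, hv, hS⟩ := K.exists_potential hτ.1 h.nn h.trace2 h.edge
  refine ⟨v, hv, mem_symCurlBubble.2 ⟨Submodule.sub_mem _ hτ (devGrad_mem_PT hv), fun d => ?_⟩⟩
  exact K.isScalarOn_sub_dev.2 (hS d)

end

end DivDiv

/-! ### Unisolvence: the degrees of freedom of the `div div` bubbles determine their traces. -/

namespace DivDiv

open MeasureTheory MvPolynomial
open scoped Matrix

noncomputable section

/-! ### Integrals over edges and faces -/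

theorem exists_axis_mul {m : ℕ} {p : Poly} (hp : p ∈ P (m + 1)) (h : eval 0 p = 0) :
    ∃ q ∈ P m, p - X 0 * q ∈ Ideal.span {(X 1 : Poly), X 2} := by
  have key : ∀ p : Poly, ∃ u, axisRes p = X 0 * u + C (eval 0 p) := fun p => by
    induction p using MvPolynomial.induction_on with
    | C a => exact ⟨0, by simp [axisRes]⟩
    | add p q hp hq =>
      obtain ⟨u, hu⟩ := hp
      obtain ⟨v, hv⟩ := hq
      exact ⟨u + v, by rw [map_add, hu, hv, map_add, C_add]; ring⟩
    | mul_X p j hp =>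
      obtain ⟨u, hu⟩ := hp
      fin_cases j
      · exact ⟨axisRes p, by simp [axisRes, mul_comm]⟩
      · exact ⟨0, by simp [axisRes]⟩
      · exact ⟨0, by simp [axisRes]⟩
  obtain ⟨u, hu⟩ := key p
  rw [h, C_0, add_zero] at hu
  refine ⟨u, mem_P_of_mul_mem (p := X 0) (by simp) ?_, ?_⟩
  · rw [← hu, mem_P, axisRes]
    refine (totalDegree_aeval_le (fun i => ?_) p).trans (mem_P.1 hp)
    fin_cases i <;> simp
  · rw [← hu]
    exact sub_axisRes_mem p

theorem Tetra.exists_edge_mul (K : Tetra) (π : Equiv.Perm (Fin 4)) {m : ℕ} {p : Poly}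
    (hp : p ∈ P (m + 1)) (h : eval (K.points (π 0)) p = 0) :
    ∃ q ∈ P m, p - K.bary (π 1) * q ∈ K.edgeIdeal (π 2) (π 3) := by
  obtain ⟨q, hq, hpq⟩ := exists_axis_mul ((K.chart_mem_P π).2 hp) (by
    rw [eval_chart, chartPoint]
    simpa using h)
  refine ⟨(K.chart π).symm q, ?_, ?_⟩
  · rw [← K.chart_mem_P π, AlgEquiv.apply_symm_apply]
    exact hq
  · rw [← chart_mem_span, map_sub, map_mul, AlgEquiv.apply_symm_apply,
      show K.chart π (K.bary (π 1)) = X 0 from K.chart_bary π 0]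
    exact hpq

theorem Tetra.edgePoint_eq (K : Tetra) (π : Equiv.Perm (Fin 4)) (t : ℝ) :
    K.edgePoint (π 0) (π 1) t = K.chartPoint π ![t, 0, 0] := by
  rw [chartPoint, Fin.sum_univ_three]
  simp [edgePoint, tan]

theorem Tetra.eval_bary_edgePoint (K : Tetra) (π : Equiv.Perm (Fin 4)) (t : ℝ) :
    eval (K.edgePoint (π 0) (π 1) t) (K.bary (π 0)) = 1 - t ∧
    eval (K.edgePoint (π 0) (π 1) t) (K.bary (π 1)) = t ∧
    eval (K.edgePoint (π 0) (π 1) t) (K.bary (π 2)) = 0 ∧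
    eval (K.edgePoint (π 0) (π 1) t) (K.bary (π 3)) = 0 := by
  rw [edgePoint_eq]
  have h1 : eval (K.chartPoint π ![t, 0, 0]) (K.bary (π 1)) = t :=
    K.eval_bary_chartPoint π _ 0
  have h2 : eval (K.chartPoint π ![t, 0, 0]) (K.bary (π 2)) = 0 :=
    K.eval_bary_chartPoint π _ 1
  have h3 : eval (K.chartPoint π ![t, 0, 0]) (K.bary (π 3)) = 0 :=
    K.eval_bary_chartPoint π _ 2
  refine ⟨?_, h1, h2, h3⟩
  have h := K.sum_eval_bary (K.chartPoint π ![t, 0, 0])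
  rw [← Equiv.sum_comp π, Fin.sum_univ_four, h1, h2, h3] at h
  linarith

theorem Tetra.edgeInt_eq_zero (K : Tetra) (π : Equiv.Perm (Fin 4)) {p : Poly}
    (h : p ∈ K.edgeIdeal (π 2) (π 3)) : K.edgeInt (π 0) (π 1) p = 0 := by
  have h1 : ∀ t, eval (K.edgePoint (π 0) (π 1) t) p = 0 := fun t =>
    K.eval_eq_zero_of_mem_edgeIdeal (K.eval_bary_edgePoint π t).2.2.1
      (K.eval_bary_edgePoint π t).2.2.2 h
  simp [edgeInt, h1]

/-- A polynomial of degree `m + 2` on an edge, vanishing at the end points and orthogonal to the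
polynomials of degree `m`, vanishes. -/
theorem Tetra.mem_edgeIdeal_of_edgeInt (K : Tetra) (π : Equiv.Perm (Fin 4)) {m : ℕ} {p : Poly}
    (hp : p ∈ P (m + 2)) (h0 : eval (K.points (π 0)) p = 0) (h1 : eval (K.points (π 1)) p = 0)
    (h : ∀ q ∈ P m, K.edgeInt (π 0) (π 1) (p * q) = 0) : p ∈ K.edgeIdeal (π 2) (π 3) := by
  obtain ⟨q, hq, k1⟩ := K.exists_edge_mul π hp h0
  have hq1 : eval (K.points (π 1)) q = 0 := by
    have := K.eval_eq_zero_of_mem_edgeIdeal (x := K.points (π 1))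
      (by rw [eval_bary_points]; simp) (by rw [eval_bary_points]; simp) k1
    rw [map_sub, map_mul, h1, eval_bary_points, if_pos rfl] at this
    linarith
  obtain ⟨π', e0, e1, e2, e3⟩ : ∃ π' : Equiv.Perm (Fin 4),
      π' 0 = π 1 ∧ π' 1 = π 0 ∧ π' 2 = π 2 ∧ π' 3 = π 3 :=
    ⟨(Equiv.swap 0 1).trans π, by simp, by simp, by
      rw [Equiv.trans_apply, Equiv.swap_apply_of_ne_of_ne (by decide) (by decide)], by
      rw [Equiv.trans_apply, Equiv.swap_apply_of_ne_of_ne (by decide) (by decide)]⟩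
  obtain ⟨g, hg, k2⟩ := K.exists_edge_mul π' hq (by rwa [e0])
  rw [e1, e2, e3] at k2
  have k3 : p - K.bary (π 1) * K.bary (π 0) * g ∈ K.edgeIdeal (π 2) (π 3) := by
    have := Ideal.add_mem _ k1 (Ideal.mul_mem_left _ (K.bary (π 1)) k2)
    convert this using 1
    ring
  -- On the edge `p` equals `g` times the quadratic edge bubble. Testing with `g` itself gives an
  -- integral of `g²` with a weight positive inside the edge.
  have k4 := K.edgeInt_eq_zero π (Ideal.mul_mem_left _ g k3)
  have k5 : g * (p - K.bary (π 1) * K.bary (π 0) * g) =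
      p * g - K.bary (π 1) * K.bary (π 0) * g * g := by ring
  rw [k5, map_sub, h g hg, zero_sub, neg_eq_zero] at k4
  change Real.sqrt _ * _ = 0 at k4
  have hne : K.points (π 1) - K.points (π 0) ≠ 0 :=
    sub_ne_zero.2 (K.independent.injective.ne (π.injective.ne (by decide)))
  have hs : Real.sqrt ((K.points (π 1) - K.points (π 0)) ⬝ᵥ
      (K.points (π 1) - K.points (π 0))) ≠ 0 := by
    rw [Real.sqrt_ne_zero']
    exact lt_of_le_of_ne (Finset.sum_nonneg fun _ _ => mul_self_nonneg _)
      (dotProduct_self_ne_zero hne).symm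
  have k6 := (mul_eq_zero.1 k4).resolve_left hs
  have hcont : Continuous fun t => eval (K.edgePoint (π 0) (π 1) t)
      (K.bary (π 1) * K.bary (π 0) * g * g) := by
    refine (continuous_eval _).comp ?_
    unfold Tetra.edgePoint
    fun_prop
  have hval : ∀ t, eval (K.edgePoint (π 0) (π 1) t) (K.bary (π 1) * K.bary (π 0) * g * g) =
      t * (1 - t) * (eval (K.edgePoint (π 0) (π 1) t) g) ^ 2 := fun t => by
    rw [map_mul, map_mul, map_mul, (K.eval_bary_edgePoint π t).1,
      (K.eval_bary_edgePoint π t).2.1]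
    ring
  have hg0 : ∀ t ∈ Set.Ioo (0 : ℝ) 1, eval (K.edgePoint (π 0) (π 1) t) g = 0 := by
    by_contra! hcon
    obtain ⟨t, ht, htg⟩ := hcon
    have := intervalIntegral.integral_pos (zero_lt_one' ℝ) hcont.continuousOn
      (fun s hs => by
        rw [hval]
        exact mul_nonneg (mul_nonneg hs.1.le (sub_nonneg.2 hs.2)) (sq_nonneg _))
      ⟨t, ⟨ht.1.le, ht.2.le⟩, by
        rw [hval]
        exact mul_pos (mul_pos ht.1 (sub_pos.2 ht.2)) (by positivity)⟩
    exact this.ne' k6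
  have hgI : g ∈ K.edgeIdeal (π 2) (π 3) := K.mem_edgeIdeal_of_forall π fun t ht => by
    rw [← edgePoint_eq]
    exact hg0 t ht
  have := Ideal.add_mem _ k3 (Ideal.mul_mem_left _ (K.bary (π 1) * K.bary (π 0)) hgI)
  rwa [sub_add_cancel] at this

theorem Tetra.faceInt_eq_zero (K : Tetra) {i : Fin 4} {p : Poly} (h : K.bary i ∣ p) :
    K.faceInt i p = 0 := by
  have h1 : ∫ s in refTriangle, eval (K.facePoint i s) p = 0 := by
    rw [setIntegral_congr_fun isCompact_refTriangle.measurableSet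
      (fun s hs => (K.bary_dvd_iff i p).1 h _ (K.facePoint_mem_face i hs))]
    simp
  change Real.sqrt _ * _ = 0
  rw [h1, mul_zero]

theorem refTriangle_box_subset :
    Set.Ioo (0 : ℝ) (1 / 2) ×ˢ Set.Ioo (0 : ℝ) (1 / 2) ⊆ refTriangle := by
  rintro s ⟨⟨h1, h2⟩, ⟨h3, h4⟩⟩
  exact ⟨h1.le, h3.le, by linarith⟩

theorem eq_zero_of_integral_refTriangle {f : ℝ × ℝ → ℝ} (hf : Continuous f)
    (h0 : ∀ s ∈ refTriangle, 0 ≤ f s) (h : ∫ s in refTriangle, f s = 0) :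
    ∀ s ∈ Set.Ioo (0 : ℝ) (1 / 2) ×ˢ Set.Ioo (0 : ℝ) (1 / 2), f s = 0 := by
  have hint : IntegrableOn f refTriangle :=
    hf.continuousOn.integrableOn_compact isCompact_refTriangle
  rw [setIntegral_eq_zero_iff_of_nonneg_ae
    ((ae_restrict_iff' isCompact_refTriangle.measurableSet).2 (Filter.Eventually.of_forall h0))
    hint] at h
  have h1 : f =ᵐ[volume.restrict (Set.Ioo (0 : ℝ) (1 / 2) ×ˢ Set.Ioo (0 : ℝ) (1 / 2))] 0 :=
    ae_restrict_of_ae_restrict_of_subset refTriangle_box_subset h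
  exact Measure.eqOn_open_of_ae_eq h1 (isOpen_Ioo.prod isOpen_Ioo) hf.continuousOn
    continuous_const.continuousOn

theorem Tetra.continuous_eval_facePoint (K : Tetra) (i : Fin 4) (p : Poly) :
    Continuous fun s => eval (K.facePoint i s) p := by
  refine (continuous_eval p).comp ?_
  unfold Tetra.facePoint
  fun_prop

theorem Tetra.faceInt_eq_zero_imp (K : Tetra) {i : Fin 4} {p : Poly}
    (h0 : ∀ s ∈ refTriangle, 0 ≤ eval (K.facePoint i s) p) (h : K.faceInt i p = 0) :
    K.bary i ∣ p := by
  have hs : Real.sqrt (K.areaVec i ⬝ᵥ K.areaVec i) ≠ 0 := by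
    rw [Real.sqrt_ne_zero']
    exact lt_of_le_of_ne (Finset.sum_nonneg fun _ _ => mul_self_nonneg _)
      (dotProduct_self_ne_zero (K.areaVec_ne_zero i)).symm
  exact K.bary_dvd_of_facePoint i (eq_zero_of_integral_refTriangle
    (K.continuous_eval_facePoint i p) h0 ((mul_eq_zero.1 h).resolve_left hs))

theorem Tetra.dvd_of_dvd_sq (K : Tetra) {i : Fin 4} {p : Poly} (h : K.bary i ∣ p * p) :
    K.bary i ∣ p := by
  rw [bary_dvd_iff] at h ⊢
  intro x hx
  simpa using h x hx

theorem Tetra.bary_dvd_of_faceInt_sq (K : Tetra) {i : Fin 4} {p : Poly}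
    (h : K.faceInt i (p * p) = 0) : K.bary i ∣ p :=
  K.dvd_of_dvd_sq (K.faceInt_eq_zero_imp (fun s _ => by
    rw [map_mul]; exact mul_self_nonneg _) h)

theorem Tetra.convex_bary_nonneg (K : Tetra) (i : Fin 4) :
    Convex ℝ {x : Vec | 0 ≤ eval x (K.bary i)} := by
  intro x hx y hy a b ha hb hab
  have key : ∀ x, eval x (K.bary i) = eval 0 (K.bary i) + K.baryGrad i ⬝ᵥ x := fun x => by
    simpa using K.eval_bary_sub i x 0
  rw [Set.mem_ofPred_eq, key] at hx hy ⊢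
  rw [dotProduct_add, dotProduct_smul, dotProduct_smul, smul_eq_mul, smul_eq_mul]
  have : b = 1 - a := by linarith
  subst this
  nlinarith [mul_nonneg ha hx, mul_nonneg hb hy]

theorem Tetra.eval_bary_facePoint_nonneg (K : Tetra) {i : Fin 4} (j : Fin 4) {x : Vec}
    (hx : x ∈ K.face i) : 0 ≤ eval x (K.bary j) := by
  refine convexHull_min ?_ (K.convex_bary_nonneg j) hx
  rintro _ ⟨a, rfl⟩
  rw [Set.mem_ofPred_eq, fv, eval_bary_points]
  split_ifs <;> norm_num

/-- A polynomial of degree `m + 3` on a face, vanishing on the edges and orthogonal to the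
polynomials of degree `m`, vanishes. -/
theorem Tetra.bary_dvd_of_faceInt (K : Tetra) {i : Fin 4} {m : ℕ} {p : Poly}
    (hp : p ∈ P (m + 3)) (he : ∀ c, c ≠ i → p ∈ K.edgeIdeal c i)
    (h : ∀ q ∈ P m, K.faceInt i (p * q) = 0) : K.bary i ∣ p := by
  obtain ⟨π, rfl⟩ := exists_perm_last (d := i)
  have hne : ∀ {a : Fin 4}, a ≠ 3 → π a ≠ π 3 := fun h => π.injective.ne h
  obtain ⟨g, hg, k⟩ := K.exists_faceBubble_mul π hp (he _ (hne (by decide)))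
    (he _ (hne (by decide))) (he _ (hne (by decide)))
  -- Testing with the quotient `g` leaves the integral of `g²` weighted by the cubic face bubble,
  -- which is nonnegative on the face.
  have k4 := K.faceInt_eq_zero (k.mul_right g)
  have k5 : (p - K.bary (π 0) * K.bary (π 1) * K.bary (π 2) * g) * g =
      p * g - K.bary (π 0) * K.bary (π 1) * K.bary (π 2) * (g * g) := by ring
  rw [k5, map_sub, h g hg, zero_sub, neg_eq_zero] at k4
  have k6 := K.faceInt_eq_zero_imp (fun s hs => by
    have hx := K.facePoint_mem_face (π 3) hs
    rw [map_mul, map_mul, map_mul, map_mul]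
    exact mul_nonneg (mul_nonneg (mul_nonneg (K.eval_bary_facePoint_nonneg _ hx)
      (K.eval_bary_facePoint_nonneg _ hx)) (K.eval_bary_facePoint_nonneg _ hx))
      (mul_self_nonneg _)) k4
  have k7 : K.bary (π 3) ∣ g := by
    rw [mul_assoc, mul_assoc] at k6
    exact K.dvd_of_dvd_sq (K.bary_dvd_of_dvd_mul (hne (by decide)) (K.bary_dvd_of_dvd_mul
      (hne (by decide)) (K.bary_dvd_of_dvd_mul (hne (by decide)) k6)))
  have := dvd_add k (k7.mul_left (K.bary (π 0) * K.bary (π 1) * K.bary (π 2)))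
  rwa [sub_add_cancel] at this

/-! ### Shape functions -/

/-- The linear polynomial `n · x`. -/
def lin (n : Vec) : Poly := ∑ j, C (n j) * X j

theorem bilin_xxT (n m : Vec) (q : Poly) : bilin n m (xxT q) = lin n * lin m * q := by
  rw [bilin_eq_sum, lin, lin, Finset.sum_mul_sum, Finset.sum_mul]
  refine Finset.sum_congr rfl fun i _ => ?_
  rw [Finset.sum_mul]
  refine Finset.sum_congr rfl fun j _ => ?_
  change _ * (X i * X j * q) = _
  ring

theorem Tetra.lin_eq_chart (K : Tetra) (π : Equiv.Perm (Fin 4)) (n : Vec) :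
    lin n = C (n ⬝ᵥ K.points (π 0)) + ∑ a, C (n ⬝ᵥ K.tan π a) * K.bary (π a.succ) := by
  have h : ∀ j, C (n j) * (X j : Poly) = C (n j * K.points (π 0) j) +
      ∑ a, C (n j * K.tan π a j) * K.bary (π a.succ) := fun j => by
    rw [K.X_eq_chart π j, mul_add, ← C_mul, Finset.mul_sum]
    simp_rw [← mul_assoc, ← C_mul]
  simp_rw [lin, h, Finset.sum_add_distrib, dotProduct, map_sum, Finset.sum_mul]
  rw [Finset.sum_comm]

/-- A linear function whose gradient is normal to the edge is constant on it. -/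
theorem Tetra.lin_sub_C_mem (K : Tetra) (π : Equiv.Perm (Fin 4)) {n : Vec}
    (h : n ⬝ᵥ K.tan π 0 = 0) :
    lin n - C (n ⬝ᵥ K.points (π 0)) ∈ K.edgeIdeal (π 2) (π 3) := by
  rw [K.lin_eq_chart π, add_sub_cancel_left, Fin.sum_univ_three, h, C_0, zero_mul, zero_add]
  exact Ideal.mem_span_pair.2 ⟨_, _, rfl⟩

theorem Tetra.exists_lin_baryGrad (K : Tetra) (d : Fin 4) :
    ∃ γ : ℝ, lin (K.baryGrad d) = K.bary d + C γ := by
  obtain ⟨π, rfl⟩ := exists_perm_last (d := d)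
  refine ⟨K.baryGrad (π 3) ⬝ᵥ K.points (π 0), ?_⟩
  have h : ∀ a, K.baryGrad (π 3) ⬝ᵥ K.tan π a = if 2 = a then 1 else 0 := K.cotan_dot_tan π 2
  rw [K.lin_eq_chart π, Fin.sum_univ_three, h, h, h]
  simp [add_comm]

theorem symCurl_mem_P {m : ℕ} {τ : PMat} (hτ : ∀ i j, τ i j ∈ P (m + 1)) (i j : Fin 3) :
    symCurl τ i j ∈ P m := by
  have hMP : ∀ i j, curlM τ i j ∈ P m := fun i j => by
    have := fun k l => pderiv_mem_P k (hτ i l)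
    simp only [Nat.add_sub_cancel] at this
    fin_cases j
    · exact Submodule.sub_mem _ (this 1 2) (this 2 1)
    · exact Submodule.sub_mem _ (this 2 0) (this 0 2)
    · exact Submodule.sub_mem _ (this 0 1) (this 1 0)
  exact Submodule.smul_mem _ _ (Submodule.add_mem _ (hMP i j) (hMP j i))

theorem trace2_mem_P {m : ℕ} {σ : PMat} (hσ : ∀ i j, σ i j ∈ P m) (n : Vec) :
    trace2 n σ ∈ P (m - 1) := by
  rw [trace2_eq]
  refine Submodule.sub_mem _ ?_ (dirD_mem_P _ (bilin_mem_P hσ n n))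
  rw [show (2 : Poly) = C 2 from rfl]
  have h : ∀ i, (σ *ᵥ constVec n) i ∈ P m := fun i =>
    Submodule.sum_mem (P m) (t := Finset.univ) (f := fun j => σ i j * C (n j)) fun j _ => by
      rw [mul_comm]
      exact C_mul_mem_P _ (hσ i j)
  exact C_mul_mem_P _ (C_mul_mem_P _
    (Submodule.sum_mem (P (m - 1)) fun i _ => pderiv_mem_P i (h i)))

theorem mem_shape {l k : ℕ} {σ : PMat} :
    σ ∈ shape l k ↔ ∃ τ ∈ PT (l + 1), ∃ q ∈ P (k - 2), symCurl τ + xxT q = σ := by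
  rw [shape, Submodule.mem_sup]
  constructor
  · rintro ⟨_, ⟨τ, hτ, rfl⟩, _, ⟨q, hq, rfl⟩, h⟩
    exact ⟨τ, hτ, q, hq, h⟩
  · rintro ⟨τ, hτ, q, hq, h⟩
    exact ⟨_, ⟨τ, hτ, rfl⟩, _, ⟨q, hq, rfl⟩, h⟩

section Shape

variable {K : Tetra} {l k : ℕ} {σ : PMat}

/-- On an edge `n · x` is constant for normal `n`, so `x xᵀ q` contributes with the degree of `q`,
not two more. This is why moments up to degree `l - 2` suffice although the tensor may have degree
above `l`. -/
theorem exists_edge_reduction (hkl : k ≤ l + 2) (hσ : σ ∈ shape l k) (π : Equiv.Perm (Fin 4))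
    {n n' : Vec} (hn : n ⬝ᵥ K.tan π 0 = 0) (hn' : n' ⬝ᵥ K.tan π 0 = 0) :
    ∃ f ∈ P l, bilin n n' σ - f ∈ K.edgeIdeal (π 2) (π 3) := by
  obtain ⟨τ, hτ, q, hq, rfl⟩ := mem_shape.1 hσ
  refine ⟨bilin n n' (symCurl τ) + C (n ⬝ᵥ K.points (π 0)) * (C (n' ⬝ᵥ K.points (π 0)) * q),
    Submodule.add_mem _ (bilin_mem_P (symCurl_mem_P hτ.1) _ _)
      (C_mul_mem_P _ (C_mul_mem_P _ (P_mono (by omega) hq))), ?_⟩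
  rw [bilin_add, add_sub_add_left_eq_sub, bilin_xxT]
  have h1 := Ideal.mul_mem_right (lin n' * q) _ (K.lin_sub_C_mem π hn)
  have h2 := Ideal.mul_mem_left _ (C (n ⬝ᵥ K.points (π 0)) * q) (K.lin_sub_C_mem π hn')
  convert Ideal.add_mem _ h1 h2 using 1
  ring

theorem exists_face_reduction (hkl : k ≤ l + 2) (hσ : σ ∈ shape l k) (d : Fin 4) :
    ∃ f ∈ P l, K.bary d ∣ bilin (K.baryGrad d) (K.baryGrad d) σ - f := by
  obtain ⟨τ, hτ, q, hq, rfl⟩ := mem_shape.1 hσ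
  obtain ⟨γ, hγ⟩ := K.exists_lin_baryGrad d
  refine ⟨bilin (K.baryGrad d) (K.baryGrad d) (symCurl τ) + C γ * (C γ * q),
    Submodule.add_mem _ (bilin_mem_P (symCurl_mem_P hτ.1) _ _)
      (C_mul_mem_P _ (C_mul_mem_P _ (P_mono (by omega) hq))), ?_⟩
  rw [bilin_add, add_sub_add_left_eq_sub, bilin_xxT, hγ]
  exact ⟨(K.bary d + 2 * C γ) * q, by ring⟩

theorem divV_xxT_mulVec (n : Vec) (q : Poly) :
    divV (xxT q *ᵥ constVec n) = lin n * (4 * q + ∑ i, X i * pderiv i q) := by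
  have h : xxT q *ᵥ constVec n = fun i => X i * (lin n * q) := by
    funext i
    have h1 : (xxT q *ᵥ constVec n) i = ∑ j, X i * X j * q * C (n j) := rfl
    rw [h1, lin, Finset.sum_mul, Finset.mul_sum]
    exact Finset.sum_congr rfl fun j _ => by ring
  rw [h]
  simp only [divV, lin, Fin.sum_univ_three, pderiv_mul, map_add, pderiv_C, pderiv_X,
    Pi.single_apply]
  simp
  ring

theorem trace2_xxT (n : Vec) (q : Poly) :
    trace2 n (xxT q) = 2 * (C (n ⬝ᵥ n) * (lin n * (4 * q + ∑ i, X i * pderiv i q))) -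
      (2 * C (n ⬝ᵥ n) * lin n * q + lin n * lin n * dirD n q) := by
  have h : dirD n (lin n) = C (n ⬝ᵥ n) := by
    simp only [lin, map_sum, dirD_C_mul, dirD_X, ← C_mul, dotProduct]
  rw [trace2_eq, divV_xxT_mulVec, bilin_xxT, dirD_mul, dirD_mul, h]
  ring

theorem euler_mem_P {m : ℕ} {q : Poly} (hq : q ∈ P m) : ∑ i, X i * pderiv i q ∈ P m := by
  by_cases hm : m = 0
  · subst hm
    rw [mem_P, Nat.le_zero, totalDegree_eq_zero_iff_eq_C] at hq
    rw [hq]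
    simp
  · refine Submodule.sum_mem _ fun i _ => ?_
    have := mul_mem_P (X_mem_P i) (pderiv_mem_P i hq)
    rwa [show 1 + (m - 1) = m by omega] at this

/-- Every term of the second trace of `x xᵀ q` carries the factor `n · x`, constant on the face,
beside an expression of the degree of `q`. The bound `k - 2 ≤ l - 1` is where `k ≤ l + 1` is needed.
-/
theorem exists_trace2_reduction (hkl : k ≤ l + 1) (hσ : σ ∈ shape l k) (d : Fin 4) :
    ∃ f ∈ P (l - 1), K.bary d ∣ trace2 (K.baryGrad d) σ - f := by
  obtain ⟨τ, hτ, q, hq, rfl⟩ := mem_shape.1 hσ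
  obtain ⟨γ, hγ⟩ := K.exists_lin_baryGrad d
  set n := K.baryGrad d
  have hq' : q ∈ P (l - 1) := P_mono (by omega) hq
  refine ⟨trace2 n (symCurl τ) +
    (C 2 * (C (n ⬝ᵥ n) * (C γ * (C 4 * q + ∑ i, X i * pderiv i q))) -
      (C 2 * (C (n ⬝ᵥ n) * (C γ * q)) + C γ * (C γ * dirD n q))),
    Submodule.add_mem _ (trace2_mem_P (symCurl_mem_P hτ.1) n) (Submodule.sub_mem _
      (C_mul_mem_P _ (C_mul_mem_P _ (C_mul_mem_P _ (Submodule.add_mem _ (C_mul_mem_P _ hq')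
        (euler_mem_P hq'))))) (Submodule.add_mem _
        (C_mul_mem_P _ (C_mul_mem_P _ (C_mul_mem_P _ hq')))
        (C_mul_mem_P _ (C_mul_mem_P _ (P_mono (Nat.sub_le _ _) (dirD_mem_P n hq')))))), ?_⟩
  rw [trace2_add, add_sub_add_left_eq_sub, trace2_xxT, hγ, show (C 2 : Poly) = 2 from rfl,
    show (C 4 : Poly) = 4 from rfl]
  generalize ∑ i, X i * pderiv i q = e
  exact ⟨2 * C (n ⬝ᵥ n) * (4 * q + e) - 2 * C (n ⬝ᵥ n) * q -
    (K.bary d + 2 * C γ) * dirD n q, by ring⟩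

end Shape

/-! ### The `div div` bubbles -/

/-- Both pairs span the plane normal to the edge, so the edge conditions do not depend on the choice
of normals. -/
theorem EdgeNormals.span_eq {K : Tetra} (N : EdgeNormals K) (π : Equiv.Perm (Fin 4))
    (h : π 0 < π 1) :
    Submodule.span ℝ (Set.range (N.nrm (π 0) (π 1))) =
      Submodule.span ℝ {K.baryGrad (π 2), K.baryGrad (π 3)} := by
  refine Submodule.eq_of_le_of_finrank_le ?_ ?_
  · rw [Submodule.span_le]
    rintro _ ⟨a, rfl⟩
    have h1 := K.eq_sum_baryGrad π (N.nrm (π 0) (π 1) a)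
    have h2 : K.tan π 0 ⬝ᵥ N.nrm (π 0) (π 1) a = 0 := by
      rw [dotProduct_comm]
      exact N.orthogonal _ _ h a
    rw [Fin.sum_univ_three, h2, zero_smul, zero_add] at h1
    rw [SetLike.mem_coe, Submodule.mem_span_pair]
    exact ⟨_, _, h1.symm⟩
  · rw [finrank_span_eq_card (N.independent _ _ h)]
    refine (finrank_span_le_card _).trans ?_
    simpa using Finset.card_le_two

theorem bilin_zero_left (m : Vec) (τ : PMat) : bilin 0 m τ = 0 := by simp [bilin_eq_sum]

theorem bilin_zero_right (m : Vec) (τ : PMat) : bilin m 0 τ = 0 := by simp [bilin_eq_sum]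

theorem bilin_span_induction {s : Set Vec} {I : Submodule ℝ Poly} {σ : PMat}
    (h : ∀ n ∈ s, ∀ m ∈ s, bilin n m σ ∈ I) {n m : Vec} (hn : n ∈ Submodule.span ℝ s)
    (hm : m ∈ Submodule.span ℝ s) : bilin n m σ ∈ I := by
  induction hn using Submodule.span_induction with
  | mem n hn =>
    induction hm using Submodule.span_induction with
    | mem m hm => exact h n hn m hm
    | zero => rw [bilin_zero_right]; exact I.zero_mem
    | add x y _ _ hx hy => rw [bilin_add_right]; exact I.add_mem hx hy
    | smul c x _ hx => rw [bilin_smul_right, ← smul_eq_C_mul]; exact I.smul_mem c hx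
  | zero => rw [bilin_zero_left]; exact I.zero_mem
  | add x y _ _ hx hy => rw [bilin_add_left]; exact I.add_mem hx hy
  | smul c x _ hx => rw [bilin_smul_left, ← smul_eq_C_mul]; exact I.smul_mem c hx

theorem Tetra.TraceFree.edge_mem {K : Tetra} {σ : PMat} (h : K.TraceFree σ) {c d : Fin 4}
    (hcd : c ≠ d) {n m : Vec} (hn : n ∈ Submodule.span ℝ {K.baryGrad c, K.baryGrad d})
    (hm : m ∈ Submodule.span ℝ {K.baryGrad c, K.baryGrad d}) :
    bilin n m σ ∈ K.edgeIdeal c d := by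
  refine bilin_span_induction (I := (K.edgeIdeal c d).restrictScalars ℝ) ?_ hn hm
  rintro n (rfl | rfl) m (rfl | rfl)
  · exact K.mem_edgeIdeal_of_dvd_left (h.nn _)
  · exact h.edge _ _ hcd
  · rw [edgeIdeal_comm]
    exact h.edge _ _ hcd.symm
  · exact K.mem_edgeIdeal_of_dvd_right (h.nn _)

/-- Three faces meet at the vertex and their normals form a basis. Diagonal entries in this basis
vanish by the face condition, the others by the edge condition. -/
theorem Tetra.TraceFree.evalMat_points {K : Tetra} {σ : PMat} (h : K.TraceFree σ) (i : Fin 4) :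
    evalMat (K.points i) σ = 0 := by
  obtain ⟨π, hπ⟩ : ∃ π : Equiv.Perm (Fin 4), π 0 = i := ⟨Equiv.swap 0 i, by simp⟩
  have hz : ∀ a : Fin 3, eval (K.points i) (K.bary (π a.succ)) = 0 := fun a => by
    rw [← hπ, K.eval_bary_points]
    simp
  have h1 : ∀ a b : Fin 3, K.cotan π a ⬝ᵥ (evalMat (K.points i) σ *ᵥ K.cotan π b) = 0 :=
    fun a b => by
      rw [← eval_bilin]
      by_cases hab : a = b
      · subst hab
        exact K.eval_eq_zero_of_dvd (hz a) (h.nn (π a.succ))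
      · exact K.eval_eq_zero_of_mem_edgeIdeal (hz a) (hz b)
          (h.edge (π a.succ) (π b.succ) (by simpa using hab))
  have h2 : ∀ x y, x ⬝ᵥ (evalMat (K.points i) σ *ᵥ y) = 0 := fun x y => by
    rw [K.eq_sum_baryGrad π x, K.eq_sum_baryGrad π y]
    simp only [Matrix.mulVec_sum, Matrix.mulVec_smul, sum_dotProduct, dotProduct_sum,
      smul_dotProduct, dotProduct_smul]
    refine Finset.sum_eq_zero fun a _ => ?_
    rw [Finset.sum_eq_zero, smul_zero]
    intro b _
    have := h1 b a
    rw [cotan, cotan] at this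
    rw [this, smul_zero]
  ext a b
  simpa using h2 (Pi.single a 1) (Pi.single b 1)

/-- From moments to traces one climbs by dimension: vertex values make the edge traces vanish at end
points, edge moments then kill them, and face moments kill the normal-normal components, which now
vanish on all edges. Traces are first replaced by representatives of the reduced degree. -/
theorem mem_sigmaBubble {K : Tetra} {N : EdgeNormals K} {l k : ℕ} (hl : 3 ≤ l)
    (hkl : k ≤ l + 1) {σ : PMat} :
    σ ∈ sigmaBubble K N l k ↔ σ ∈ shape l k ∧ K.TraceFree σ := by
  have hnorm : ∀ d, ∃ c : ℝ, c ≠ 0 ∧ K.normal d = c • K.baryGrad d := K.exists_normal_eq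
  constructor
  · rintro ⟨hs, hv, he, hn, ht⟩
    have hedge : ∀ c d, c ≠ d → ∀ n ∈ Submodule.span ℝ {K.baryGrad c, K.baryGrad d},
        ∀ m ∈ Submodule.span ℝ {K.baryGrad c, K.baryGrad d},
        bilin n m σ ∈ K.edgeIdeal c d := fun c d hcd n hn' m hm' => by
      have hex : ∀ c d : Fin 4, c ≠ d → ∃ π : Equiv.Perm (Fin 4),
        π 2 = c ∧ π 3 = d ∧ π 0 < π 1 := by decide
      obtain ⟨π, rfl, rfl, h01⟩ := hex c d hcd
      have ht0 : ∀ {w : Vec}, w ∈ Submodule.span ℝ {K.baryGrad (π 2), K.baryGrad (π 3)} →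
          w ⬝ᵥ K.tan π 0 = 0 := fun {w} hw => by
        obtain ⟨a, b, rfl⟩ := Submodule.mem_span_pair.1 hw
        have h2 : K.baryGrad (π 2) ⬝ᵥ K.tan π 0 = 0 := K.cotan_dot_tan π 1 0
        have h3 : K.baryGrad (π 3) ⬝ᵥ K.tan π 0 = 0 := K.cotan_dot_tan π 2 0
        simp [add_dotProduct, smul_dotProduct, h2, h3]
      obtain ⟨f, hf, hfI⟩ := exists_edge_reduction (K := K) (by omega) hs π (ht0 hn') (ht0 hm')
      have hz : ∀ r, r = 0 ∨ r = 1 → eval (K.points (π r)) f = 0 := fun r hr => by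
        have h2 : eval (K.points (π r)) (K.bary (π 2)) = 0 := by
          rw [K.eval_bary_points, if_neg (π.injective.ne (by rcases hr with rfl | rfl <;> decide))]
        have h3 : eval (K.points (π r)) (K.bary (π 3)) = 0 := by
          rw [K.eval_bary_points, if_neg (π.injective.ne (by rcases hr with rfl | rfl <;> decide))]
        have := K.eval_eq_zero_of_mem_edgeIdeal h2 h3 hfI
        rw [map_sub, eval_bilin, hv, Matrix.zero_mulVec, dotProduct_zero] at this
        linarith
      have hint : ∀ q ∈ P (l - 2), K.edgeInt (π 0) (π 1) (bilin n m σ * q) = 0 := fun q hq => by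
        rw [← N.span_eq π h01] at hn' hm'
        exact bilin_span_induction
          (I := LinearMap.ker ((K.edgeInt (π 0) (π 1)).comp (LinearMap.mulRight ℝ q)))
          (by
            rintro _ ⟨a, rfl⟩ _ ⟨b, rfl⟩
            exact he _ _ h01 a b q hq) hn' hm'
      have hfe := K.mem_edgeIdeal_of_edgeInt π (m := l - 2) (p := f)
        (by rwa [show l - 2 + 2 = l by omega]) (hz 0 (Or.inl rfl)) (hz 1 (Or.inr rfl))
        (fun q hq => by
          have h1 := hint q hq
          have h2 := K.edgeInt_eq_zero π (Ideal.mul_mem_right q _ hfI)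
          rw [sub_mul, map_sub, h1, zero_sub, neg_eq_zero] at h2
          exact h2)
      have := Ideal.add_mem _ hfI hfe
      rwa [sub_add_cancel] at this
    have hface : ∀ d, K.bary d ∣ bilin (K.baryGrad d) (K.baryGrad d) σ := fun d => by
      obtain ⟨c, hc, hcn⟩ := hnorm d
      obtain ⟨f, hf, hfd⟩ := exists_face_reduction (K := K) (by omega) hs d
      have := K.bary_dvd_of_faceInt (i := d) (m := l - 3) (p := f)
        (by rwa [show l - 3 + 3 = l by omega])
        (fun e hed => by
          have h1 := hedge e d hed (K.baryGrad d) (Submodule.subset_span (by simp))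
            (K.baryGrad d) (Submodule.subset_span (by simp))
          have h2 := Ideal.sub_mem _ h1 (K.mem_edgeIdeal_of_dvd_right (c := e) hfd)
          rwa [sub_sub_cancel] at h2)
        (fun q hq => by
          have h1 := hn d q hq
          rw [hcn, bilin_smul_left, bilin_smul_right, mul_assoc, mul_assoc, ← smul_eq_C_mul,
            ← smul_eq_C_mul, map_smul, map_smul, smul_eq_zero, smul_eq_zero, or_iff_right hc,
            or_iff_right hc] at h1
          have h2 := K.faceInt_eq_zero (hfd.mul_right q)
          rw [sub_mul, map_sub, h1, zero_sub, neg_eq_zero] at h2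
          exact h2)
      have h3 := dvd_add hfd this
      rwa [sub_add_cancel] at h3
    refine ⟨hs, hface, fun d => ?_, fun c d hcd => ?_⟩
    · obtain ⟨c, hc, hcn⟩ := hnorm d
      obtain ⟨f, hf, hfd⟩ := exists_trace2_reduction (K := K) hkl hs d
      -- The representative of the second trace lies in the test space `P (l - 1)`, so it may be
      -- tested against itself, without any boundary information.
      have h1 := ht d f hf
      rw [hcn, trace2_smul_left, mul_assoc, ← smul_eq_C_mul, map_smul, smul_eq_zero,
        or_iff_right (pow_ne_zero 3 hc)] at h1
      have h2 := K.faceInt_eq_zero (hfd.mul_right f)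
      rw [sub_mul, map_sub, h1, zero_sub, neg_eq_zero] at h2
      have h3 := dvd_add hfd (K.bary_dvd_of_faceInt_sq h2)
      rwa [sub_add_cancel] at h3
    · exact hedge c d hcd _ (Submodule.subset_span (by simp)) _ (Submodule.subset_span (by simp))
  · rintro ⟨hs, h⟩
    refine ⟨hs, h.evalMat_points, fun i j hij a b q _ => ?_, fun i q _ => ?_, fun i q _ => ?_⟩
    · have hex : ∀ i j : Fin 4, i < j → ∃ π : Equiv.Perm (Fin 4), π 0 = i ∧ π 1 = j := by decide
      obtain ⟨π, rfl, rfl⟩ := hex i j hij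
      have hsp := N.span_eq π hij
      refine K.edgeInt_eq_zero π (Ideal.mul_mem_right _ _
        (h.edge_mem (π.injective.ne (by decide)) ?_ ?_))
      · rw [← hsp]; exact Submodule.subset_span ⟨a, rfl⟩
      · rw [← hsp]; exact Submodule.subset_span ⟨b, rfl⟩
    · exact K.faceInt_eq_zero (((K.dvd_bilin_normal_iff i σ).2 (h.nn i)).mul_right q)
    · exact K.faceInt_eq_zero (((K.dvd_trace2_normal_iff i σ).2 (h.trace2 i)).mul_right q)

end

end DivDiv

/-! ### Volume integrals, their face and edge traces, and Green's formula for `div div`. -/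

namespace DivDiv

open MeasureTheory MvPolynomial
open scoped Matrix

noncomputable section

/-! ### Integrals over the reference simplex -/

/-- The reference simplex in three-space. -/
def refSimplex : Set Vec := {y | (∀ a, 0 ≤ y a) ∧ ∑ a, y a ≤ 1}

theorem isCompact_refSimplex : IsCompact refSimplex := by
  refine IsCompact.of_isClosed_subset (isCompact_Icc (a := (0 : Vec)) (b := 1)) ?_ ?_
  · have h1 : IsClosed {y : Vec | ∀ a, 0 ≤ y a} := isClosed_Ici (a := (0 : Vec))
    have h2 : Continuous fun y : Vec => ∑ a, y a := by fun_prop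
    exact h1.inter (isClosed_le h2 continuous_const)
  · rintro y ⟨h0, h1⟩
    exact ⟨h0, fun a => (Finset.single_le_sum (fun b _ => h0 b) (Finset.mem_univ a)).trans h1⟩

theorem hasDerivAt_eval_cons (v : Poly) (z : Fin 2 → ℝ) (s : ℝ) :
    HasDerivAt (fun s : ℝ => eval (Fin.cons s z : Vec) v)
      (eval (Fin.cons s z : Vec) (pderiv 0 v)) s := by
  induction v using MvPolynomial.induction_on with
  | C a => simpa using hasDerivAt_const s a
  | add p q hp hq => 
    rw [map_add, map_add]
    exact (hp.add hq).congr_of_eventuallyEq (Filter.Eventually.of_forall fun s => map_add _ _ _)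
  | mul_X p j hp =>
    have hX : HasDerivAt (fun s : ℝ => eval (Fin.cons s z : Vec) (X j : Poly))
        (eval (Fin.cons s z : Vec) (pderiv 0 (X j : Poly))) s := by
      refine Fin.cases ?_ (fun i => ?_) j
      · simpa using hasDerivAt_id' s
      · simpa [pderiv_X, Pi.single_apply] using hasDerivAt_const s (z i)
    have := hp.mul hX
    rw [pderiv_mul, map_add, map_mul, map_mul]
    exact this.congr_of_eventuallyEq (Filter.Eventually.of_forall fun s => map_mul _ _ _)

/-- By Fubini, integration in the first variable comes first; the two divisibilities annihilate the
boundary terms at the ends `0` and `1 - ∑ z` of each segment. -/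
theorem integral_refSimplex_pderiv {v : Poly} (h0 : (X 0 : Poly) ∣ v)
    (h1 : (1 - ∑ a, X a : Poly) ∣ v) : ∫ y in refSimplex, eval y (pderiv 0 v) = 0 := by
  have hms : MeasurableSet refSimplex := isCompact_refSimplex.isClosed.measurableSet
  have hcont : Continuous fun y : Vec => eval y (pderiv 0 v) := continuous_eval _
  have hint : Integrable (refSimplex.indicator fun y : Vec => eval y (pderiv 0 v)) :=
    (hcont.continuousOn.integrableOn_compact isCompact_refSimplex).integrable_indicator hms
  rw [← integral_indicator hms]
  have hmp := (volume_preserving_piFinSuccAbove (fun _ : Fin 3 => ℝ) 0).symm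
  rw [← hmp.integral_comp']
  have hint' := (hmp.integrable_comp_emb (MeasurableEquiv.measurableEmbedding _)).2 hint
  rw [Measure.volume_eq_prod] at hint' ⊢
  refine (integral_prod_symm _ hint').trans ?_
  refine (integral_congr_ae (g := 0) (Filter.Eventually.of_forall fun z => ?_)).trans
    (integral_zero' _ _)
  have hcons : ∀ s : ℝ, (MeasurableEquiv.piFinSuccAbove (fun _ : Fin 3 => ℝ) 0).symm (s, z) =
      (Fin.cons s z : Vec) := fun s => by
    rw [MeasurableEquiv.piFinSuccAbove_symm_apply]
    exact Fin.insertNth_zero' s z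
  simp only [Function.comp_apply, hcons, Pi.zero_apply]
  have hmem : ∀ s : ℝ, (Fin.cons s z : Vec) ∈ refSimplex ↔
      (∀ i, 0 ≤ z i) ∧ s ∈ Set.Icc 0 (1 - ∑ i, z i) := fun s => by
    change (∀ a, _) ∧ _ ↔ _
    rw [Fin.forall_fin_succ, Fin.sum_univ_succ]
    simp only [Fin.cons_zero, Fin.cons_succ, Set.mem_Icc, le_sub_iff_add_le]
    tauto
  by_cases hz : (∀ i, 0 ≤ z i) ∧ 0 ≤ 1 - ∑ i, z i
  · have : (fun s : ℝ => refSimplex.indicator (fun y : Vec => eval y (pderiv 0 v))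
        (Fin.cons s z : Vec)) = (Set.Icc 0 (1 - ∑ i, z i)).indicator
          fun s => eval (Fin.cons s z : Vec) (pderiv 0 v) := by
      funext s
      by_cases hs : s ∈ Set.Icc 0 (1 - ∑ i, z i)
      · rw [Set.indicator_of_mem hs, Set.indicator_of_mem ((hmem s).2 ⟨hz.1, hs⟩)]
      · rw [Set.indicator_of_notMem hs, Set.indicator_of_notMem fun h => hs ((hmem s).1 h).2]
    rw [this, integral_indicator measurableSet_Icc, integral_Icc_eq_integral_Ioc,
      ← intervalIntegral.integral_of_le hz.2,
      intervalIntegral.integral_eq_sub_of_hasDerivAt (fun s _ => hasDerivAt_eval_cons v z s)]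
    · obtain ⟨u, hu⟩ := h0
      obtain ⟨w, hw⟩ := h1
      have hev : ∀ s : ℝ, eval (Fin.cons s z : Vec) (1 - ∑ a, X a : Poly) = 1 - (s + ∑ i, z i) :=
        fun s => by
          rw [map_sub, map_one, map_sum, Fin.sum_univ_succ]
          simp only [eval_X, Fin.cons_zero, Fin.cons_succ]
      have e1 : eval (Fin.cons (1 - ∑ i, z i) z : Vec) v = 0 := by
        rw [hw, map_mul, hev, sub_add_cancel, sub_self, zero_mul]
      have e0 : eval (Fin.cons 0 z : Vec) v = 0 := by
        rw [hu, map_mul, eval_X, Fin.cons_zero, zero_mul]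
      rw [e1, e0, sub_zero]
    · refine Continuous.intervalIntegrable (hcont.comp ?_) _ _
      exact continuous_pi fun a => Fin.cases (by simpa using continuous_id')
        (fun i => by simpa using continuous_const) a
  · refine (integral_congr_ae (g := 0) (Filter.Eventually.of_forall fun s => ?_)).trans
      (integral_zero' _ _)
    exact Set.indicator_of_notMem (fun h => hz ⟨((hmem s).1 h).1,
      ((hmem s).1 h).2.1.trans ((hmem s).1 h).2.2⟩) _

/-! ### Volume integrals -/

theorem Tetra.mem_body (K : Tetra) {x : Vec} : x ∈ K.body ↔ ∀ i, 0 ≤ eval x (K.bary i) := by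
  constructor
  · intro hx i
    refine convexHull_min ?_ (K.convex_bary_nonneg i) hx
    rintro _ ⟨a, rfl⟩
    rw [Set.mem_ofPred_eq, eval_bary_points]
    split_ifs <;> norm_num
  · intro h
    rw [K.point_eq x]
    exact (convex_convexHull ℝ _).sum_mem (fun i _ => h i) (K.sum_eval_bary x)
      fun i _ => subset_convexHull ℝ _ ⟨i, rfl⟩

theorem Tetra.body_eq_image (K : Tetra) (π : Equiv.Perm (Fin 4)) :
    K.body = K.chartPoint π '' refSimplex := by
  have key : ∀ y, K.chartPoint π y ∈ K.body ↔ y ∈ refSimplex := fun y => by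
    rw [mem_body, ← π.forall_congr_right, Fin.forall_fin_succ]
    have h := K.sum_eval_bary (K.chartPoint π y)
    rw [← Equiv.sum_comp π, Fin.sum_univ_succ] at h
    simp only [eval_bary_chartPoint] at h ⊢
    rw [eq_sub_of_add_eq h, sub_nonneg, and_comm]
    rfl
  ext x
  constructor
  · intro hx
    rw [← K.chartPoint_bary π x] at hx ⊢
    exact ⟨_, (key _).1 hx, rfl⟩
  · rintro ⟨y, hy, rfl⟩
    exact (key y).2 hy

/-- Change of variables under an affine map; only the independence of the Jacobian factor `c` from
`p` matters. -/
theorem Tetra.exists_volInt_eq (K : Tetra) (π : Equiv.Perm (Fin 4)) :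
    ∃ c : ℝ, ∀ p, K.volInt p = c * ∫ y in refSimplex, eval y (K.chart π p) := by
  let L : Vec →L[ℝ] Vec := ∑ a, (ContinuousLinearMap.proj a).smulRight (K.tan π a)
  refine ⟨|L.det|, fun p => ?_⟩
  change ∫ x in K.body, eval x p = _
  have hfun : K.chartPoint π = fun y => K.points (π 0) + L y := by
    funext y
    simp [chartPoint, L]
  have hinj : Function.Injective (K.chartPoint π) := fun y z h => by
    funext a
    rw [← K.eval_bary_chartPoint π y a, h, eval_bary_chartPoint]
  rw [K.body_eq_image π, integral_image_eq_integral_abs_det_fderiv_smul volume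
    isCompact_refSimplex.isClosed.measurableSet (f' := fun _ => L) (fun x _ => ?_) hinj.injOn]
  · simp only [eval_chart, smul_eq_mul]
    rw [integral_const_mul]
  · rw [hfun]
    exact (L.hasFDerivAt.const_add _).hasFDerivWithinAt

/-- The integral of the derivative of a polynomial along an edge vanishes if the polynomial
vanishes on both faces that the edge crosses. -/
theorem Tetra.volInt_dirD (K : Tetra) {c d : Fin 4} (u : Poly) :
    K.volInt (dirD (K.points c - K.points d) (K.bary c * K.bary d * u)) = 0 := by
  by_cases hcd : c = d
  · rw [hcd, sub_self, dirD_apply]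
    simp
  obtain ⟨π, rfl, rfl⟩ : ∃ π : Equiv.Perm (Fin 4), π 0 = d ∧ π 1 = c := by
    revert c d; decide
  obtain ⟨k, hk⟩ := K.exists_volInt_eq π
  have h0 : K.chart π (K.bary (π 1)) = X 0 := K.chart_bary π 0
  have h1 : K.chart π (K.bary (π 0)) = 1 - ∑ a, X a := by
    have := congrArg (K.chart π) K.sum_bary
    rw [← Equiv.sum_comp π, Fin.sum_univ_succ, map_add, map_sum, map_one] at this
    simp only [chart_bary] at this
    exact eq_sub_of_add_eq this
  have h := K.pderiv_chart π 0 (K.bary (π 1) * K.bary (π 0) * u)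
  rw [tan] at h
  have h2 : (0 : Fin 3).succ = (1 : Fin 4) := rfl
  rw [h2] at h
  rw [hk, ← h, integral_refSimplex_pderiv, mul_zero]
  · rw [map_mul, map_mul, h0, mul_assoc]
    exact dvd_mul_right _ _
  · rw [map_mul, map_mul, h1, mul_comm (K.chart π _), mul_assoc]
    exact dvd_mul_right _ _

/-! ### Traces of the volume integral on faces and edges -/

theorem dirD_sub_self (x : Vec) (p : Poly) : dirD (x - x) p = 0 := by
  rw [dirD_sub_left, sub_self]

theorem Tetra.dirD_bary_points (K : Tetra) (i j k : Fin 4) :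
    dirD (K.points j - K.points k) (K.bary i) =
      C ((if i = j then 1 else 0) - (if i = k then 1 else 0)) := by
  rw [dirD_bary, baryGrad_dot_sub]

/-- The integral over face `d`, up to a constant factor, as a functional on polynomials. -/
def Tetra.faceTrace (K : Tetra) (d : Fin 4) (w : Poly) : ℝ :=
  ∑ a, K.volInt (dirD (K.points d - K.points a) (K.bary a * w))

/-- The integral over the edge with complementary vertices `c` and `d`, up to a constant factor,
as a functional on polynomials. -/
def Tetra.edgeTrace (K : Tetra) (c d : Fin 4) (w : Poly) : ℝ :=
  ∑ a, if a = d then 0 else K.faceTrace d (dirD (K.points c - K.points a) (K.bary a * w))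

section Trace

variable (K : Tetra)

theorem Tetra.faceTrace_add (d : Fin 4) (v w : Poly) :
    K.faceTrace d (v + w) = K.faceTrace d v + K.faceTrace d w := by
  simp only [faceTrace, mul_add, map_add, Finset.sum_add_distrib]

theorem Tetra.faceTrace_sub (d : Fin 4) (v w : Poly) :
    K.faceTrace d (v - w) = K.faceTrace d v - K.faceTrace d w := by
  simp only [faceTrace, mul_sub, map_sub, Finset.sum_sub_distrib]

theorem Tetra.faceTrace_sum {ι : Type*} (s : Finset ι) (d : Fin 4) (w : ι → Poly) :
    K.faceTrace d (∑ i ∈ s, w i) = ∑ i ∈ s, K.faceTrace d (w i) := by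
  simp only [faceTrace, Finset.mul_sum, map_sum]
  rw [Finset.sum_comm]

theorem Tetra.edgeTrace_sum {ι : Type*} (s : Finset ι) (c d : Fin 4) (w : ι → Poly) :
    K.edgeTrace c d (∑ i ∈ s, w i) = ∑ i ∈ s, K.edgeTrace c d (w i) := by
  simp only [edgeTrace, Finset.mul_sum, map_sum, faceTrace_sum]
  rw [Finset.sum_comm]
  refine Finset.sum_congr rfl fun a _ => ?_
  split_ifs
  · simp
  · rfl

theorem Tetra.edgeTrace_add (c d : Fin 4) (v w : Poly) :
    K.edgeTrace c d (v + w) = K.edgeTrace c d v + K.edgeTrace c d w := by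
  have := K.edgeTrace_sum Finset.univ c d ![v, w]
  simpa [Fin.sum_univ_two] using this

theorem Tetra.faceTrace_eq_zero {d : Fin 4} {w : Poly} (h : K.bary d ∣ w) :
    K.faceTrace d w = 0 := by
  obtain ⟨u, rfl⟩ := h
  refine Finset.sum_eq_zero fun a _ => ?_
  rw [show K.bary a * (K.bary d * u) = K.bary d * K.bary a * u by ring, volInt_dirD]

/-- A divergence theorem: the edge from `d` to `c` is tangent to the two other faces, so only faces
`c` and `d` contribute. It follows from `∑ λ_a = 1` by splitting, for each `a`, the direction as
`(p_c - p_a) - (p_d - p_a)`. -/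
theorem Tetra.volInt_dirD_eq_faceTrace (c d : Fin 4) (w : Poly) :
    K.volInt (dirD (K.points c - K.points d) w) = K.faceTrace c w - K.faceTrace d w := by
  have hw : w = ∑ a, K.bary a * w := by rw [← Finset.sum_mul, sum_bary, one_mul]
  conv_lhs => rw [hw]
  rw [faceTrace, faceTrace, ← Finset.sum_sub_distrib, map_sum, map_sum]
  refine Finset.sum_congr rfl fun a _ => ?_
  rw [← map_sub, dirD_sub_left, dirD_sub_left, dirD_sub_left]
  congr 1
  ring

theorem Tetra.faceTrace_dirD_eq_edgeTrace {b c d : Fin 4} (hb : b ≠ d) (hc : c ≠ d) (w : Poly) :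
    K.faceTrace d (dirD (K.points c - K.points b) w) = K.edgeTrace c d w - K.edgeTrace b d w := by
  have hw : w = ∑ a, K.bary a * w := by rw [← Finset.sum_mul, sum_bary, one_mul]
  conv_lhs => rw [hw]
  rw [edgeTrace, edgeTrace, ← Finset.sum_sub_distrib, map_sum, faceTrace_sum]
  refine Finset.sum_congr rfl fun a _ => ?_
  split_ifs with h
  · subst h
    rw [sub_zero]
    refine K.faceTrace_eq_zero ?_
    rw [dirD_mul, dirD_bary_points, if_neg hc.symm, if_neg hb.symm, sub_zero, C_0, zero_mul,
      zero_add]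
    exact dvd_mul_right _ _
  · rw [← faceTrace_sub, dirD_sub_left, dirD_sub_left, dirD_sub_left]
    congr 1
    ring

/-- The analogue of `volInt_dirD` on a face. Moving `λ_b` inside the derivative and commuting
derivatives gives integrals covered by `volInt_dirD`. The product-rule terms add up to one more
derivative of the same kind. -/
theorem Tetra.faceTrace_dirD_bary_mul {a c d : Fin 4} (ha : a ≠ d) (hc : c ≠ d) (u : Poly) :
    K.faceTrace d (dirD (K.points c - K.points a) (K.bary a * K.bary c * u)) = 0 := by
  by_cases hac : a = c
  · rw [hac, dirD_sub_self]
    simp [faceTrace]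
  set v := K.bary a * K.bary c * u with hv
  have key : ∀ b, K.bary b * dirD (K.points c - K.points a) v =
      dirD (K.points c - K.points a) (K.bary b * v) -
        C ((if b = c then 1 else 0) - (if b = a then 1 else 0)) * v := fun b => by
    rw [dirD_mul _ (K.bary b), dirD_bary_points]
    ring
  have hz : ∀ b, K.volInt (dirD (K.points d - K.points b)
      (dirD (K.points c - K.points a) (K.bary b * v))) = 0 := fun b => by
    -- Since `a` and `c` differ from `d`, the derivative can lower the power of `λ_a` only when `b =
    -- a`, and there the extra factor `λ_b` compensates; likewise for `c`.
    have hdvd : ∃ w, dirD (K.points d - K.points b) (K.bary b * v) = K.bary c * K.bary a * w := by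
      rw [hv, dirD_mul, dirD_mul, dirD_mul, dirD_bary_points, dirD_bary_points, dirD_bary_points,
        if_neg ha, if_neg hc]
      by_cases hba : b = a
      · subst hba
        simp only [if_true, if_neg (Ne.symm hac), if_neg ha]
        exact ⟨2 * (C (0 - 1) * u) + K.bary b * dirD (K.points d - K.points b) u, by
          simp only [sub_zero, C_0]; ring⟩
      by_cases hbc : b = c
      · subst hbc
        simp only [if_true, if_neg hac, if_neg hc]
        exact ⟨2 * (C (0 - 1) * u) + K.bary b * dirD (K.points d - K.points b) u, by
          simp only [sub_zero, C_0]; ring⟩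
      rw [if_neg (Ne.symm hba), if_neg (Ne.symm hbc)]
      exact ⟨C ((if b = d then 1 else 0) - (if b = b then 1 else 0)) * u +
        K.bary b * dirD (K.points d - K.points b) u, by
          simp only [sub_zero, C_0]; ring⟩
    obtain ⟨w, hw⟩ := hdvd
    rw [dirD_comm, hw, volInt_dirD]
  have h0 : ∀ b, K.volInt (dirD (K.points d - K.points b)
      (K.bary b * dirD (K.points c - K.points a) v)) =
      (if b = a then K.volInt (dirD (K.points d - K.points b) v) else 0) -
        (if b = c then K.volInt (dirD (K.points d - K.points b) v) else 0) := fun b => by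
    rw [key, map_sub, map_sub, hz, dirD_C_mul, ← smul_eq_C_mul, map_smul, smul_eq_mul]
    split_ifs <;> ring
  simp only [faceTrace, h0, Finset.sum_sub_distrib, Finset.sum_ite_eq', Finset.mem_univ, if_true]
  rw [← map_sub]
  have h1 : dirD (K.points d - K.points a) v - dirD (K.points d - K.points c) v =
      dirD (K.points c - K.points a) v := by
    simp only [dirD_sub_left]
    ring
  rw [h1, hv, mul_comm (K.bary a), volInt_dirD]

theorem Tetra.edgeTrace_eq_zero {c d : Fin 4} (hcd : c ≠ d) {w : Poly}
    (h : w ∈ K.edgeIdeal c d) : K.edgeTrace c d w = 0 := by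
  obtain ⟨u, v, rfl⟩ := Ideal.mem_span_pair.1 h
  rw [edgeTrace_add]
  have h1 : K.edgeTrace c d (u * K.bary c) = 0 := Finset.sum_eq_zero fun a _ => by
    split_ifs with ha
    · rfl
    · rw [show K.bary a * (u * K.bary c) = K.bary a * K.bary c * u by ring,
        K.faceTrace_dirD_bary_mul ha hcd]
  have h2 : K.edgeTrace c d (v * K.bary d) = 0 := Finset.sum_eq_zero fun a _ => by
    split_ifs with ha
    · rfl
    · refine K.faceTrace_eq_zero ?_
      rw [← mul_assoc, mul_comm, dirD_mul, dirD_bary_points, if_neg hcd.symm,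
        if_neg (Ne.symm ha), sub_zero, C_0, zero_mul, zero_add]
      exact dvd_mul_right _ _
  rw [h1, h2, add_zero]

end Trace

/-! ### Green's formula for `div div` -/

/-- The barycentric gradients sum to zero, so the base point of the chart drops out and the four
vertices enter symmetrically as position vectors. -/
theorem Tetra.divV_eq_sum (K : Tetra) (v : PVec) :
    divV v = ∑ c, dirD (K.points c) (dotC (K.baryGrad c) v) := by
  have h0 : dotC (K.baryGrad 0) v = -∑ a : Fin 3, dotC (K.baryGrad a.succ) v := by
    have h : K.baryGrad 0 = -∑ a : Fin 3, K.baryGrad a.succ := by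
      rw [eq_neg_iff_add_eq_zero, ← Fin.sum_univ_succ]
      refine dotProduct_eq_zero _ fun w => ?_
      rw [sum_dotProduct, sum_baryGrad_dot]
    simp only [dotC, h, Pi.neg_apply, Finset.sum_apply, map_neg, map_sum, neg_mul,
      Finset.sum_neg_distrib, Finset.sum_mul]
    rw [Finset.sum_comm]
  have h1 : ∀ a, K.cotan 1 a = K.baryGrad a.succ := fun a => rfl
  have h2 : ∀ a, K.tan 1 a = K.points a.succ - K.points 0 := fun a => rfl
  rw [K.divV_eq_chart 1, Fin.sum_univ_succ (n := 3), h0, map_neg, map_sum]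
  simp only [h1, h2, dirD_sub_left, Finset.sum_sub_distrib]
  ring

theorem Tetra.divDiv_eq_sum (K : Tetra) (σ : PMat) :
    divDiv σ = ∑ c, ∑ d, dirD (K.points c) (dirD (K.points d)
      (bilin (K.baryGrad c) (K.baryGrad d) σ)) := by
  have h : ∀ n : Vec, dotC n (divM σ) =
      ∑ d, dirD (K.points d) (bilin n (K.baryGrad d) σ) := fun n => by
    have h1 : dotC n (divM σ) = divV fun j => dotC n fun i => σ i j := by
      simp only [dotC, divM, divV, map_sum, pderiv_C_mul, Finset.mul_sum]
      rw [Finset.sum_comm]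
    rw [h1, K.divV_eq_sum]
    refine Finset.sum_congr rfl fun d _ => congrArg _ ?_
    rw [bilin_eq_sum, Finset.sum_comm]
    simp only [dotC, Finset.mul_sum]
    exact Finset.sum_congr rfl fun j _ => Finset.sum_congr rfl fun i _ => by ring
  change divV (divM σ) = _
  rw [K.divV_eq_sum]
  exact Finset.sum_congr rfl fun c _ => by rw [h, map_sum]

theorem Tetra.sum_bilin_baryGrad (K : Tetra) (n : Vec) (σ : PMat) :
    ∑ d, bilin n (K.baryGrad d) σ = 0 := by
  have h : ∑ d, K.baryGrad d = 0 := dotProduct_eq_zero _ fun w => by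
    rw [sum_dotProduct, sum_baryGrad_dot]
  rw [← bilin_sum_right, h]
  simp [bilin_eq_sum]

/-- The contribution of face `c` to Green's formula. It is rewritten as derivatives of `p B_d` along
edges from `a`, minus `2 p div(σ n)`. Tangential derivatives reduce to edge traces, which vanish by
the edge condition or cancel because `∑ B_d = 0`. Writing `B_c = λ_c u`, the transversal derivative
leaves `p u`. The second trace condition says that `u - 2 div(σ n)` vanishes on the face. -/
theorem Tetra.TraceFree.faceTrace_eq_zero {K : Tetra} {σ : PMat} (h : K.TraceFree σ)
    (hs : σᵀ = σ) (p : Poly) (c : Fin 4) :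
    K.faceTrace c (∑ d, (p * dirD (K.points c - K.points d)
        (bilin (K.baryGrad c) (K.baryGrad d) σ) -
      dirD (K.points c - K.points d) p * bilin (K.baryGrad c) (K.baryGrad d) σ)) = 0 := by
  obtain ⟨a, ha⟩ := exists_ne c
  obtain ⟨u, hu⟩ := h.nn c
  have h0 := K.sum_bilin_baryGrad (K.baryGrad c) σ
  have hV : divV (σ *ᵥ constVec (K.baryGrad c)) =
      ∑ d, dirD (K.points d) (bilin (K.baryGrad c) (K.baryGrad d) σ) := by
    rw [K.divV_eq_sum]
    refine Finset.sum_congr rfl fun d _ => congrArg _ ?_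
    rw [← bilin_transpose, hs]
    rfl
  have ht := h.trace2 c
  rw [trace2_eq, hu, dirD_mul, dirD_bary] at ht
  have he : ∀ d, d ≠ c → bilin (K.baryGrad c) (K.baryGrad d) σ ∈ K.edgeIdeal d c :=
    fun d hd => by rw [edgeIdeal_comm]; exact h.edge c d hd.symm
  set B : Fin 4 → Poly := fun d => bilin (K.baryGrad c) (K.baryGrad d) σ with hB
  change ∑ d, B d = 0 at h0
  change _ = ∑ d, dirD (K.points d) (B d) at hV
  change ∀ d, d ≠ c → B d ∈ K.edgeIdeal d c at he
  change B c = _ at hu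
  change K.faceTrace c (∑ d, (p * dirD (K.points c - K.points d) (B d) -
    dirD (K.points c - K.points d) p * B d)) = 0
  clear_value B
  have hW : ∀ w, ∑ d, dirD w (B d) = 0 := fun w => by rw [← map_sum, h0, map_zero]
  have h1 : ∑ d, (p * dirD (K.points c - K.points d) (B d) -
      dirD (K.points c - K.points d) p * B d) =
      ∑ d, dirD (K.points d - K.points a) (p * B d) -
        2 * (p * divV (σ *ᵥ constVec (K.baryGrad c))) := by
    have e1 : ∀ d, p * dirD (K.points c - K.points d) (B d) -
        dirD (K.points c - K.points d) p * B d =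
        dirD (K.points d - K.points a) (p * B d) - 2 * (p * dirD (K.points d) (B d)) +
        p * dirD (K.points c) (B d) + p * dirD (K.points a) (B d) +
        (dirD (K.points a) p - dirD (K.points c) p) * B d := fun d => by
      simp only [dirD_sub_left, dirD_mul]
      ring
    simp only [e1, Finset.sum_add_distrib, Finset.sum_sub_distrib, ← Finset.mul_sum, hW, h0, hV]
    ring
  have h2 : ∀ d, K.faceTrace c (dirD (K.points d - K.points a) (p * B d)) =
      (if d = c then K.faceTrace c (p * u) + K.edgeTrace a c (p * B c) else 0) -
        K.edgeTrace a c (p * B d) := fun d => by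
    split_ifs with hd
    · subst hd
      rw [add_sub_cancel_right, hu, show p * (K.bary d * u) = K.bary d * (p * u) by ring, dirD_mul,
        dirD_bary_points, if_pos rfl, if_neg ha.symm, sub_zero, C_1, one_mul, faceTrace_add,
        K.faceTrace_eq_zero (dvd_mul_right _ _), add_zero]
    · rw [K.faceTrace_dirD_eq_edgeTrace ha hd,
        K.edgeTrace_eq_zero hd (Ideal.mul_mem_left _ _ (he d hd))]
  have h3 : K.edgeTrace a c (p * B c) = 0 :=
    K.edgeTrace_eq_zero ha (Ideal.mul_mem_left _ _ (by
      rw [hu]; exact K.mem_edgeIdeal_of_dvd_right (dvd_mul_right _ _)))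
  have h4 : ∑ d, K.edgeTrace a c (p * B d) = 0 := by
    rw [← edgeTrace_sum, ← Finset.mul_sum, h0, mul_zero]
    exact K.edgeTrace_eq_zero ha (Ideal.zero_mem _)
  rw [h1, faceTrace_sub, faceTrace_sum]
  simp only [h2, h3, Finset.sum_sub_distrib, h4, Finset.sum_ite_eq', Finset.mem_univ, if_true,
    add_zero, sub_zero]
  rw [← faceTrace_sub]
  refine K.faceTrace_eq_zero ?_
  have h5 : K.bary c ∣ C (K.baryGrad c ⬝ᵥ K.baryGrad c) *
      (u - 2 * divV (σ *ᵥ constVec (K.baryGrad c))) := by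
    have := dvd_add ht (dvd_mul_right (K.bary c) (dirD (K.baryGrad c) u))
    rw [← dvd_neg] at this
    convert this using 1
    ring
  rw [dvd_C_mul_iff (dotProduct_self_ne_zero (K.baryGrad_ne_zero c))] at h5
  convert h5.mul_left p using 1
  ring

/-- For affine `p` the second derivatives of `p` vanish, and `-2 p div div σ` is the sum of edge
derivatives of `W c d = p ∂B - (∂p) B`, antisymmetric in `c` and `d`. Integration turns this sum
into face traces, which are zero by the preceding lemma. -/
theorem Tetra.TraceFree.volInt_divDiv_mul {K : Tetra} {σ : PMat} (h : K.TraceFree σ)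
    (hs : σᵀ = σ) {p : Poly} (hp : p ∈ P 1) : K.volInt (divDiv σ * p) = 0 := by
  have hpc : ∀ v w, dirD v (dirD w p) = 0 := fun v w => by
    have h1 := dirD_mem_P w hp
    rw [mem_P, Nat.sub_self, Nat.le_zero, totalDegree_eq_zero_iff_eq_C] at h1
    rw [h1, dirD_C]
  have hf := fun c => h.faceTrace_eq_zero hs p c
  have hd := K.divDiv_eq_sum σ
  have h0 := fun c => K.sum_bilin_baryGrad (K.baryGrad c) σ
  have hsym : ∀ c d, bilin (K.baryGrad c) (K.baryGrad d) σ =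
      bilin (K.baryGrad d) (K.baryGrad c) σ := fun c d => by rw [← bilin_transpose, hs]
  set B : Fin 4 → Fin 4 → Poly := fun c d => bilin (K.baryGrad c) (K.baryGrad d) σ with hB
  change ∀ c, ∑ d, B c d = 0 at h0
  change divDiv σ = ∑ c, ∑ d, dirD (K.points c) (dirD (K.points d) (B c d)) at hd
  change ∀ c d, B c d = B d c at hsym
  change ∀ c, K.faceTrace c (∑ d, (p * dirD (K.points c - K.points d) (B c d) -
    dirD (K.points c - K.points d) p * B c d)) = 0 at hf
  clear_value B
  let W : Fin 4 → Fin 4 → Poly := fun c d => p * dirD (K.points c - K.points d) (B c d) -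
    dirD (K.points c - K.points d) p * B c d
  have hW : ∀ c d, W d c = -W c d := fun c d => by
    simp only [W, hsym d c, dirD_sub_left]
    ring
  have h1 : ∑ c, ∑ d, dirD (K.points c - K.points d) (W c d) = -(2 * (divDiv σ * p)) := by
    have e : ∀ c d, dirD (K.points c - K.points d) (W c d) =
        p * dirD (K.points c) (dirD (K.points c) (B c d)) +
        p * dirD (K.points d) (dirD (K.points d) (B d c)) -
        2 * p * dirD (K.points c) (dirD (K.points d) (B c d)) := fun c d => by
      simp only [W]
      rw [map_sub, dirD_mul, dirD_mul, hpc, hsym d c]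
      simp only [dirD_sub_left, map_sub]
      rw [dirD_comm (K.points d) (K.points c)]
      ring
    have e1 : ∀ c, ∑ d, p * dirD (K.points c) (dirD (K.points c) (B c d)) = 0 := fun c => by
      rw [← Finset.mul_sum, ← map_sum, ← map_sum, h0, map_zero, map_zero, mul_zero]
    simp only [e, Finset.sum_add_distrib, Finset.sum_sub_distrib, e1, Finset.sum_const_zero]
    rw [Finset.sum_comm]
    simp only [e1, Finset.sum_const_zero, ← Finset.mul_sum, ← hd]
    ring
  have h2 : K.volInt (∑ c, ∑ d, dirD (K.points c - K.points d) (W c d)) = 0 := by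
    simp only [map_sum, volInt_dirD_eq_faceTrace, Finset.sum_sub_distrib]
    rw [Finset.sum_comm (f := fun c d => K.faceTrace d (W c d))]
    have e : ∀ c, ∑ d, K.faceTrace c (W c d) = 0 := fun c => by
      rw [← faceTrace_sum]
      exact hf c
    have e' : ∀ c, ∑ d, K.faceTrace c (W d c) = 0 := fun c => by
      simp only [hW c]
      rw [← faceTrace_sum, Finset.sum_neg_distrib, ← zero_sub, faceTrace_sub, faceTrace_sum, e,
        K.faceTrace_eq_zero (dvd_zero _), sub_zero]
    simp only [e, e', Finset.sum_const_zero, sub_zero]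
  rw [h1, map_neg, neg_eq_zero, show (2 : Poly) = C 2 from rfl, ← smul_eq_C_mul, map_smul,
    smul_eq_zero] at h2
  exact h2.resolve_left two_ne_zero

end

end DivDiv

/-! ### Exactness of the polynomial complex and surjectivity of `div div` on bubbles. -/

namespace DivDiv

open MeasureTheory MvPolynomial
open scoped Matrix

noncomputable section

/-! ### Exactness of the polynomial `div div` complex -/

/-- The potential is the integral of `t v(tx) × x` over `t` in `[0, 1]`; the extra factor `t`
accounts for `invEuler 2`. -/
theorem exists_curlV_eq {m : ℕ} {v : PVec} (hv : v ∈ PV m) (h : divV v = 0) :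
    ∃ u ∈ PV (m + 1), curlV u = v := by
  set w : PVec := fun i => invEuler 2 (v i) with hw
  have hwP : ∀ i j, X i * w j ∈ P (m + 1) := fun i j => by
    rw [add_comm]
    exact mul_mem_P (X_mem_P i) (invEuler_mem_P 2 (hv j))
  have hdiv : pderiv 0 (w 0) + pderiv 1 (w 1) + pderiv 2 (w 2) = 0 := by
    rw [divV, Fin.sum_univ_three] at h
    simp only [hw, pderiv_invEuler, ← map_add, h, map_zero]
  have hE : ∀ i, X 0 * pderiv 0 (w i) + X 1 * pderiv 1 (w i) + X 2 * pderiv 2 (w i) + 2 * w i =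
      v i := fun i => by
    have := euler_invEuler two_pos (v i)
    rw [Fin.sum_univ_three] at this
    exact this
  refine ⟨![X 2 * w 1 - X 1 * w 2, X 0 * w 2 - X 2 * w 0, X 1 * w 0 - X 0 * w 1], fun i => ?_, ?_⟩
  · fin_cases i
    · exact Submodule.sub_mem _ (hwP 2 1) (hwP 1 2)
    · exact Submodule.sub_mem _ (hwP 0 2) (hwP 2 0)
    · exact Submodule.sub_mem _ (hwP 1 0) (hwP 0 1)
  · funext i
    rw [← hE i]
    fin_cases i
    · simp [curlV, pderiv_X]
      linear_combination -X 0 * hdiv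
    · simp [curlV, pderiv_X]
      linear_combination -X 1 * hdiv
    · simp [curlV, pderiv_X]
      linear_combination -X 2 * hdiv

theorem symCurl_dev (A : PMat) : symCurl (dev A) = symCurl A := by
  have h : ∀ p : Poly, symCurl (p • (1 : PMat)) = 0 := fun p => by
    change symPart (curlM (p • (1 : PMat))) = 0
    ext1 i j
    fin_cases i <;> fin_cases j <;>
      simp [symPart, curlM, curlV, Matrix.one_apply]
  rw [dev, map_sub, h, sub_zero]

theorem dev_mem_PT {m : ℕ} {A : PMat} (hA : ∀ i j, A i j ∈ P m) : dev A ∈ PT m := by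
  refine ⟨fun i j => ?_, trace_dev A⟩
  rw [dev, Matrix.sub_apply, Matrix.smul_apply, Matrix.one_apply]
  refine Submodule.sub_mem _ (hA i j) ?_
  split_ifs
  · rw [smul_eq_mul, mul_one]
    exact Submodule.smul_mem _ _ (Submodule.sum_mem _ fun i _ => hA i i)
  · rw [smul_zero]
    exact Submodule.zero_mem _

theorem divV_mem_P {m : ℕ} {v : PVec} (hv : v ∈ PV m) : divV v ∈ P (m - 1) :=
  Submodule.sum_mem _ fun i _ => pderiv_mem_P i (hv i)

theorem divDiv_mem_P {m : ℕ} {σ : PMat} (hσ : ∀ i j, σ i j ∈ P m) : divDiv σ ∈ P (m - 2) := by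
  change divV (divM σ) ∈ P (m - 1 - 1)
  exact divV_mem_P fun i => divV_mem_P (hσ i)

/-- The field `div σ` is divergence-free, so it is `curl u`, which is also the divergence of the
skew matrix `S` built from `u`. Then `σ - S` is a row-wise curl, and taking symmetric parts removes
`S`. -/
theorem exists_symCurl_eq {m : ℕ} {σ : PMat} (hσ : ∀ i j, σ i j ∈ P (m + 1)) (hs : σᵀ = σ)
    (h : divDiv σ = 0) : ∃ τ ∈ PT (m + 2), symCurl τ = σ := by
  obtain ⟨u, hu, huv⟩ := exists_curlV_eq (v := divM σ) (fun i => divV_mem_P (hσ i)) h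
  have hu' : ∀ i, u i ∈ P (m + 1) := hu
  set S : PMat := ![![0, u 2, -u 1], ![-u 2, 0, u 0], ![u 1, -u 0, 0]] with hS
  have hdiv : ∀ i, divV (σ i - S i) = 0 := fun i => by
    have h1 : divV (σ i) = curlV u i := (congrFun huv i).symm
    have h2 : divV (S i) = curlV u i := by
      fin_cases i
      · simp [divV, Fin.sum_univ_three, hS, curlV, sub_eq_add_neg]
      · simp [divV, Fin.sum_univ_three, hS, curlV, sub_eq_add_neg, add_comm]
      · simp [divV, Fin.sum_univ_three, hS, curlV, sub_eq_add_neg]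
    have h3 : divV (σ i - S i) = divV (σ i) - divV (S i) := by simp [divV]
    rw [h3, h1, h2, sub_self]
  have hSP : ∀ i j, S i j ∈ P (m + 1) := fun i j => by
    fin_cases i <;> fin_cases j
    · exact Submodule.zero_mem _
    · exact hu' 2
    · exact Submodule.neg_mem _ (hu' 1)
    · exact Submodule.neg_mem _ (hu' 2)
    · exact Submodule.zero_mem _
    · exact hu' 0
    · exact hu' 1
    · exact Submodule.neg_mem _ (hu' 0)
    · exact Submodule.zero_mem _
  have hA := fun i => exists_curlV_eq (v := σ i - S i)
    (fun j => Submodule.sub_mem _ (hσ i j) (hSP i j)) (hdiv i)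
  choose B hAP hA using hA
  set A : PMat := Matrix.of B with hB
  refine ⟨dev A, dev_mem_PT hAP, ?_⟩
  rw [symCurl_dev]
  have hc : curlM A = σ - S := by
    ext1 i j
    exact congrFun (hA i) j
  change symPart (curlM A) = σ
  have hST : Sᵀ = -S := by
    ext1 i j
    fin_cases i <;> fin_cases j <;> first | exact neg_zero.symm | rfl | exact (neg_neg _).symm
  rw [hc, symPart, Matrix.transpose_sub, hs, hST, sub_neg_eq_add, sub_add_add_cancel, ← two_smul ℝ,
    smul_smul]
  norm_num

/-- The second-order Euler operator `q ↦ div div (x xᵀ q)`. -/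
theorem divDiv_xxT (q : Poly) :
    divDiv (xxT q) = ∑ i, X i * pderiv i (∑ j, X j * pderiv j q + C 4 * q) +
      C 3 * (∑ j, X j * pderiv j q + C 4 * q) := by
  have h : divM (xxT q) = fun i => X i * (∑ j, X j * pderiv j q + C 4 * q) := by
    funext i
    have h4 : (C 4 : Poly) = 4 := rfl
    have h5 : divM (xxT q) i = divV fun j => X i * X j * q := rfl
    rw [h5, divV, h4]
    fin_cases i <;> simp [Fin.sum_univ_three, pderiv_X] <;> ring
  have h5 : divDiv (xxT q) = divV (divM (xxT q)) := rfl
  rw [h5, h]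
  generalize ∑ j, X j * pderiv j q + C 4 * q = r
  have h3 : (C 3 : Poly) = 3 := rfl
  rw [divV, h3]
  simp [Fin.sum_univ_three, pderiv_X]
  ring

/-- With `E = x · ∇`, the operator is `(E + 3)(E + 4)`, and both factors are invertible on
polynomials. The same factorisation gives the preimage in `exists_divDiv_xxT_eq`. -/
theorem divDiv_xxT_injective {q : Poly} (h : divDiv (xxT q) = 0) : q = 0 := by
  rw [divDiv_xxT] at h
  have h1 := invEuler_euler three_pos (∑ j, X j * pderiv j q + C 4 * q)
  rw [h, map_zero] at h1
  have h2 := invEuler_euler four_pos q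
  rwa [← h1, map_zero, eq_comm] at h2

theorem divDiv_xxT_mem_P {m : ℕ} {q : Poly} (hq : q ∈ P m) : divDiv (xxT q) ∈ P m := by
  rw [divDiv_xxT]
  have h := Submodule.add_mem _ (euler_mem_P hq) (C_mul_mem_P 4 hq)
  exact Submodule.add_mem _ (euler_mem_P h) (C_mul_mem_P 3 h)

theorem exists_divDiv_xxT_eq {m : ℕ} {f : Poly} (hf : f ∈ P m) :
    ∃ q ∈ P m, divDiv (xxT q) = f := by
  refine ⟨invEuler 4 (invEuler 3 f), invEuler_mem_P _ (invEuler_mem_P _ hf), ?_⟩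
  rw [divDiv_xxT, euler_invEuler four_pos, euler_invEuler three_pos]

theorem symCurl_transpose (τ : PMat) : (symCurl τ)ᵀ = symCurl τ := by
  change (symPart (curlM τ))ᵀ = symPart (curlM τ)
  rw [symPart, Matrix.transpose_smul, Matrix.transpose_add, Matrix.transpose_transpose, add_comm]

theorem xxT_transpose (q : Poly) : (xxT q)ᵀ = xxT q := by
  ext1 i j
  change X j * X i * q = X i * X j * q
  ring

theorem transpose_eq_of_mem_shape {l k : ℕ} {σ : PMat} (h : σ ∈ shape l k) : σᵀ = σ := by
  obtain ⟨τ, -, q, -, rfl⟩ := mem_shape.1 h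
  rw [Matrix.transpose_add, symCurl_transpose, xxT_transpose]

theorem divDiv_mem_of_mem_shape {l k : ℕ} {σ : PMat} (h : σ ∈ shape l k) :
    divDiv σ ∈ P (k - 2) := by
  obtain ⟨τ, -, q, hq, rfl⟩ := mem_shape.1 h
  rw [map_add, divDiv_symCurl, zero_add]
  exact divDiv_xxT_mem_P hq

theorem xxT_mem_P {m : ℕ} {q : Poly} (hq : q ∈ P m) (i j : Fin 3) : xxT q i j ∈ P (m + 2) := by
  change X i * X j * q ∈ P (m + 2)
  rw [add_comm]
  exact mul_mem_P (mul_mem_P (X_mem_P i) (X_mem_P j)) hq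

theorem PT_mono {m n : ℕ} (h : m ≤ n) : PT m ≤ PT n := fun _ hτ =>
  ⟨fun i j => P_mono h (hτ.1 i j), hτ.2⟩

/-- Symmetric tensors of low degree are shape functions. -/
theorem mem_shape_of_mem_P {j k l : ℕ} (hj : 2 ≤ j) (hjl : j ≤ l) (hjk : j ≤ k) {σ : PMat}
    (hσ : ∀ a b, σ a b ∈ P j) (hs : σᵀ = σ) : σ ∈ shape l k := by
  obtain ⟨m, rfl⟩ := Nat.exists_eq_add_of_le' hj
  have hd := divDiv_mem_P hσ
  rw [Nat.add_sub_cancel] at hd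
  -- The summand `x xᵀ q` absorbs the whole `div div` of `σ`, so the rest lies in the range of `sym
  -- curl`.
  obtain ⟨q, hq, hqd⟩ := exists_divDiv_xxT_eq hd
  obtain ⟨τ, hτ, h⟩ := exists_symCurl_eq (m := m + 1) (σ := σ - xxT q)
    (fun i j => Submodule.sub_mem _ (hσ i j) (xxT_mem_P hq i j))
    (by rw [Matrix.transpose_sub, hs, xxT_transpose]) (by rw [map_sub, hqd, sub_self])
  exact mem_shape.2 ⟨τ, PT_mono (by omega) hτ, q, P_mono (by omega) hq, by rw [h, sub_add_cancel]⟩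

/-! ### Tensors spanned by the edge directions -/

theorem sum_comm_four {ι κ : Type*} [Fintype ι] [Fintype κ] (F : ι → ι → κ → κ → Poly) :
    ∑ i, ∑ j, ∑ c, ∑ d, F i j c d = ∑ c, ∑ d, ∑ i, ∑ j, F i j c d := by
  calc _ = ∑ i, ∑ c, ∑ j, ∑ d, F i j c d := Finset.sum_congr rfl fun i _ => Finset.sum_comm
    _ = ∑ c, ∑ i, ∑ j, ∑ d, F i j c d := Finset.sum_comm
    _ = ∑ c, ∑ i, ∑ d, ∑ j, F i j c d := Finset.sum_congr rfl fun c _ =>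
      Finset.sum_congr rfl fun i _ => Finset.sum_comm
    _ = _ := Finset.sum_congr rfl fun c _ => Finset.sum_comm

/-- The symmetric tensor with coefficient `λ_c λ_d w_cd` on the square of the edge from `d`
to `c`. -/
def Tetra.edgeTensor (K : Tetra) (w : Fin 4 → Fin 4 → Poly) : PMat := Matrix.of fun i j =>
  ∑ c, ∑ d, C ((K.points c - K.points d) i * (K.points c - K.points d) j) *
    (K.bary c * K.bary d * w c d)

section EdgeTensor

variable {K : Tetra} {w : Fin 4 → Fin 4 → Poly}

theorem Tetra.edgeTensor_transpose : (K.edgeTensor w)ᵀ = K.edgeTensor w := by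
  ext1 i j
  simp only [edgeTensor, Matrix.transpose_apply, Matrix.of_apply, mul_comm]

theorem Tetra.edgeTensor_mem_P {m : ℕ} (hw : ∀ c d, w c d ∈ P m) (i j : Fin 3) :
    K.edgeTensor w i j ∈ P (m + 2) := by
  rw [edgeTensor, Matrix.of_apply, add_comm]
  refine Submodule.sum_mem _ fun c _ => Submodule.sum_mem _ fun d _ => C_mul_mem_P _ ?_
  exact mul_mem_P (mul_mem_P (K.bary_mem_P c) (K.bary_mem_P d)) (hw c d)

theorem Tetra.bilin_edgeTensor (n m : Vec) :
    bilin n m (K.edgeTensor w) = ∑ c, ∑ d, C ((n ⬝ᵥ (K.points c - K.points d)) *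
      (m ⬝ᵥ (K.points c - K.points d))) * (K.bary c * K.bary d * w c d) := by
  simp only [bilin_eq_sum, edgeTensor, Matrix.of_apply, Finset.mul_sum]
  rw [sum_comm_four]
  refine Finset.sum_congr rfl fun c _ => Finset.sum_congr rfl fun d _ => ?_
  rw [dotProduct, dotProduct, Finset.sum_mul_sum, map_sum, Finset.sum_mul]
  refine Finset.sum_congr rfl fun i _ => ?_
  rw [map_sum, Finset.sum_mul]
  refine Finset.sum_congr rfl fun j _ => ?_
  simp only [C_mul]
  ring

theorem Tetra.divDiv_edgeTensor : divDiv (K.edgeTensor w) =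
    ∑ c, ∑ d, dirD (K.points c - K.points d) (dirD (K.points c - K.points d)
      (K.bary c * K.bary d * w c d)) := by
  have h : divDiv (K.edgeTensor w) = ∑ i, ∑ j, pderiv i (pderiv j (K.edgeTensor w i j)) := by
    change divV (divM _) = _
    simp only [divV, divM, map_sum]
  rw [h]
  simp only [edgeTensor, Matrix.of_apply, map_sum, pderiv_C_mul]
  rw [sum_comm_four]
  refine Finset.sum_congr rfl fun c _ => Finset.sum_congr rfl fun d _ => ?_
  generalize K.points c - K.points d = t
  simp only [dirD_apply, map_sum, pderiv_C_mul, C_mul]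
  exact Finset.sum_congr rfl fun i _ => Finset.sum_congr rfl fun j _ => by
    rw [pderiv_comm]
    ring

/-- The gradient of `λ_a` pairs to `±1` with edges at vertex `a` and to `0` with the others. The
factor `2` comes from counting each edge in both orientations. -/
theorem Tetra.bilin_baryGrad_edgeTensor (hw : ∀ c d, w c d = w d c) (a b : Fin 4) :
    bilin (K.baryGrad a) (K.baryGrad b) (K.edgeTensor w) =
      2 * ((if a = b then K.bary a * ∑ d, K.bary d * w a d else 0) -
        K.bary a * K.bary b * w a b) := by
  rw [bilin_edgeTensor]
  have hf : ∀ c d, K.bary c * K.bary d * w c d = K.bary d * K.bary c * w d c := fun c d => by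
    rw [hw c d]; ring
  have h0 : K.bary a * ∑ d, K.bary d * w a d = ∑ d, K.bary a * K.bary d * w a d := by
    rw [Finset.mul_sum]
    exact Finset.sum_congr rfl fun d _ => by ring
  rw [h0]
  set f : Fin 4 → Fin 4 → Poly := fun c d => K.bary c * K.bary d * w c d with hfd
  change ∀ c d, f c d = f d c at hf
  change ∑ c, ∑ d, C _ * f c d = 2 * ((if a = b then ∑ d, f a d else 0) - f a b)
  clear_value f
  have h1 : ∀ c d, C ((K.baryGrad a ⬝ᵥ (K.points c - K.points d)) *
      (K.baryGrad b ⬝ᵥ (K.points c - K.points d))) * f c d =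
      (if a = c then if b = c then f c d else 0 else 0) -
      (if a = c then if b = d then f c d else 0 else 0) -
      (if b = c then if a = d then f d c else 0 else 0) +
      (if a = d then if b = d then f d c else 0 else 0) := fun c d => by
    rw [baryGrad_dot_sub, baryGrad_dot_sub, hf d c]
    split_ifs <;> simp
  simp only [h1, Finset.sum_add_distrib, Finset.sum_sub_distrib]
  rw [Finset.sum_comm (f := fun c d => if a = d then if b = d then f d c else 0 else 0)]
  simp only [Finset.sum_ite_irrel, Finset.sum_const_zero, Finset.sum_ite_eq, Finset.mem_univ,
    if_true]
  by_cases hab : a = b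
  · subst hab
    simp only [if_true]
    ring
  · rw [if_neg hab, if_neg (Ne.symm hab)]
    ring

/-- The normal-normal and edge conditions hold for any symmetric weights. Modulo `λ_d`, the
divergence of `σ ∇λ_d` is twice `∑ λ_e w_de`; the hypothesis kills it and also makes the
normal-normal component divisible by `λ_d²`, so its normal derivative vanishes on the face. -/
theorem Tetra.traceFree_edgeTensor (hw : ∀ c d, w c d = w d c)
    (h : ∀ c, K.bary c ∣ ∑ d, K.bary d * w c d) : K.TraceFree (K.edgeTensor w) := by
  have hB := K.bilin_baryGrad_edgeTensor hw
  refine ⟨fun d => ?_, fun d => ?_, fun c d hcd => ?_⟩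
  · rw [hB, if_pos rfl, mul_assoc (K.bary d), ← mul_sub]
    exact (dvd_mul_right _ _).mul_left _
  · obtain ⟨z, hz⟩ := h d
    rw [trace2_eq]
    refine dvd_sub (((?_ : K.bary d ∣ _).mul_left _).mul_left _) ?_
    · have h0 : ∑ e, bilin (K.baryGrad e) (K.baryGrad d) (K.edgeTensor w) = 0 := by
        rw [← K.sum_bilin_baryGrad (K.baryGrad d) (K.edgeTensor w)]
        refine Finset.sum_congr rfl fun e _ => ?_
        rw [← bilin_transpose, edgeTensor_transpose]
      have h1 : divV (K.edgeTensor w *ᵥ constVec (K.baryGrad d)) = ∑ e,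
          dirD (K.points e - K.points d)
            (bilin (K.baryGrad e) (K.baryGrad d) (K.edgeTensor w)) := by
        simp only [dirD_sub_left, Finset.sum_sub_distrib]
        rw [← map_sum, h0, map_zero, sub_zero]
        exact K.divV_eq_sum _
      have h2 : ∀ e, dirD (K.points e - K.points d)
          (bilin (K.baryGrad e) (K.baryGrad d) (K.edgeTensor w)) =
          2 * (K.bary e * w d e) - K.bary d * (2 * dirD (K.points e - K.points d)
            (K.bary e * w d e) + if e = d then 2 * w d d else 0) := fun e => by
        by_cases hed : e = d
        · subst hed
          rw [dirD_sub_self, dirD_sub_self, if_pos rfl]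
          ring
        · have h3 : bilin (K.baryGrad e) (K.baryGrad d) (K.edgeTensor w) =
              C (-2) * (K.bary d * (K.bary e * w d e)) := by
            rw [hB, if_neg hed, hw e d, C_neg, show (C 2 : Poly) = 2 from rfl]
            ring
          rw [h3, dirD_C_mul, dirD_mul, dirD_bary_points, if_neg (Ne.symm hed), if_pos rfl,
            if_neg hed, zero_sub, C_neg, C_neg, C_1, show (C 2 : Poly) = 2 from rfl]
          ring
      rw [h1]
      simp only [h2, Finset.sum_sub_distrib, ← Finset.mul_sum]
      rw [hz]
      exact dvd_sub ((dvd_mul_right _ _).mul_left _) (dvd_mul_right _ _)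
    · have h3 : bilin (K.baryGrad d) (K.baryGrad d) (K.edgeTensor w) =
          K.bary d * (K.bary d * (2 * (z - w d d))) := by
        rw [hB, if_pos rfl, hz]
        ring
      rw [h3, dirD_mul]
      exact dvd_add ((dvd_mul_right _ _).mul_left _) (dvd_mul_right _ _)
  · rw [hB, if_neg hcd, zero_sub]
    exact K.mem_edgeIdeal_of_dvd_left (((dvd_mul_right _ _).mul_right _).neg_right.mul_left _)

end EdgeTensor

/-! ### Functions orthogonal to the range of `div div` -/

theorem Tetra.isOpen_bary_pos (K : Tetra) : IsOpen {x : Vec | ∀ i, 0 < eval x (K.bary i)} := by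
  simp only [Set.ofPred_forall]
  exact isOpen_iInter_of_finite fun i => isOpen_lt continuous_const (continuous_eval _)

theorem Tetra.eq_zero_of_bary_pos (K : Tetra) {p : Poly}
    (h : ∀ x, (∀ i, 0 < eval x (K.bary i)) → eval x p = 0) : p = 0 := by
  obtain ⟨x₀, hx₀⟩ : ∃ x, ∀ i, eval x (K.bary i) = 1 / 4 := by
    refine ⟨K.chartPoint 1 fun _ => 1 / 4, fun i => ?_⟩
    have h1 := fun a : Fin 3 => K.eval_bary_chartPoint 1 (fun _ => 1 / 4) a
    have h2 := K.sum_eval_bary (K.chartPoint 1 fun _ => 1 / 4)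
    rw [Fin.sum_univ_succ] at h2
    simp only [Equiv.Perm.one_apply] at h1
    refine Fin.cases ?_ h1 i
    simp only [h1, Finset.sum_const, Finset.card_univ, Fintype.card_fin, nsmul_eq_mul] at h2
    norm_num at h2
    linarith
  have hx : {x : Vec | ∀ i, 0 < eval x (K.bary i)} ∈ nhds x₀ :=
    K.isOpen_bary_pos.mem_nhds fun i => by rw [hx₀]; norm_num
  obtain ⟨ε, hε, hb⟩ := Metric.mem_nhds_iff.1 hx
  rw [ball_pi _ hε] at hb
  refine MvPolynomial.funext_set (fun j => Metric.ball (x₀ j) ε) (fun j => ?_) fun x hx => ?_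
  · rw [Real.ball_eq_Ioo]
    exact Set.Ioo_infinite (by linarith)
  · rw [map_zero]
    exact h x (hb hx)

theorem Tetra.eq_zero_of_volInt_sq (K : Tetra) {p : Poly} (h : K.volInt (p * p) = 0) : p = 0 := by
  have hc : Continuous fun x : Vec => eval x (p * p) := continuous_eval _
  have hK : MeasurableSet K.body :=
    ((Set.finite_range K.points).isCompact_convexHull ℝ).isClosed.measurableSet
  change ∫ x in K.body, eval x (p * p) = 0 at h
  rw [setIntegral_eq_zero_iff_of_nonneg_ae ((ae_restrict_iff' hK).2
    (Filter.Eventually.of_forall fun x _ => by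
      rw [map_mul]; exact mul_self_nonneg _)) (integrableOn_body K _)] at h
  have h1 := Measure.eqOn_open_of_ae_eq (g := fun _ => 0)
    (ae_restrict_of_ae_restrict_of_subset
      (fun x (hx : ∀ i, 0 < eval x (K.bary i)) => K.mem_body.2 fun i => (hx i).le) h)
    K.isOpen_bary_pos hc.continuousOn continuous_const.continuousOn
  refine K.eq_zero_of_bary_pos fun x hx => ?_
  have h2 : eval x (p * p) = 0 := h1 hx
  rwa [map_mul, mul_self_eq_zero] at h2

/-- Polarisation over the edges `t_a`, `t_b` and `t_a - t_b` gives all mixed second derivatives, so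
the Hessian vanishes. -/
theorem Tetra.mem_P_one (K : Tetra) {f : Poly}
    (h : ∀ a b, a ≠ b → dirD (K.points a - K.points b) (dirD (K.points a - K.points b) f) = 0) :
    f ∈ P 1 := by
  have h1 : ∀ a : Fin 3, dirD (K.tan 1 a) (dirD (K.tan 1 a) f) = 0 := fun a =>
    h _ _ (by simp)
  have h2 : ∀ a b, dirD (K.tan 1 a) (dirD (K.tan 1 b) f) = 0 := fun a b => by
    by_cases hab : a = b
    · rw [hab, h1]
    have h3 := h a.succ b.succ (by simpa using hab)
    have h4 : K.points a.succ - K.points b.succ = K.tan 1 a - K.tan 1 b := by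
      simp [tan]
    rw [h4] at h3
    simp only [dirD_sub_left, map_sub, h1, dirD_comm (K.tan 1 b) (K.tan 1 a)] at h3
    have h5 : 2 * dirD (K.tan 1 a) (dirD (K.tan 1 b) f) = 0 := by linear_combination -h3
    exact (mul_eq_zero.1 h5).resolve_left two_ne_zero
  rw [← K.chart_mem_P 1]
  have h3 : ∀ a b, pderiv a (pderiv b (K.chart 1 f)) = 0 := fun a b => by
    rw [pderiv_chart, pderiv_chart, h2, map_zero]
  have h4 := fun b => eq_C_of_pderiv_eq_zero fun a => h3 a b
  obtain ⟨c, hc⟩ : ∃ c : Fin 3 → ℝ, ∀ b, pderiv b (K.chart 1 f) = C (c b) := ⟨_, h4⟩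
  have h5 : ∀ a, pderiv a (K.chart 1 f - ∑ b, C (c b) * X b) = 0 := fun a => by
    rw [map_sub, map_sum, hc, sub_eq_zero]
    simp [pderiv_X, Pi.single_apply]
  have he := eq_C_of_pderiv_eq_zero h5
  rw [sub_eq_iff_eq_add] at he
  rw [he]
  exact Submodule.add_mem _ (C_mem_P _ _) (Submodule.sum_mem _ fun b _ => C_mul_mem_P _ (X_mem_P b))

/-- Two integrations by parts along an edge. The factor `(λ_a λ_b)²` leaves one factor `λ_a λ_b`
after a first derivative, so both boundary terms vanish by `volInt_dirD`. -/
theorem Tetra.volInt_mul_dirD_dirD (K : Tetra) (a b : Fin 4) (f v : Poly) :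
    K.volInt (dirD (K.points a - K.points b) (dirD (K.points a - K.points b)
      (K.bary a * K.bary b * (K.bary a * K.bary b * v))) * f) =
    K.volInt (K.bary a * K.bary b * (K.bary a * K.bary b * v) *
      dirD (K.points a - K.points b) (dirD (K.points a - K.points b) f)) := by
  have hz := fun u => K.volInt_dirD (c := a) (d := b) u
  generalize K.points a - K.points b = t at hz ⊢
  generalize K.bary a * K.bary b = p at hz ⊢
  have h1 : dirD t (p * (p * v)) = p * (2 * (dirD t p * v) + p * dirD t v) := by
    rw [dirD_mul, dirD_mul]
    ring
  have h2 : dirD t (dirD t (p * (p * v))) * f =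
      dirD t (p * ((2 * (dirD t p * v) + p * dirD t v) * f)) -
        dirD t (p * (p * v * dirD t f)) + p * (p * v) * dirD t (dirD t f) := by
    have e1 : p * ((2 * (dirD t p * v) + p * dirD t v) * f) = dirD t (p * (p * v)) * f := by
      rw [h1]; ring
    have e2 : p * (p * v * dirD t f) = p * (p * v) * dirD t f := by ring
    rw [e1, e2, dirD_mul t (dirD t _), dirD_mul t (p * (p * v)) (dirD t f)]
    ring
  rw [h2, map_add, map_sub, hz, hz, sub_zero, zero_add]

/-- The tensor `λ_a² λ_b² v t tᵀ` with `t` the edge from `b` to `a`. -/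
theorem Tetra.exists_traceFree_divDiv (K : Tetra) {a b : Fin 4} (hab : a ≠ b) {m : ℕ} {v : Poly}
    (hv : v ∈ P m) : ∃ σ : PMat, (∀ i j, σ i j ∈ P (m + 4)) ∧ σᵀ = σ ∧ K.TraceFree σ ∧
      divDiv σ = 2 * dirD (K.points a - K.points b) (dirD (K.points a - K.points b)
        (K.bary a * K.bary b * (K.bary a * K.bary b * v))) := by
  set u := K.bary a * K.bary b * v with hu
  have huP : u ∈ P (m + 2) := by
    rw [add_comm]
    exact mul_mem_P (mul_mem_P (K.bary_mem_P a) (K.bary_mem_P b)) hv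
  -- The weight must be symmetric, so the edge is counted in both orientations; hence the factor `2`
  -- in the statement.
  let w : Fin 4 → Fin 4 → Poly := fun c d => if c = a ∧ d = b ∨ c = b ∧ d = a then u else 0
  refine ⟨K.edgeTensor w, edgeTensor_mem_P fun c d => ?_, edgeTensor_transpose,
    traceFree_edgeTensor (fun c d => ?_) fun c => Finset.dvd_sum fun d _ => ?_, ?_⟩
  · simp only [w]
    split_ifs
    · exact huP
    · exact Submodule.zero_mem _
  · simp only [w, or_comm, and_comm]
  · simp only [w]
    split_ifs with hc
    · rcases hc with ⟨rfl, rfl⟩ | ⟨rfl, rfl⟩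
      · exact ((dvd_mul_right _ _).mul_right _).mul_left _
      · exact ((dvd_mul_left _ _).mul_right _).mul_left _
    · rw [mul_zero]
      exact dvd_zero _
  · have e : ∀ c d, dirD (K.points c - K.points d) (dirD (K.points c - K.points d)
        (K.bary c * K.bary d * w c d)) =
        (if c = a then if d = b then dirD (K.points a - K.points b) (dirD (K.points a - K.points b)
          (K.bary a * K.bary b * u)) else 0 else 0) +
        (if c = b then if d = a then dirD (K.points b - K.points a) (dirD (K.points b - K.points a)
          (K.bary b * K.bary a * u)) else 0 else 0) := fun c d => by
      by_cases h1 : c = a ∧ d = b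
      · obtain ⟨rfl, rfl⟩ := h1
        simp [w, hab]
      · by_cases h2 : c = b ∧ d = a
        · obtain ⟨rfl, rfl⟩ := h2
          simp [w, hab.symm]
        · have h3 : w c d = 0 := if_neg (by tauto)
          rw [h3, mul_zero, map_zero, map_zero, ← ite_and, ← ite_and, if_neg h1, if_neg h2,
            add_zero]
    rw [divDiv_edgeTensor]
    simp only [e, Finset.sum_add_distrib, Finset.sum_ite_irrel, Finset.sum_const_zero,
      Finset.sum_ite_eq', Finset.mem_univ, if_true]
    have e : ∀ p, dirD (K.points b - K.points a) p = -dirD (K.points a - K.points b) p := fun p => by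
      rw [dirD_sub_left, dirD_sub_left, neg_sub]
    rw [e, e, map_neg, neg_neg, mul_comm (K.bary b), ← two_mul]

/-! ### Surjectivity of `div div` -/

section Surjective

variable {K : Tetra} {N : EdgeNormals K} {k l : ℕ}

theorem divDiv_mem_orthP1 (hl : 3 ≤ l) (hkl : k ≤ l + 1) {σ : PMat} (hσ : σ ∈ sigmaBubble K N l k) :
    divDiv σ ∈ orthP1 K (k - 2) := by
  obtain ⟨hs, ht⟩ := (mem_sigmaBubble hl hkl).1 hσ
  exact ⟨divDiv_mem_of_mem_shape hs, fun p hp =>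
    ht.volInt_divDiv_mul (transpose_eq_of_mem_shape hs) hp⟩

/-- Taking `v` to be the second derivative of `f` along an edge in the test tensor turns
orthogonality into a vanishing integral of `(λ_a λ_b v)²`. -/
theorem Tetra.mem_P_one_of_orthogonal (K : Tetra) {m : ℕ} {f : Poly} (hf : f ∈ P (m + 2))
    (h : ∀ σ : PMat, (∀ i j, σ i j ∈ P (m + 4)) → σᵀ = σ → K.TraceFree σ →
      K.volInt (divDiv σ * f) = 0) : f ∈ P 1 := by
  refine K.mem_P_one fun a b hab => ?_
  set v := dirD (K.points a - K.points b) (dirD (K.points a - K.points b) f) with hv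
  have hvP : v ∈ P m := dirD_mem_P _ (dirD_mem_P _ hf)
  obtain ⟨σ, h1, h2, h3, h4⟩ := K.exists_traceFree_divDiv hab hvP
  have h5 := h σ h1 h2 h3
  rw [h4, mul_assoc, show (2 : Poly) = C 2 from rfl, ← smul_eq_C_mul, map_smul, smul_eq_zero,
    or_iff_right two_ne_zero, volInt_mul_dirD_dirD, ← hv] at h5
  have h6 := K.eq_zero_of_volInt_sq (p := K.bary a * K.bary b * v) (by
    rw [← h5]
    congr 1
    ring)
  exact (mul_eq_zero.1 h6).resolve_left (mul_ne_zero (K.bary_ne_zero a) (K.bary_ne_zero b))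

instance finiteDimensional_P (m : ℕ) : FiniteDimensional ℝ (P m) := by
  refine FiniteDimensional.of_finrank_pos ?_
  rw [P, finrank_restrictTotalDegree]
  exact Nat.choose_pos (Nat.le_add_left _ _)

/-- The pairing embeds `V` into the dual of `W`, so the dimension of `V` is at most that of its
subspace `W`. -/
theorem eq_of_forall_orthogonal (K : Tetra) {m : ℕ} {V W : Submodule ℝ Poly} (hV : V ≤ P m)
    (hWV : W ≤ V) (h : ∀ f ∈ V, (∀ g ∈ W, K.volInt (g * f) = 0) → f = 0) : W = V := by
  have : FiniteDimensional ℝ V := Submodule.finiteDimensional_of_le hV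
  have : FiniteDimensional ℝ W := Submodule.finiteDimensional_of_le (hWV.trans hV)
  let φ : V →ₗ[ℝ] Module.Dual ℝ W :=
    ((LinearMap.mul ℝ Poly).compr₂ K.volInt).domRestrict₁₂ V W
  have hφ : Function.Injective φ := by
    rw [injective_iff_map_eq_zero]
    intro f hf
    refine Subtype.ext (h f f.2 fun g hg => ?_)
    rw [mul_comm]
    exact LinearMap.congr_fun hf ⟨g, hg⟩
  refine Submodule.eq_of_le_of_finrank_le hWV ?_
  rw [← Subspace.dual_finrank_eq (V := W)]
  exact LinearMap.finrank_le_finrank_of_injective hφ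

/-- For `k ≤ l` every symmetric tensor of degree `k` is a shape function, so the test tensors of
degree `k` are available as bubbles. -/
theorem map_divDiv_eq_of_le (hk : 3 ≤ k) (hkl : k ≤ l) :
    (sigmaBubble K N l k).map divDiv = orthP1 K (k - 2) := by
  refine eq_of_forall_orthogonal K (m := k - 2) (fun f hf => hf.1) ?_ fun f hf h => ?_
  · rintro _ ⟨σ, hσ, rfl⟩
    exact divDiv_mem_orthP1 (by omega) (by omega) hσ
  · have h1 : f ∈ P 1 := by
      -- For `k = 3` the target degree is already `1`; the test tensors are needed only for `k ≥ 4`.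
      obtain rfl | hk' := hk.eq_or_lt
      · exact hf.1
      · obtain ⟨m, rfl⟩ := Nat.exists_eq_add_of_le' hk'
        refine K.mem_P_one_of_orthogonal (m := m) hf.1 fun σ h1 h2 h3 => h _ ⟨σ, ?_, rfl⟩
        exact (mem_sigmaBubble (by omega) (by omega)).2
          ⟨mem_shape_of_mem_P (by omega) hkl le_rfl h1 h2, h3⟩
    exact K.eq_zero_of_volInt_sq (hf.2 f h1)

end Surjective

/-! ### The leading part of `div div` -/

/-- The Euler operator multiplies the homogeneous part of degree `n + 1` by `n + 1`, so the
difference loses its leading part. -/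
theorem euler_sub_mem_P {n : ℕ} {q : Poly} (hq : q ∈ P (n + 1)) :
    ∑ j, X j * pderiv j q - C (n + 1 : ℝ) * q ∈ P n := by
  have h : ∀ p : Poly, (∑ j, X j * pderiv j p - C (n + 1 : ℝ) * p) =
      (∑ j, (LinearMap.mulLeft ℝ (X j)).comp (pderiv j).toLinearMap -
        LinearMap.mulLeft ℝ (C (n + 1 : ℝ)) : Poly →ₗ[ℝ] Poly) p := fun p => by
    simp
  rw [h, q.as_sum, map_sum]
  refine Submodule.sum_mem _ fun s hs => ?_
  rw [← h, sum_X_mul_pderiv_monomial, ← sub_mul, ← C_sub, C_mul_monomial]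
  have hd : s.degree ≤ n + 1 := (le_totalDegree hs).trans (mem_P.1 hq)
  obtain hd | hd := hd.eq_or_lt
  · rw [hd]
    simp
  · rw [mem_P]
    exact (totalDegree_monomial_le _ _).trans (Nat.lt_succ_iff.1 hd)

theorem dirD_pderiv (w : Vec) (j : Fin 3) (p : Poly) :
    dirD w (pderiv j p) = pderiv j (dirD w p) := by
  simp only [dirD_apply, map_sum, pderiv_C_mul, pderiv_comm j]

theorem dirD_euler (w : Vec) (p : Poly) : dirD w (∑ j, X j * pderiv j p) =
    ∑ j, X j * pderiv j (dirD w p) + dirD w p := by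
  simp only [map_sum, dirD_mul, dirD_X, Finset.sum_add_distrib, dirD_pderiv]
  rw [add_comm, ← dirD_apply]

theorem Tetra.sum_bary_mul_C (K : Tetra) (j : Fin 3) :
    ∑ c, K.bary c * C (K.points c j) = X j :=
  MvPolynomial.funext fun x => by
    conv_rhs => rw [eval_X, K.point_eq x]
    simp

theorem Tetra.sum_bary_mul_dirD (K : Tetra) (p : Poly) :
    ∑ c, K.bary c * dirD (K.points c) p = ∑ j, X j * pderiv j p := by
  simp only [dirD_apply, ← K.sum_bary_mul_C, Finset.mul_sum, Finset.sum_mul]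
  rw [Finset.sum_comm]
  simp only [mul_assoc]

theorem Tetra.edgeTensor_add (K : Tetra) (v w : Fin 4 → Fin 4 → Poly) :
    K.edgeTensor (v + w) = K.edgeTensor v + K.edgeTensor w := by
  ext1 i j
  simp only [edgeTensor, Matrix.add_apply, Matrix.of_apply, Pi.add_apply, mul_add,
    Finset.sum_add_distrib]

/-- Expanding `(p_c - p_d)(p_c - p_d)ᵀ` and summing with `∑ λ_c = 1` and `∑ λ_c p_c = x`. The term
`-2 x xᵀ q` exceeds the degree of `q` by two, the other term by one only. -/
theorem Tetra.edgeTensor_const (K : Tetra) (q : Poly) (i j : Fin 3) :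
    K.edgeTensor (fun _ _ => q) i j =
      C 2 * ((∑ c, C (K.points c i * K.points c j) * K.bary c) * q) - C 2 * (X i * X j * q) := by
  have h : K.edgeTensor (fun _ _ => q) i j =
      ((∑ c, C (K.points c i * K.points c j) * K.bary c) * ∑ d, K.bary d -
        (∑ c, K.bary c * C (K.points c i)) * ∑ d, K.bary d * C (K.points d j) -
        (∑ c, K.bary c * C (K.points c j)) * ∑ d, K.bary d * C (K.points d i) +
        (∑ c, K.bary c) * ∑ d, C (K.points d i * K.points d j) * K.bary d) * q := by
    simp only [Finset.sum_mul_sum]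
    simp only [← Finset.sum_sub_distrib, ← Finset.sum_add_distrib, Finset.sum_mul,
      edgeTensor, Matrix.of_apply, Pi.sub_apply, C_mul, C_sub]
    exact Finset.sum_congr rfl fun c _ => Finset.sum_congr rfl fun d _ => by ring
  rw [h, sum_bary, sum_bary_mul_C, sum_bary_mul_C, show (C 2 : Poly) = 2 from rfl]
  ring

/-- With `E = x · ∇`, the operator `E (E - 1)` multiplies the top-degree part by `(m + 2)(m + 1)`.
-/
theorem euler_euler_sub_mem_P {m : ℕ} {q : Poly} (hq : q ∈ P (m + 2)) :
    ∑ i, X i * pderiv i (∑ j, X j * pderiv j q) - ∑ j, X j * pderiv j q -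
      C (((m : ℝ) + 1) * ((m : ℝ) + 2)) * q ∈ P (m + 1) := by
  have hf := euler_sub_mem_P (n := m + 1) hq
  obtain ⟨f, hfd⟩ : ∃ f, f = ∑ j, X j * pderiv j q - C ((m + 1 : ℕ) + 1 : ℝ) * q := ⟨_, rfl⟩
  rw [← hfd] at hf
  have h1 : ∑ j, X j * pderiv j q = f + C ((m + 1 : ℕ) + 1 : ℝ) * q := by
    rw [hfd, sub_add_cancel]
  have h2 : ∑ i, X i * pderiv i (∑ j, X j * pderiv j q) =
      ∑ j, X j * pderiv j f + C ((m + 1 : ℕ) + 1 : ℝ) * ∑ j, X j * pderiv j q := by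
    conv_lhs => rw [h1]
    generalize ((m + 1 : ℕ) + 1 : ℝ) = a
    simp only [map_add, pderiv_C_mul, mul_add, Finset.sum_add_distrib]
    rw [Finset.mul_sum]
    congr 1
    exact Finset.sum_congr rfl fun j _ => by ring
  have h3 : ∑ i, X i * pderiv i (∑ j, X j * pderiv j q) - ∑ j, X j * pderiv j q -
      C (((m : ℝ) + 1) * ((m : ℝ) + 2)) * q = ∑ j, X j * pderiv j f + C ((m : ℝ) + 1) * f := by
    rw [h2, h1]
    push_cast
    simp only [C_add, C_mul, C_1, show (C 2 : Poly) = 2 from rfl]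
    ring
  rw [h3]
  exact Submodule.add_mem _ (euler_mem_P hf) (C_mul_mem_P _ hf)

/-- The choice is `r c d = ∂_{p_c} ∂_{p_d} q` and `R c = ∂_{p_c} (E - 1) q`, with the vertices as
position vectors. The sums are evaluated by `∑ λ_c ∂_{p_c} = E`, where `E = x · ∇`. -/
theorem Tetra.exists_bary_decomposition (K : Tetra) {m : ℕ} {q : Poly} (hq : q ∈ P (m + 2)) :
    ∃ (r : Fin 4 → Fin 4 → Poly) (R : Fin 4 → Poly), (∀ c d, r c d ∈ P m) ∧
      (∀ c d, r c d = r d c) ∧ (∀ c, R c ∈ P (m + 1)) ∧ (∀ c, ∑ d, K.bary d * r c d = R c) ∧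
      ∑ c, K.bary c * R c - C (((m : ℝ) + 1) * ((m : ℝ) + 2)) * q ∈ P (m + 1) := by
  have hD : ∀ {n : ℕ} (w : Vec) {p : Poly}, p ∈ P (n + 1) → dirD w p ∈ P n := fun w _ hp =>
    dirD_mem_P w hp
  have he := euler_mem_P hq
  have h1 := euler_euler_sub_mem_P hq
  have h2 := fun w => dirD_euler w q
  have h3 := K.sum_bary_mul_dirD (∑ j, X j * pderiv j q)
  have h4 := K.sum_bary_mul_dirD q
  generalize hE : ∑ j, X j * pderiv j q = E at he h1 h2 h3 h4
  refine ⟨fun c d => dirD (K.points d) (dirD (K.points c) q),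
    fun c => dirD (K.points c) E - dirD (K.points c) q, fun c d => hD _ (hD _ hq),
    fun c d => dirD_comm _ _ _, fun c => Submodule.sub_mem _ (hD _ he) (hD _ hq),
    fun c => ?_, ?_⟩
  · simp only
    rw [K.sum_bary_mul_dirD, h2, add_sub_cancel_right]
  · simp only [mul_sub, Finset.sum_sub_distrib]
    rw [h3, h4]
    exact h1

/-- A trace-free tensor with leading part `-2 x xᵀ q₀`, with `q₀` equal to a given polynomial up
to a constant factor and terms of lower degree. -/
theorem Tetra.exists_traceFree_add_xxT (K : Tetra) {m : ℕ} {q : Poly} (hq : q ∈ P (m + 2)) :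
    ∃ σ : PMat, ∃ q₀ ∈ P (m + 2), σᵀ = σ ∧ K.TraceFree σ ∧
      q₀ - C (((m : ℝ) + 1) * ((m : ℝ) + 2)) * q ∈ P (m + 1) ∧
      ∀ i j, (σ + (2 : ℝ) • xxT q₀) i j ∈ P (m + 3) := by
  obtain ⟨r, R, hrP, hrs, hRP, hrR, hqR⟩ := K.exists_bary_decomposition hq
  obtain ⟨q₀, hq₀⟩ : ∃ q₀, q₀ = ∑ c, K.bary c * R c := ⟨_, rfl⟩
  rw [← hq₀] at hqR
  have hq₀P : q₀ ∈ P (m + 2) := by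
    rw [hq₀, show m + 2 = 1 + (m + 1) by ring]
    exact Submodule.sum_mem _ fun c _ => mul_mem_P (K.bary_mem_P c) (hRP c)
  -- This correction has lower degree and makes the weights satisfy the condition of
  -- `traceFree_edgeTensor`: `∑ λ_d (q₀ + r c d - R c - R d) = q₀ + R c - R c - q₀ = 0`.
  obtain ⟨v, hv⟩ : ∃ v : Fin 4 → Fin 4 → Poly, ∀ c d, v c d = r c d - R c - R d :=
    ⟨_, fun _ _ => rfl⟩
  have hvP : ∀ c d, v c d ∈ P (m + 1) := fun c d => by
    rw [hv]
    exact Submodule.sub_mem _ (Submodule.sub_mem _ (P_mono (Nat.le_succ m) (hrP c d)) (hRP c))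
      (hRP d)
  have hvs : ∀ c d, v c d = v d c := fun c d => by
    rw [hv, hv, hrs c d]
    ring
  refine ⟨K.edgeTensor ((fun _ _ => q₀) + v), q₀, hq₀P, edgeTensor_transpose,
    traceFree_edgeTensor (fun c d => ?_) (fun c => ?_), hqR, fun i j => ?_⟩
  · simp only [Pi.add_apply, hvs c d]
  · have : ∑ d, K.bary d * ((fun _ _ => q₀) + v : Fin 4 → Fin 4 → Poly) c d = 0 := by
      simp only [Pi.add_apply, hv, mul_add, mul_sub, Finset.sum_add_distrib,
        Finset.sum_sub_distrib, hrR, ← Finset.sum_mul, sum_bary, one_mul, ← hq₀]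
      ring
    rw [this]
    exact dvd_zero _
  · have h1 : (K.edgeTensor ((fun _ _ => q₀) + v) + (2 : ℝ) • xxT q₀) i j =
        C 2 * ((∑ c, C (K.points c i * K.points c j) * K.bary c) * q₀) + K.edgeTensor v i j := by
      have h2 : xxT q₀ i j = X i * X j * q₀ := rfl
      rw [edgeTensor_add, Matrix.add_apply, Matrix.add_apply, edgeTensor_const,
        Matrix.smul_apply, smul_eq_C_mul, h2]
      ring
    rw [h1]
    refine Submodule.add_mem _ (C_mul_mem_P _ ?_) (edgeTensor_mem_P hvP i j)
    rw [show m + 3 = 1 + (m + 2) by ring]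
    exact mul_mem_P (Submodule.sum_mem _ fun c _ => C_mul_mem_P _ (K.bary_mem_P c)) hq₀P

theorem shape_mono {k k' l : ℕ} (h : k ≤ k') : shape l k ≤ shape l k' := by
  intro σ hσ
  obtain ⟨τ, hτ, q, hq, rfl⟩ := mem_shape.1 hσ
  exact mem_shape.2 ⟨τ, hτ, q, P_mono (by omega) hq, rfl⟩

/-- Only `k = l + 1` is new: an explicit bubble reproduces the top-degree part of the target, and
the remainder has one degree less. -/
theorem map_divDiv_eq {K : Tetra} {N : EdgeNormals K} {k l : ℕ} (hk : 3 ≤ k) (hl : 3 ≤ l)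
    (hkl : k ≤ l + 1) : (sigmaBubble K N l k).map divDiv = orthP1 K (k - 2) := by
  obtain hkl' | rfl := Nat.le_succ_iff.1 hkl
  · exact map_divDiv_eq_of_le hk hkl'
  refine le_antisymm ?_ fun f hf => ?_
  · rintro _ ⟨σ, hσ, rfl⟩
    exact divDiv_mem_orthP1 hl hkl hσ
  obtain ⟨m, rfl⟩ := Nat.exists_eq_add_of_le' hl
  have hk2 : m + 3 + 1 - 2 = m + 2 := by omega
  -- The constant undoes two factors: the bubble has leading part `-2 x xᵀ q₀`, and `q₀` has the
  -- leading part of `(m + 1)(m + 2) q`.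
  obtain ⟨q, hq, hqf⟩ := exists_divDiv_xxT_eq (m := m + 2)
    (f := C (-(2 * (((m : ℝ) + 1) * ((m : ℝ) + 2)))⁻¹) * f) (C_mul_mem_P _ (hk2 ▸ hf.1))
  obtain ⟨σ, q₀, hq₀, hs, ht, h1, h2⟩ := K.exists_traceFree_add_xxT hq
  have h3 : σ ∈ sigmaBubble K N (m + 3) (m + 3 + 1) := by
    refine (mem_sigmaBubble hl hkl).2 ⟨?_, ht⟩
    -- `σ` itself may have degree `l + 1`, but it is a symmetric tensor of degree `l` minus `2 x xᵀ
    -- q₀`, and both are shape functions.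
    have h4 : σ + (2 : ℝ) • xxT q₀ ∈ shape (m + 3) (m + 3 + 1) :=
      mem_shape_of_mem_P (by omega) le_rfl (by omega) h2
        (by rw [Matrix.transpose_add, Matrix.transpose_smul, hs, xxT_transpose])
    have h5 : xxT q₀ ∈ shape (m + 3) (m + 3 + 1) :=
      mem_shape.2 ⟨0, Submodule.zero_mem _, q₀, hk2 ▸ hq₀, by rw [map_zero, zero_add]⟩
    have h6 := Submodule.sub_mem _ h4 (Submodule.smul_mem _ (2 : ℝ) h5)
    rwa [add_sub_cancel_right] at h6
  have h7 : divDiv σ - f ∈ P (m + 1) := by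
    have ha : ((m : ℝ) + 1) * ((m : ℝ) + 2) ≠ 0 := by positivity
    generalize ((m : ℝ) + 1) * ((m : ℝ) + 2) = a at hqf h1 ha
    have e1 : divDiv σ - f = divDiv (σ + (2 : ℝ) • xxT q₀) -
        (2 : ℝ) • divDiv (xxT (q₀ - C a * q)) := by
      rw [map_sub, map_sub, map_add, map_smul, ← smul_eq_C_mul, map_smul, map_smul, hqf,
        ← smul_eq_C_mul, smul_sub, smul_smul, smul_smul]
      have : (2 : ℝ) * a * -(2 * a)⁻¹ = -1 := by
        rw [mul_neg, mul_inv_cancel₀ (mul_ne_zero two_ne_zero ha)]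
      rw [this, neg_one_smul]
      abel
    rw [e1]
    exact Submodule.sub_mem _ (divDiv_mem_P h2) (Submodule.smul_mem _ _ (divDiv_xxT_mem_P h1))
  have h8 := Submodule.sub_mem _ (divDiv_mem_orthP1 hl hkl h3) hf
  have h9 : divDiv σ - f ∈ (sigmaBubble K N (m + 3) (m + 3)).map divDiv := by
    rw [map_divDiv_eq_of_le (by omega) le_rfl]
    exact ⟨h7, h8.2⟩
  obtain ⟨ρ, hρ, hρf⟩ := h9
  refine ⟨σ - ρ, Submodule.sub_mem _ h3 ?_, by rw [map_sub, hρf, sub_sub_cancel]⟩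
  obtain ⟨h10, h11⟩ := (mem_sigmaBubble hl (by omega)).1 hρ
  exact (mem_sigmaBubble hl hkl).2 ⟨shape_mono (by omega) h10, h11⟩

end

end DivDiv

/-! ### Hilbert space structures, injectivity of `dev grad`, and assembly of the complex. -/

namespace DivDiv

open MeasureTheory MvPolynomial
open scoped Matrix

noncomputable section

/-! ### Finite-dimensional Hilbert spaces -/

theorem isHilbert_of_posDef {M : Type*} [AddCommGroup M] [Module ℝ M] {ip : M → M → ℝ}
    (V : Submodule ℝ M) [FiniteDimensional ℝ V] (symm : ∀ x y, ip x y = ip y x)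
    (add : ∀ x y z, ip (x + y) z = ip x z + ip y z)
    (smul : ∀ (r : ℝ) x y, ip (r • x) y = r * ip x y) (nonneg : ∀ x, 0 ≤ ip x x)
    (definite : ∀ x, ip x x = 0 → x = 0) : IsHilbert ip V := by
  let c : InnerProductSpace.Core ℝ V :=
    { inner := fun x y => ip x y
      conj_inner_symm := fun x y => symm y x
      re_inner_nonneg := fun x => nonneg x
      add_left := fun x y z => add x y z
      smul_left := fun x y r => smul r x y
      definite := fun x hx => Subtype.ext (definite x hx) }
  refine ⟨c, fun _ _ => rfl, ?_⟩
  let _ : NormedAddCommGroup V := c.toNormedAddCommGroup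
  let _ : InnerProductSpace ℝ V := InnerProductSpace.ofCore c.toCore
  exact FiniteDimensional.complete ℝ V

theorem Tetra.volInt_sq_nonneg (K : Tetra) (p : Poly) : 0 ≤ K.volInt (p * p) :=
  integral_nonneg fun x => by
    rw [map_mul]
    exact mul_self_nonneg _

theorem isHilbert_innerS (K : Tetra) (V : Submodule ℝ Poly) [FiniteDimensional ℝ V] :
    IsHilbert (innerS K) V :=
  isHilbert_of_posDef V (fun x y => by rw [innerS, innerS, mul_comm])
    (fun x y z => by rw [innerS, innerS, innerS, add_mul, map_add])
    (fun r x y => by rw [innerS, innerS, smul_mul_assoc, map_smul, smul_eq_mul])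
    (fun x => K.volInt_sq_nonneg x) fun x hx => K.eq_zero_of_volInt_sq hx

theorem isHilbert_innerV (K : Tetra) (V : Submodule ℝ PVec) [FiniteDimensional ℝ V] :
    IsHilbert (innerV K) V := by
  have h : ∀ x, innerV K x x = ∑ i, K.volInt (x i * x i) := fun x => map_sum _ _ _
  refine isHilbert_of_posDef V (fun x y => ?_) (fun x y z => ?_) (fun r x y => ?_) (fun x => ?_)
    fun x hx => ?_
  · simp only [innerV, mul_comm]
  · simp only [innerV, Pi.add_apply, add_mul, Finset.sum_add_distrib, map_add]
  · simp only [innerV, Pi.smul_apply, smul_mul_assoc, ← Finset.smul_sum, map_smul, smul_eq_mul]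
  · rw [h]
    exact Finset.sum_nonneg fun i _ => K.volInt_sq_nonneg _
  · rw [h, Finset.sum_eq_zero_iff_of_nonneg fun i _ => K.volInt_sq_nonneg _] at hx
    exact funext fun i => K.eq_zero_of_volInt_sq (hx i (Finset.mem_univ i))

theorem isHilbert_innerM (K : Tetra) (V : Submodule ℝ PMat) [FiniteDimensional ℝ V] :
    IsHilbert (innerM K) V := by
  have h : ∀ x, innerM K x x = ∑ i, ∑ j, K.volInt (x i j * x i j) := fun x => by
    simp only [innerM, map_sum]
  refine isHilbert_of_posDef V (fun x y => ?_) (fun x y z => ?_) (fun r x y => ?_) (fun x => ?_)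
    fun x hx => ?_
  · simp only [innerM, mul_comm]
  · simp only [innerM, Matrix.add_apply, add_mul, Finset.sum_add_distrib, map_add]
  · simp only [innerM, Matrix.smul_apply, smul_mul_assoc, ← Finset.smul_sum, map_smul,
      smul_eq_mul]
  · rw [h]
    exact Finset.sum_nonneg fun i _ => Finset.sum_nonneg fun j _ => K.volInt_sq_nonneg _
  · rw [h] at hx
    ext1 i j
    have h1 := (Finset.sum_eq_zero_iff_of_nonneg fun i _ => Finset.sum_nonneg fun j _ =>
      K.volInt_sq_nonneg (x i j)).1 hx i (Finset.mem_univ i)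
    have h2 := (Finset.sum_eq_zero_iff_of_nonneg fun j _ =>
      K.volInt_sq_nonneg (x i j)).1 h1 j (Finset.mem_univ j)
    exact K.eq_zero_of_volInt_sq h2

instance finiteDimensional_PV (m : ℕ) : FiniteDimensional ℝ (PV m) := by
  let φ : PV m →ₗ[ℝ] Fin 3 → P m := LinearMap.pi fun i =>
    ((LinearMap.proj i).comp (PV m).subtype).codRestrict (P m) fun v => v.2 i
  refine FiniteDimensional.of_injective φ fun v w h => Subtype.ext (funext fun i => ?_)
  exact congrArg Subtype.val (congrFun h i)

instance finiteDimensional_PT (m : ℕ) : FiniteDimensional ℝ (PT m) := by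
  let φ : PT m →ₗ[ℝ] Fin 3 → PV m := LinearMap.pi fun i =>
    ((LinearMap.proj (φ := fun _ => PVec) i).comp (PT m).subtype).codRestrict (PV m)
      fun v => v.2.1 i
  refine FiniteDimensional.of_injective φ fun v w h => Subtype.ext (funext fun i => ?_)
  exact congrArg Subtype.val (congrFun h i)

/-! ### The maps of the bubble complex -/

/-- A coordinate direction is a combination of edge directions. An edge crosses two faces, and `u`
supplies the factor for one face, `v` for the other. -/
theorem Tetra.volInt_pderiv_mul (K : Tetra) {u v : Poly} (hu : ∀ d, K.bary d ∣ u)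
    (hv : ∀ d, K.bary d ∣ v) (j : Fin 3) : K.volInt (pderiv j (u * v)) = 0 := by
  have h : pderiv j (u * v) = dirD (Pi.single j 1) (u * v) := by
    simp [dirD_apply, Pi.single_apply]
  have h1 : ∀ a, K.volInt (dirD (K.tan 1 a) (u * v)) = 0 := fun a => by
    obtain ⟨x, hx⟩ := hu ((1 : Equiv.Perm (Fin 4)) a.succ)
    obtain ⟨y, hy⟩ := hv ((1 : Equiv.Perm (Fin 4)) 0)
    rw [hx, hy, mul_mul_mul_comm]
    exact K.volInt_dirD _
  rw [h, K.eq_sum_tan 1 (Pi.single j 1)]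
  have h2 : ∀ (c : Fin 3 → ℝ), dirD (∑ a, c a • K.tan 1 a) (u * v) =
      ∑ a, c a • dirD (K.tan 1 a) (u * v) := fun c => by
    simp only [Fin.sum_univ_three, dirD_add_left, dirD_smul_left, smul_eq_C_mul]
  rw [h2, map_sum]
  simp only [map_smul, h1, smul_zero, Finset.sum_const_zero]

/-- An off-diagonal entry says that `v i` does not depend on some `x_j`. Then `(v i)²` is the
`j`-derivative of `(v i)² x_j`, which vanishes on the boundary, so its integral is zero. -/
theorem eq_zero_of_devGrad_eq_zero {K : Tetra} {m : ℕ} {v : PVec} (hv : v ∈ vecBubble K m)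
    (h : devGrad v = 0) : v = 0 := by
  obtain ⟨-, hv⟩ := mem_vecBubble.1 hv
  funext i
  obtain ⟨j, hij⟩ := exists_ne i
  have h1 : pderiv j (v i) = 0 := by
    have h2 : dev (gradV v) i j = 0 := congrFun (congrFun h i) j
    rw [dev, Matrix.sub_apply, Matrix.smul_apply, Matrix.one_apply_ne hij.symm, smul_zero,
      sub_zero] at h2
    exact h2
  have h3 := K.volInt_pderiv_mul (fun d => hv d i) (fun d => (hv d i).mul_right (X j)) j
  have h4 : pderiv j (v i * (v i * X j)) = v i * v i := by
    rw [pderiv_mul, pderiv_mul, h1, pderiv_X_self]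
    ring
  rw [h4] at h3
  exact K.eq_zero_of_volInt_sq h3

section Complex

variable {K : Tetra} {N : EdgeNormals K} {k l : ℕ}

theorem symCurl_mem_sigmaBubble (hl : 3 ≤ l) (hkl : k ≤ l + 1) {τ : PMat}
    (hτ : τ ∈ symCurlBubble K (l + 1)) : symCurl τ ∈ sigmaBubble K N l k := by
  obtain ⟨h1, h2⟩ := mem_symCurlBubble.1 hτ
  exact (mem_sigmaBubble hl hkl).2
    ⟨mem_shape.2 ⟨τ, h1, 0, Submodule.zero_mem _, by rw [map_zero, add_zero]⟩,
      K.traceFree_symCurl h2⟩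

/-- In the kernel of `div div` the summand `x xᵀ q` must vanish; the remaining potential is
corrected by a deviatoric gradient, invisible to `sym curl`, so that its traces vanish. -/
theorem map_symCurl_eq (hl : 3 ≤ l) (hkl : k ≤ l + 1) :
    (symCurlBubble K (l + 1)).map symCurl = sigmaBubble K N l k ⊓ LinearMap.ker divDiv := by
  ext σ
  constructor
  · rintro ⟨τ, hτ, rfl⟩
    exact ⟨symCurl_mem_sigmaBubble hl hkl hτ, divDiv_symCurl τ⟩
  · rintro ⟨hσ, hd⟩
    obtain ⟨hs, ht⟩ := (mem_sigmaBubble hl hkl).1 hσ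
    obtain ⟨τ, hτ, q, -, rfl⟩ := mem_shape.1 hs
    replace hd := LinearMap.mem_ker.1 hd
    rw [map_add, divDiv_symCurl, zero_add] at hd
    rw [divDiv_xxT_injective hd, map_zero, add_zero] at ht ⊢
    obtain ⟨m, rfl⟩ := Nat.exists_eq_add_of_le' hl
    obtain ⟨v, -, hv⟩ := exists_symCurlBubble_add (m := m + 2) hτ ht
    exact ⟨_, hv, by rw [map_sub, symCurl_devGrad, sub_zero]⟩

end Complex

end

end DivDiv

theorem mainTheorem4 (K : DivDiv.Tetra) (N : DivDiv.EdgeNormals K) (k l : ℕ)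
    (hk : 3 ≤ k) (hl : max (k - 1) 3 ≤ l) :
    DivDiv.vecBubble K (l + 2) = DivDiv.bubbleTimes K (l - 2) ∧
    (DivDiv.IsHilbert (DivDiv.innerV K) (DivDiv.vecBubble K (l + 2)) ∧
      DivDiv.IsHilbert (DivDiv.innerM K) (DivDiv.symCurlBubble K (l + 1)) ∧
      DivDiv.IsHilbert (DivDiv.innerM K) (DivDiv.sigmaBubble K N l k) ∧
      DivDiv.IsHilbert (DivDiv.innerS K) (DivDiv.orthP1 K (k - 2))) ∧
    (∃ (d₀ : DivDiv.vecBubble K (l + 2) →ₗ[ℝ] DivDiv.symCurlBubble K (l + 1))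
      (d₁ : DivDiv.symCurlBubble K (l + 1) →ₗ[ℝ] DivDiv.sigmaBubble K N l k)
      (d₂ : DivDiv.sigmaBubble K N l k →ₗ[ℝ] DivDiv.orthP1 K (k - 2)),
      (∀ v, (d₀ v : DivDiv.PMat) = DivDiv.devGrad v) ∧
      (∀ τ, (d₁ τ : DivDiv.PMat) = DivDiv.symCurl τ) ∧
      (∀ σ, (d₂ σ : DivDiv.Poly) = DivDiv.divDiv σ) ∧
      Function.Injective d₀ ∧ Function.Exact d₀ d₁ ∧ Function.Exact d₁ d₂ ∧
      Function.Surjective d₂) ∧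
    (DivDiv.symCurlBubble K (l + 1)).map DivDiv.symCurl =
      DivDiv.sigmaBubble K N l k ⊓ LinearMap.ker DivDiv.divDiv := by
  have hl3 : 3 ≤ l := (le_max_right _ _).trans hl
  have hkl : k ≤ l + 1 := by
    have := (le_max_left _ _).trans hl
    omega
  have hker := DivDiv.map_symCurl_eq (K := K) (N := N) hl3 hkl
  refine ⟨?_, ⟨?_, ?_, ?_, ?_⟩, ?_, hker⟩
  · obtain ⟨n, rfl⟩ := Nat.exists_eq_add_of_le' (show 2 ≤ l by omega)
    exact DivDiv.vecBubble_eq K n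
  · have := Submodule.finiteDimensional_of_le (show DivDiv.vecBubble K (l + 2) ≤ _ from
      fun _ h => h.1)
    exact DivDiv.isHilbert_innerV K _
  · have := Submodule.finiteDimensional_of_le (show DivDiv.symCurlBubble K (l + 1) ≤ _ from
      fun _ h => h.1)
    exact DivDiv.isHilbert_innerM K _
  · have : FiniteDimensional ℝ (DivDiv.shape l k) := Submodule.finite_sup _ _
    have := Submodule.finiteDimensional_of_le (show DivDiv.sigmaBubble K N l k ≤ _ from
      fun _ h => h.1)
    exact DivDiv.isHilbert_innerM K _
  · have := Submodule.finiteDimensional_of_le (show DivDiv.orthP1 K (k - 2) ≤ _ from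
      fun _ h => h.1)
    exact DivDiv.isHilbert_innerS K _
  · refine ⟨DivDiv.devGrad.restrict fun _ h => DivDiv.devGrad_mem_symCurlBubble h,
      DivDiv.symCurl.restrict fun _ h => DivDiv.symCurl_mem_sigmaBubble hl3 hkl h,
      DivDiv.divDiv.restrict fun _ h => DivDiv.divDiv_mem_orthP1 hl3 hkl h,
      fun _ => rfl, fun _ => rfl, fun _ => rfl, ?_, fun τ => ?_, fun σ => ?_, fun f => ?_⟩
    · rw [injective_iff_map_eq_zero]
      exact fun v hv => Subtype.ext
        (DivDiv.eq_zero_of_devGrad_eq_zero v.2 (congrArg Subtype.val hv))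
    · constructor
      · intro h
        obtain ⟨v, hv, hvτ⟩ := DivDiv.exists_vecBubble_devGrad_eq τ.2 (congrArg Subtype.val h)
        exact ⟨⟨v, hv⟩, Subtype.ext hvτ⟩
      · rintro ⟨v, rfl⟩
        exact Subtype.ext (DivDiv.symCurl_devGrad v)
    · constructor
      · intro h
        obtain ⟨τ, hτ, hτσ⟩ := hker.ge ⟨σ.2, congrArg Subtype.val h⟩
        exact ⟨⟨τ, hτ⟩, Subtype.ext hτσ⟩
      · rintro ⟨τ, rfl⟩
        exact Subtype.ext (DivDiv.divDiv_symCurl τ)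
    · obtain ⟨σ, hσ, hσf⟩ := (DivDiv.map_divDiv_eq (N := N) hk hl3 hkl).ge f.2
      exact ⟨⟨σ, hσ⟩, Subtype.ext hσf⟩
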